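/- Let $T>0$ and let $\Gamma_t=\Phi(\Gamma_0,t)\subset\mathbb R^{n+1}$, $t\in[0,T]$, be a moving closed (compact, without boundary) smooth hypersurface, where $\Phi:\Gamma_0\times[0,T]\to\mathbb R^{n+1}$ is smooth, $\Phi(\cdot,0)=\mathrm{Id}$ and each $\Phi(\cdot,t):\Gamma_0\to\Gamma_t$ is a diffeomorphism. Put $v=\partial_t\Phi\circ\Phi^{-1}$ and $G_T=\bigcup_{t\in(0,T)}\Gamma_t\times\{t\}$. For functions on the space-time surface let $\nabla_\Gamma g=\nabla\bar g-(\nabla\bar g\cdot\nu)\nu$ ($\bar g$ an extension, $\nu$ a unit normal), $\nabla_\Gamma\cdot w=\sum_j(\nabla_\Gamma w_j)_j$, $\Delta_\Gamma g=\nabla_\Gamma\cdot\nabla_\Gamma g$, and $\dot g=\partial_tg+v\cdot\nabla g$; integrals over $\Gamma_t$ are with respect to surface measure, and $G_T$ carries the measure $\int_0^T\int_{\Gamma_t}$. Let $f=f((x,t),s)\in\mathbb R^{n+1}$ be smooth in $(x,t)\in\overline{G_T}$ and $s\in\mathbb R$, tangent to $\Gamma_t$ at $x$, and with $\nabla_\Gamma\cdot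 f((\cdot,t),s)=0$ on $\Gamma_t$ for all fixed $t\in[0,T]$, $s\in\mathbb R$. Let $\Lambda\subset(0,1]$ have $0$ as an accumulation point (for instance $\Lambda=(0,1]$, or a sequence tending to $0$). For $\varepsilon\in\Lambda$ let $u_{0\varepsilon}$ be measurable on $\Gamma_0$ with $\|u_{0\varepsilon}\|_{L^\infty(\Gamma_0)}\le c_0$, with $c_0$ independent of $\varepsilon$, and let $u_\varepsilon$ be a smooth solution of $$\dot u_\varepsilon+u_\varepsilon\nabla_\Gamma\cdot v+\nabla_\Gamma\cdot f(\cdot,u_\varepsilon)-\varepsilon\Delta_\Gamma u_\varepsilon=0\ \text{ on }G_T,\qquad u_\varepsilon(\cdot,0)=u_{0\varepsilon}\ \text{ on }\Gamma_0,$$ where $\nabla_\Gamma\cdot f(\cdot,u_\varepsilon)$ is the total divergence of $x\mapsto f((x,t),u_\varepsilon(x,t))$ and the initial condition means $u_\varepsilon(\Phi(\cdot,t),t)\to u_{0\varepsilon}$ in $L^1(\Gamma_0)$ as $t\downarrow0$. Suppose that, as $\varepsilon\to0$ in $\Lambda$, $u_\varepsilon\to u$ a.e. on $G_T$ and $u_{0\varepsilon}\to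 u_0$ a.e. on $\Gamma_0$, with $u\in L^1(G_T)$ and $u_0\in L^\infty(\Gamma_0)$. Then for every $\eta\in C^2(\mathbb R)$ with $\eta''\ge0$, every $s_0\in\mathbb R$, with $q(\cdot,s)=\int_{s_0}^s\eta'(\tau)f_u(\cdot,\tau)\,d\tau$ (where $f_u$ is the derivative of $f$ in its last argument), and for every $\phi\in H^1(G_T)$ with $\phi\ge0$ a.e. and $\phi(\cdot,T)=0$ (in the sense of traces), the integrals below exist and $$-\int_{\Gamma_0}\eta(u_0)\phi(\cdot,0)+\int_0^T\int_{\Gamma_t}\Big(-\eta(u)\dot\phi-q(\cdot,u)\cdot\nabla_\Gamma\phi+\nabla_\Gamma\cdot v\,\big(u\eta'(u)-\eta(u)\big)\phi\Big)\le0.$$ Here $H^1(G_T)$ is the closure of the smooth functions on $\overline{G_T}$ in the norm $\big(\|\phi\|_{L^2(G_T)}^2+\|\dot\phi\|_{L^2(G_T)}^2+\|\nabla_\Gamma\phi\|_{L^2(G_T)}^2\big)^{1/2}$, and $\dot\phi$, $\nabla_\Gamma\phi$ and $\phi(\cdot,0)$ denote the corresponding weak derivatives and trace. -/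

import Mathlib

open Set Filter Topology MeasureTheory
open scoped ContDiff

noncomputable section

namespace MovingSurface

/-- The ambient Euclidean space `ℝⁿ⁺¹`. -/
abbrev Amb (n : ℕ) : Type := EuclideanSpace ℝ (Fin (n + 1))

/-- A function is smooth on an arbitrary subset `S` of a normed space if near each point of `S`
it is the restriction of a smooth function. -/
def SmoothOnSet {X Y : Type*} [NormedAddCommGroup X] [NormedSpace ℝ X]
    [NormedAddCommGroup Y] [NormedSpace ℝ Y] (S : Set X) (g : X → Y) : Prop :=
  ∀ p ∈ S, ∃ G : X → Y, ContDiff ℝ ∞ G ∧ ∀ᶠ q in 𝓝[S] p, G q = g q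

/-- Closed (compact, without boundary) smooth embedded hypersurface of `ℝⁿ⁺¹`: a compact set which
near each of its points is flattened to `ℝⁿ × {0}` by a local diffeomorphism of the ambient
space. -/
def IsClosedHypersurface {n : ℕ} (S : Set (Amb n)) : Prop :=
  IsCompact S ∧ ∀ p ∈ S, ∃ e : OpenPartialHomeomorph (Amb n) (EuclideanSpace ℝ (Fin n) × ℝ),
    p ∈ e.source ∧ ContDiffOn ℝ ∞ e e.source ∧ ContDiffOn ℝ ∞ e.symm e.target ∧
      ∀ y ∈ e.source, y ∈ S ↔ (e y).2 = 0

/-- The tangent space of `S` at `x`, as a linear subspace of the ambient space. -/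
def tangentSpaceAt {n : ℕ} (S : Set (Amb n)) (x : Amb n) : Submodule ℝ (Amb n) :=
  Submodule.span ℝ (tangentConeAt ℝ S x)

/-- The tangential gradient `∇_Γ g = ∇ḡ - (∇ḡ · ν) ν`: the orthogonal projection to the tangent
space of the gradient of an extension. Any derivative of `g` within `S` at `x` (in particular the
derivative of any differentiable extension) has the same restriction to the tangent space. -/
def tangGrad {n : ℕ} (S : Set (Amb n)) (g : Amb n → ℝ) (x : Amb n) : Amb n :=
  (tangentSpaceAt S x).starProjection (gradientWithin g S x)

/-- The tangential divergence `∇_Γ · w = ∑ⱼ Dⱼ wⱼ`, where `Dⱼ` is the `j`-th component of the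
tangential gradient. -/
def tangDiv {n : ℕ} (S : Set (Amb n)) (w : Amb n → Amb n) (x : Amb n) : ℝ :=
  ∑ j, tangGrad S (fun y => w y j) x j

/-- The Laplace-Beltrami operator `Δ_Γ g = ∇_Γ · ∇_Γ g`. -/
def laplaceBeltrami {n : ℕ} (S : Set (Amb n)) (g : Amb n → ℝ) (x : Amb n) : ℝ :=
  tangDiv S (tangGrad S g) x

/-- The surface measure of an `n`-dimensional surface in `ℝⁿ⁺¹`. -/
def surfaceMeasure {n : ℕ} (S : Set (Amb n)) : Measure (Amb n) :=
  (μHE[n] : Measure (Amb n)).restrict S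

end MovingSurface

open MovingSurface

/-- A moving closed smooth hypersurface `Γ(t) = Φ(Γ₀, t) ⊆ ℝⁿ⁺¹`, `t ∈ [0, T]`: the map `Φ` is smooth
on `Γ₀ × [0, T]`, `Φ(·, 0)` is the identity and each `Φ(·, t) : Γ₀ → Γ(t)` is a diffeomorphism.
The values of `Φ` off `Γ₀ × [0, T]` are irrelevant. -/
structure MovingHypersurface (n : ℕ) (T : ℝ) where
  Γ₀ : Set (Amb n)
  Φ : Amb n × ℝ → Amb n
  smooth : SmoothOnSet (Γ₀ ×ˢ Icc 0 T) Φ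
  initial : ∀ p ∈ Γ₀, Φ (p, 0) = p
  hypersurface : ∀ t ∈ Icc 0 T, IsClosedHypersurface ((fun p => Φ (p, t)) '' Γ₀)
  injOn : ∀ t ∈ Icc 0 T, InjOn (fun p => Φ (p, t)) Γ₀
  smooth_inv : ∀ t ∈ Icc 0 T,
    SmoothOnSet ((fun p => Φ (p, t)) '' Γ₀) (Function.invFunOn (fun p => Φ (p, t)) Γ₀)

namespace MovingHypersurface

variable {n : ℕ} {T : ℝ} (M : MovingHypersurface n T)

/-- The surface `Γ(t)`. -/
def Γ (t : ℝ) : Set (Amb n) := (fun p => M.Φ (p, t)) '' M.Γ₀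

/-- The space-time surface `G_T = ⋃_{t ∈ (0, T)} Γ(t) × {t}`. -/
def G : Set (Amb n × ℝ) := {p | p.2 ∈ Ioo 0 T ∧ p.1 ∈ M.Γ p.2}

/-- The closed space-time surface `⋃_{t ∈ [0, T]} Γ(t) × {t}`. -/
def Gbar : Set (Amb n × ℝ) := {p | p.2 ∈ Icc 0 T ∧ p.1 ∈ M.Γ p.2}

/-- The velocity `v = ∂ₜΦ ∘ Φ⁻¹` of the material points. -/
def v (p : Amb n × ℝ) : Amb n :=
  derivWithin (fun s => M.Φ (Function.invFunOn (fun y => M.Φ (y, p.2)) M.Γ₀ p.1, s)) (Icc 0 T) p.2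

/-- The tangential gradient `∇_Γ g` on `Γ(t)` of a function `g` on the space-time surface. -/
def grad (g : Amb n × ℝ → ℝ) (p : Amb n × ℝ) : Amb n :=
  tangGrad (M.Γ p.2) (fun y => g (y, p.2)) p.1

/-- The tangential divergence `∇_Γ · w` on `Γ(t)` of a vector field `w` on the space-time
surface. -/
def div (w : Amb n × ℝ → Amb n) (p : Amb n × ℝ) : ℝ :=
  tangDiv (M.Γ p.2) (fun y => w (y, p.2)) p.1

/-- The Laplace-Beltrami operator `Δ_Γ g` on `Γ(t)` of a function on the space-time surface. -/
def lap (g : Amb n × ℝ → ℝ) (p : Amb n × ℝ) : ℝ :=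
  laplaceBeltrami (M.Γ p.2) (fun y => g (y, p.2)) p.1

/-- The material derivative `ġ = ∂ₜg + v · ∇g` of a function on the space-time surface: the
derivative of (an extension of) `g` in the direction `(v, 1)`, which is tangent to `G_T`. -/
def materialDeriv (g : Amb n × ℝ → ℝ) (p : Amb n × ℝ) : ℝ :=
  fderivWithin ℝ g M.G p (M.v p, 1)

/-- The surface measure on `Γ(t)`. -/
def σ (t : ℝ) : Measure (Amb n) := surfaceMeasure (M.Γ t)

/-- The measure on the space-time surface `G_T` whose integral is `∫₀ᵀ ∫_{Γ(t)}`. -/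
def μ : Measure (Amb n × ℝ) :=
  (volume.restrict (Ioo 0 T)).bind fun t => (M.σ t).map fun x => (x, t)

/-- `f = f((x, t), s)` is an admissible flux: smooth on the closed space-time surface times `ℝ`,
tangent to `Γ(t)`, and tangentially divergence free for fixed `t` and `s`. -/
structure IsFlux (f : Amb n × ℝ → ℝ → Amb n) : Prop where
  smooth : SmoothOnSet (M.Gbar ×ˢ (univ : Set ℝ)) (fun z : (Amb n × ℝ) × ℝ => f z.1 z.2)
  tangent : ∀ p ∈ M.Gbar, ∀ s, f p s ∈ tangentSpaceAt (M.Γ p.2) p.1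
  div_free : ∀ p ∈ M.Gbar, ∀ s, M.div (fun z => f z s) p = 0

/-- `w` is a smooth solution of
`ẇ + w ∇_Γ · v + ∇_Γ · f(·, w) - ε Δ_Γ w = 0` on `G_T`, `w(·, 0) = w₀` on `Γ₀`.
The divergence of `f(·, w)` is the total one. As `G_T` only contains times in `(0, T)`, the initial
values are attained as limits, in `L¹(Γ₀)` along the material trajectories. -/
structure IsViscousSolution (f : Amb n × ℝ → ℝ → Amb n) (ε : ℝ) (w : Amb n × ℝ → ℝ)
    (w₀ : Amb n → ℝ) : Prop where
  smooth : SmoothOnSet M.G w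
  pde : ∀ p ∈ M.G, M.materialDeriv w p + w p * M.div M.v p + M.div (fun z => f z (w z)) p
    - ε * M.lap w p = 0
  initial : Tendsto (fun t => eLpNorm (fun p => w (M.Φ (p, t), t) - w₀ p) 1 (M.σ 0))
    (𝓝[>] 0) (𝓝 0)

/-- `φ ∈ H¹(G_T)`, with weak material derivative `φdot`, weak tangential gradient `φgrad`, trace
`φ₀` at `t = 0` and trace `φT` at `t = T`; here `H¹(G_T)` is the closure of the smooth functions
on the closed space-time surface in the norm
`(‖φ‖² + ‖φ̇‖² + ‖∇_Γ φ‖²)^{1/2}` with norms in `L²(G_T)`. -/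
structure IsH1 (φ φdot : Amb n × ℝ → ℝ) (φgrad : Amb n × ℝ → Amb n) (φ₀ φT : Amb n → ℝ) :
    Prop where
  memLp : MemLp φ 2 M.μ
  memLp_dot : MemLp φdot 2 M.μ
  memLp_grad : MemLp φgrad 2 M.μ
  memLp_initial : MemLp φ₀ 2 (M.σ 0)
  memLp_final : MemLp φT 2 (M.σ T)
  approx : ∃ ψ : ℕ → Amb n × ℝ → ℝ, (∀ k, ContDiff ℝ ∞ (ψ k)) ∧
    Tendsto (fun k => eLpNorm (fun p => ψ k p - φ p) 2 M.μ) atTop (𝓝 0) ∧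
    Tendsto (fun k => eLpNorm (fun p => M.materialDeriv (ψ k) p - φdot p) 2 M.μ) atTop (𝓝 0) ∧
    Tendsto (fun k => eLpNorm (fun p => M.grad (ψ k) p - φgrad p) 2 M.μ) atTop (𝓝 0) ∧
    Tendsto (fun k => eLpNorm (fun x => ψ k (x, 0) - φ₀ x) 2 (M.σ 0)) atTop (𝓝 0) ∧
    Tendsto (fun k => eLpNorm (fun x => ψ k (x, T) - φT x) 2 (M.σ T)) atTop (𝓝 0)

end MovingHypersurface

/-- The entropy flux `q(·, s) = ∫_{s₀}^s η'(τ) f_u(·, τ) dτ` of the entropy `η`. -/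
def entropyFlux {n : ℕ} (η : ℝ → ℝ) (f : Amb n × ℝ → ℝ → Amb n) (s₀ : ℝ) (p : Amb n × ℝ) (s : ℝ) :
    Amb n :=
  ∫ τ in s₀..s, deriv η τ • deriv (f p) τ

end

open MovingSurface

/-! The inequality is inherited from the viscous solutions. Multiply the viscous equation by
`η'(u_ε) ψ`, with `ψ ≥ 0` smooth, and integrate over `Γ(t)`. By the divergence theorem the diffusion
term becomes `ε ∫ η(u_ε) Δ_Γ ψ` minus `ε ∫ η''(u_ε) |∇_Γ u_ε|² ψ`, and convexity lets the second
integral be dropped (`IsParamSurface.integral_laplace_le`). Since `f(·, s)` is tangential and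
divergence free, the flux term becomes `-∫ q(·, u_ε) · ∇_Γ ψ` (`IsParamSurface.integral_flux`). The
time derivative is handled by the transport theorem (`integral_mul_J_sub`). As all derivatives now
fall on `ψ`, the limit `ε → 0` needs no bound on `∇_Γ u_ε`: almost everywhere convergence and a
uniform bound on `|u_ε|` suffice.

The uniform bound is a maximum principle (`IsViscousSolution.exists_bound`). The same entropy
computation, with test function `1` and smooth convex approximations of `(±s - k(t))⁺`, shows that
nothing of `±u_ε` rises above the barrier `k(t) = k₀ exp(B t)`, where `B` bounds `|∇_Γ · v|`.

All space-time analysis takes place on the fixed cylinder `Γ₀ × (0, T)`. The map `Ψ(p, t) = (Φ(p,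
t), t)` carries the product measure with density `J = exp ∫ ∇_Γ · v` to the measure of `G_T`
(`σ_eq_map`, `μ_eq_map`). This rests on the area formula in charts and on Liouville's formula
(`jac_chart`). Along trajectories the material derivative is an ordinary time derivative.

Passing from smooth `ψ` to `φ ∈ H¹` meets two obstacles: the smooth approximations of `φ` need be
neither nonnegative nor zero at time `T`. The second is met by proving the smooth inequality with an
error `C ∫ ψ(·, T)`, where `C` bounds the entropy on the range of the solutions. For the first, the
approximations are composed with a smooth nonnegative function `θ` that is a translation on `[0, ∞)`
and satisfies `θ(s) ≥ s`. The initial term then has the right sign provided that the entropy is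
nonpositive at `u₀` (`IsH1.integral_le_zero`). This is arranged by subtracting a constant from `η`.
The subtraction is harmless, because for constant entropies the inequality is an identity,
conservation of mass for `φ` (`IsH1.integral_transport`). -/

noncomputable section

namespace MovingSurface

/-! ### Gram operators, Jacobians and pseudo-inverses of injective linear maps -/

section LinearAlgebra

variable {E F : Type*} [NormedAddCommGroup E] [InnerProductSpace ℝ E] [FiniteDimensional ℝ E]
  [NormedAddCommGroup F] [InnerProductSpace ℝ F] [FiniteDimensional ℝ F]

/-- The determinant of continuous endomorphisms is smooth. -/
theorem contDiff_clm_det {k : WithTop ℕ∞} :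
    ContDiff ℝ k (fun A : E →L[ℝ] E => A.det) := by
  let b := Module.finBasis ℝ E
  have h : (fun A : E →L[ℝ] E => A.det) =
      fun A : E →L[ℝ] E => (LinearMap.toMatrix b b (A : E →ₗ[ℝ] E)).det := by
    ext A; rw [LinearMap.det_toMatrix]
  rw [h]
  simp only [Matrix.det_apply]
  refine ContDiff.sum fun σ _ => ContDiff.const_smul _ (contDiff_prod fun i _ => ?_)
  let l : (E →L[ℝ] E) →ₗ[ℝ] ℝ :=
    { toFun := fun A => LinearMap.toMatrix b b (A : E →ₗ[ℝ] E) (σ i) i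
      map_add' := fun A B => by simp
      map_smul' := fun c A => by simp }
  exact (LinearMap.toContinuousLinearMap l).contDiff

/-- As `G` is invertible, `det (G + r K) = det G * det (1 + r N)` with `N = G⁻¹ K`, and the last
determinant is `1 + r tr N` up to a multiple of `r²`. -/
theorem hasDerivAt_det_line (G K : E →L[ℝ] E) (hG : IsUnit G) :
    HasDerivAt (fun r : ℝ => (G + r • K).det)
      (G.det * LinearMap.trace ℝ E ((Ring.inverse G * K : E →L[ℝ] E) : E →ₗ[ℝ] E)) 0 := by
  let b := Module.finBasis ℝ E
  set N : E →L[ℝ] E := Ring.inverse G * K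
  have hfac : ∀ r : ℝ, (G + r • K).det = G.det * (1 + r • LinearMap.toMatrix b b (N : E →ₗ[ℝ] E)).det := by
    intro r
    have h1 : G + r • K = G * (1 + r • N) := by
      rw [mul_add, mul_one, mul_smul_comm]
      congr 2
      rw [← mul_assoc, Ring.mul_inverse_cancel _ hG, one_mul]
    have h2 : (1 + r • LinearMap.toMatrix b b (N : E →ₗ[ℝ] E)) =
        LinearMap.toMatrix b b ((1 + r • N : E →L[ℝ] E) : E →ₗ[ℝ] E) := by
      have : ((1 + r • N : E →L[ℝ] E) : E →ₗ[ℝ] E) = 1 + r • (N : E →ₗ[ℝ] E) := rfl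
      rw [this, map_add, map_smul, LinearMap.toMatrix_one]
    rw [h2, LinearMap.det_toMatrix, h1]
    change LinearMap.det ((G : E →ₗ[ℝ] E) * ((1 + r • N : E →L[ℝ] E) : E →ₗ[ℝ] E)) = _
    rw [map_mul]
  have htr : LinearMap.trace ℝ E (N : E →ₗ[ℝ] E) =
      (LinearMap.toMatrix b b (N : E →ₗ[ℝ] E)).trace := by
    rw [LinearMap.trace_eq_matrix_trace ℝ b]
  rw [htr]
  have hdet : ∀ r : ℝ, (G + r • K).det = _ := fun r => by
    rw [hfac, Matrix.det_one_add_smul]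
  simp only [hdet]
  refine HasDerivAt.const_mul _ ?_
  set p := (Matrix.det (1 + (Polynomial.X : Polynomial ℝ) •
    (LinearMap.toMatrix b b (N : E →ₗ[ℝ] E)).map Polynomial.C)).divX.divX
  have h3 : HasDerivAt (fun r : ℝ => 1 + (LinearMap.toMatrix b b (N : E →ₗ[ℝ] E)).trace * r
      + p.eval r * r ^ 2) (0 + (LinearMap.toMatrix b b (N : E →ₗ[ℝ] E)).trace * 1 + (p.derivative.eval 0 * 0 ^ 2 + p.eval 0 * (2 * 0 ^ 1))) 0 := by
    refine ((hasDerivAt_const _ _).add ((hasDerivAt_id _).const_mul _)).add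
      ((p.hasDerivAt 0).mul ?_)
    simpa using hasDerivAt_pow 2 (0 : ℝ)
  simpa using h3

theorem fderiv_det (G K : E →L[ℝ] E) (hG : IsUnit G) :
    fderiv ℝ (fun A : E →L[ℝ] E => A.det) G K =
      G.det * LinearMap.trace ℝ E ((Ring.inverse G * K : E →L[ℝ] E) : E →ₗ[ℝ] E) := by
  have hd : DifferentiableAt ℝ (fun A : E →L[ℝ] E => A.det) (G + (0 : ℝ) • K) :=
    (contDiff_clm_det (k := 1)).differentiable one_ne_zero _
  have h1 : HasDerivAt (fun r : ℝ => G + r • K) K 0 := by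
    simpa using ((hasDerivAt_id (0 : ℝ)).smul_const K).const_add G
  have h2 := hd.hasFDerivAt.comp_hasDerivAt (0 : ℝ) h1
  have h3 := h2.unique (hasDerivAt_det_line G K hG)
  simpa using h3

theorem trace_adjoint (A : E →L[ℝ] E) :
    LinearMap.trace ℝ E (ContinuousLinearMap.adjoint A : E →L[ℝ] E) =
      LinearMap.trace ℝ E (A : E →ₗ[ℝ] E) := by
  rw [LinearMap.trace_eq_sum_inner _ (stdOrthonormalBasis ℝ E),
    LinearMap.trace_eq_sum_inner _ (stdOrthonormalBasis ℝ E)]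
  refine Finset.sum_congr rfl fun i _ => ?_
  simp only [ContinuousLinearMap.coe_coe]
  rw [ContinuousLinearMap.adjoint_inner_right, real_inner_comm]

/-- The adjoint as a real-linear continuous map. -/
def adjL : (E →L[ℝ] F) →L[ℝ] (F →L[ℝ] E) :=
  LinearMap.toContinuousLinearMap
    { toFun := fun B => ContinuousLinearMap.adjoint B
      map_add' := fun A B => map_add _ A B
      map_smul' := fun c B => by
        simp }

@[simp] theorem adjL_apply (B : E →L[ℝ] F) : adjL B = ContinuousLinearMap.adjoint B := rfl

/-- The Gram operator `B† B`. -/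
def gram (B : E →L[ℝ] F) : E →L[ℝ] E := (ContinuousLinearMap.adjoint B).comp B

/-- The Jacobian `√det (B† B)`. -/
def jac (B : E →L[ℝ] F) : ℝ := √(gram B).det

/-- The Moore-Penrose inverse `(B† B)⁻¹ B†` of an injective map. -/
def pinv (B : E →L[ℝ] F) : F →L[ℝ] E := (Ring.inverse (gram B)).comp (ContinuousLinearMap.adjoint B)

theorem inner_gram (B : E →L[ℝ] F) (a b : E) : inner ℝ (gram B a) b = inner ℝ (B a) (B b) := by
  simp [gram, ContinuousLinearMap.adjoint_inner_left]

theorem isUnit_gram {B : E →L[ℝ] F} (hB : Function.Injective B) : IsUnit (gram B) := by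
  rw [ContinuousLinearMap.isUnit_iff_bijective]
  have hi : Function.Injective (gram B : E →ₗ[ℝ] E) := by
    rw [← LinearMap.ker_eq_bot, LinearMap.ker_eq_bot']
    intro a ha
    have h1 : inner ℝ (gram B a) a = (0 : ℝ) := by
      change gram B a = 0 at ha
      rw [ha, inner_zero_left]
    rw [inner_gram, inner_self_eq_zero] at h1
    exact hB (by rw [h1, map_zero])
  exact ⟨hi, (LinearMap.injective_iff_surjective (f := (gram B : E →ₗ[ℝ] E))).1 hi⟩

theorem det_gram_eq_sq (B : E →L[ℝ] F) :
    (gram B).det = (B : E →ₗ[ℝ] F).normDet ^ 2 :=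
  (ContinuousLinearMap.normDet_sq B).symm

theorem jac_eq_normDet (B : E →L[ℝ] F) : jac B = (B : E →ₗ[ℝ] F).normDet := by
  rw [jac, det_gram_eq_sq, Real.sqrt_sq (LinearMap.normDet_nonneg _)]

theorem det_gram_pos {B : E →L[ℝ] F} (hB : Function.Injective B) : 0 < (gram B).det := by
  have h0 : (B : E →ₗ[ℝ] F).normDet ≠ 0 := by
    rw [Ne, LinearMap.normDet_eq_zero_iff_ker_ne_bot, not_not, LinearMap.ker_eq_bot]
    exact hB
  rw [det_gram_eq_sq]
  positivity

theorem jac_pos {B : E →L[ℝ] F} (hB : Function.Injective B) : 0 < jac B :=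
  Real.sqrt_pos.2 (det_gram_pos hB)

theorem contDiff_gram {k : WithTop ℕ∞} : ContDiff ℝ k (gram : (E →L[ℝ] F) → E →L[ℝ] E) :=
  (adjL.contDiff).clm_comp contDiff_id

theorem contDiffAt_jac {k : WithTop ℕ∞} {B : E →L[ℝ] F} (hB : Function.Injective B) :
    ContDiffAt ℝ k (jac : (E →L[ℝ] F) → ℝ) B :=
  ContDiffAt.sqrt (contDiff_clm_det.comp contDiff_gram).contDiffAt (det_gram_pos hB).ne'

theorem contDiffAt_pinv {k : WithTop ℕ∞} {B : E →L[ℝ] F} (hB : Function.Injective B) :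
    ContDiffAt ℝ k (pinv : (E →L[ℝ] F) → F →L[ℝ] E) B := by
  obtain ⟨g, hg⟩ := isUnit_gram hB
  refine ContDiffAt.clm_comp ?_ (adjL (E := E) (F := F)).contDiff.contDiffAt
  have h1 : ContDiffAt ℝ k Ring.inverse (gram B) := hg ▸ contDiffAt_ringInverse ℝ g
  exact h1.comp B contDiff_gram.contDiffAt

theorem pinv_apply_apply {B : E →L[ℝ] F} (hB : Function.Injective B) (a : E) :
    pinv B (B a) = a := by
  have := Ring.inverse_mul_cancel _ (isUnit_gram hB)
  exact DFunLike.congr_fun this a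

theorem gram_pinv {B : E →L[ℝ] F} (hB : Function.Injective B) (x : F) :
    gram B (pinv B x) = ContinuousLinearMap.adjoint B x := by
  have := Ring.mul_inverse_cancel _ (isUnit_gram hB)
  exact DFunLike.congr_fun this (ContinuousLinearMap.adjoint B x)

/-- These are the normal equations: `B† (x - B (pinv B x)) = 0`, so the residual is orthogonal to
the range of `B`. -/
theorem starProjection_range {B : E →L[ℝ] F} (hB : Function.Injective B) (x : F) :
    (LinearMap.range (B : E →ₗ[ℝ] F)).starProjection x = B (pinv B x) := by
  refine (Submodule.eq_starProjection_of_mem_of_inner_eq_zero ⟨_, rfl⟩ ?_)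
  rintro _ ⟨a, rfl⟩
  simp only [ContinuousLinearMap.coe_coe]
  rw [inner_sub_left, ← inner_gram, gram_pinv hB, ContinuousLinearMap.adjoint_inner_left, sub_self]

/-- Jacobi's formula. The derivative of `B† B` in direction `H` is `B† H + H† B`. After
multiplication by the self-adjoint `(B† B)⁻¹` both terms have the same trace, being adjoint to each
other up to a cyclic permutation; the resulting factor 2 cancels the one from the square root. -/
theorem fderiv_jac {B : E →L[ℝ] F} (hB : Function.Injective B) (H : E →L[ℝ] F) :
    fderiv ℝ (jac : (E →L[ℝ] F) → ℝ) B H =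
      jac B * LinearMap.trace ℝ E ((pinv B).comp H : E →L[ℝ] E) := by
  have hpos := det_gram_pos hB
  have hG : HasFDerivAt (gram : (E →L[ℝ] F) → E →L[ℝ] E) (fderiv ℝ gram B) B :=
    ((contDiff_gram (k := 1)).differentiable one_ne_zero B).hasFDerivAt
  have hG' : fderiv ℝ (gram : (E →L[ℝ] F) → E →L[ℝ] E) B H =
      (ContinuousLinearMap.adjoint B).comp H + (ContinuousLinearMap.adjoint H).comp B := by
    have := (adjL (E := E) (F := F)).hasFDerivAt (x := B) |>.clm_comp (hasFDerivAt_id B)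
    have h2 := this.fderiv
    change fderiv ℝ (fun y : E →L[ℝ] F => (adjL y).comp (id y)) B H = _
    rw [h2]
    simp
  have hdet : HasFDerivAt (fun A : E →L[ℝ] E => A.det) (fderiv ℝ (fun A : E →L[ℝ] E => A.det)
      (gram B)) (gram B) := ((contDiff_clm_det (k := 1)).differentiable one_ne_zero _).hasFDerivAt
  have h3 : HasFDerivAt (jac : (E →L[ℝ] F) → ℝ) _ B := (hdet.comp B hG).sqrt hpos.ne'
  rw [h3.fderiv]
  simp only [smul_apply, ContinuousLinearMap.comp_apply, smul_eq_mul,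
    Function.comp_apply]
  rw [fderiv_det _ _ (isUnit_gram hB), hG', mul_add]
  have e1 : LinearMap.trace ℝ E ((Ring.inverse (gram B) * ((ContinuousLinearMap.adjoint B).comp H) +
      Ring.inverse (gram B) * ((ContinuousLinearMap.adjoint H).comp B) : E →L[ℝ] E) : E →ₗ[ℝ] E)
      = 2 * LinearMap.trace ℝ E ((pinv B).comp H : E →L[ℝ] E) := by
    have e2 : LinearMap.trace ℝ E ((Ring.inverse (gram B) *
        ((ContinuousLinearMap.adjoint H).comp B) : E →L[ℝ] E) : E →ₗ[ℝ] E) =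
        LinearMap.trace ℝ E ((pinv B).comp H : E →L[ℝ] E) := by
      have hsa : ContinuousLinearMap.adjoint (Ring.inverse (gram B)) = Ring.inverse (gram B) := by
        have : ContinuousLinearMap.adjoint (gram B) = gram B := by
          simp [gram, ContinuousLinearMap.adjoint_comp]
        rw [← ContinuousLinearMap.star_eq_adjoint, ← Ring.inverse_star,
          ContinuousLinearMap.star_eq_adjoint, this]
      rw [← trace_adjoint]
      change LinearMap.trace ℝ E (ContinuousLinearMap.adjoint ((Ring.inverse (gram B)).comp
        ((ContinuousLinearMap.adjoint H).comp B)) : E →L[ℝ] E) = _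
      rw [ContinuousLinearMap.adjoint_comp, ContinuousLinearMap.adjoint_comp,
        ContinuousLinearMap.adjoint_adjoint, hsa]
      simp only [pinv]
      exact LinearMap.trace_mul_comm ℝ
        (((ContinuousLinearMap.adjoint B).comp H : E →L[ℝ] E) : E →ₗ[ℝ] E)
        ((Ring.inverse (gram B) : E →L[ℝ] E) : E →ₗ[ℝ] E)
    have : ((Ring.inverse (gram B) * ((ContinuousLinearMap.adjoint B).comp H) +
      Ring.inverse (gram B) * ((ContinuousLinearMap.adjoint H).comp B) : E →L[ℝ] E) : E →ₗ[ℝ] E)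
      = ((pinv B).comp H : E →L[ℝ] E) + ((Ring.inverse (gram B) *
        ((ContinuousLinearMap.adjoint H).comp B) : E →L[ℝ] E) : E →ₗ[ℝ] E) := rfl
    rw [this, map_add, e2]; ring
  rw [e1]
  have : (gram B).det = jac B * jac B := (Real.mul_self_sqrt hpos.le).symm
  have hj := (jac_pos hB).ne'
  change 1 / (2 * jac B) * _ = _
  rw [this]
  field_simp

end LinearAlgebra
end MovingSurface

/-! ### Tangential gradient and divergence on a subset of the ambient space -/

namespace MovingSurface

variable {n : ℕ} {S : Set (Amb n)} {x : Amb n}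

/-- The orthogonal projection to the tangent space. -/
abbrev projT (S : Set (Amb n)) (x : Amb n) : Amb n →L[ℝ] Amb n := (tangentSpaceAt S x).starProjection

/-- Derivatives within `S` are not unique, but any two agree on the tangent cone and hence on its
span. The tangential operators only see this restriction, so they may be computed with whichever
derivative is at hand. -/
theorem fderivWithin_eqOn_tangentSpaceAt {Y : Type*} [NormedAddCommGroup Y] [NormedSpace ℝ Y]
    {g : Amb n → Y} {g₁ g₂ : Amb n →L[ℝ] Y} (h₁ : HasFDerivWithinAt g g₁ S x)
    (h₂ : HasFDerivWithinAt g g₂ S x) {τ : Amb n} (hτ : τ ∈ tangentSpaceAt S x) : g₁ τ = g₂ τ := by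
  have : tangentSpaceAt S x ≤ LinearMap.eqLocus (g₁ : Amb n →ₗ[ℝ] Y) (g₂ : Amb n →ₗ[ℝ] Y) :=
    Submodule.span_le.2 fun τ hτ => h₁.unique_on h₂ hτ
  exact this hτ

theorem projT_mem (S : Set (Amb n)) (x a : Amb n) : projT S x a ∈ tangentSpaceAt S x :=
  Submodule.starProjection_apply_mem _ _

theorem projT_eq_self {τ : Amb n} (hτ : τ ∈ tangentSpaceAt S x) : projT S x τ = τ :=
  Submodule.starProjection_eq_self_iff.2 hτ

theorem inner_projT_left (a b : Amb n) :
    inner ℝ (projT S x a) b = (inner ℝ a (projT S x b) : ℝ) :=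
  Submodule.inner_starProjection_left_eq_right _ _ _

theorem tangGrad_mem (S : Set (Amb n)) (g : Amb n → ℝ) (x : Amb n) :
    tangGrad S g x ∈ tangentSpaceAt S x := projT_mem _ _ _

theorem inner_tangGrad {g : Amb n → ℝ} {g' : Amb n →L[ℝ] ℝ} (hg : HasFDerivWithinAt g g' S x)
    (a : Amb n) : inner ℝ (tangGrad S g x) a = g' (projT S x a) := by
  have h1 : inner ℝ (tangGrad S g x) a = inner ℝ (gradientWithin g S x) (projT S x a) :=
    inner_projT_left _ _
  rw [h1, gradientWithin, InnerProductSpace.toDual_symm_apply]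
  exact fderivWithin_eqOn_tangentSpaceAt hg.differentiableWithinAt.hasFDerivWithinAt hg
    (projT_mem _ _ _)

theorem tangGrad_apply {g : Amb n → ℝ} {g' : Amb n →L[ℝ] ℝ} (hg : HasFDerivWithinAt g g' S x)
    (j : Fin (n + 1)) : tangGrad S g x j = g' (projT S x (EuclideanSpace.single j 1)) := by
  rw [← inner_tangGrad hg, EuclideanSpace.inner_single_right]
  simp

theorem tangGrad_ext {g : Amb n → ℝ} {g' : Amb n →L[ℝ] ℝ} (hg : HasFDerivWithinAt g g' S x)
    {a : Amb n} (h : ∀ b, inner ℝ a b = g' (projT S x b)) : tangGrad S g x = a :=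
  ext_inner_right ℝ fun b => by rw [inner_tangGrad hg, h]

theorem HasFDerivWithinAt.component {w : Amb n → Amb n} {w' : Amb n →L[ℝ] Amb n}
    (hw : HasFDerivWithinAt w w' S x) (j : Fin (n + 1)) :
    HasFDerivWithinAt (fun y => w y j) ((EuclideanSpace.proj j).comp w') S x :=
  (EuclideanSpace.proj (𝕜 := ℝ) j : Amb n →L[ℝ] ℝ).hasFDerivAt.comp_hasFDerivWithinAt x hw

theorem tangDiv_eq {w : Amb n → Amb n} {w' : Amb n →L[ℝ] Amb n} (hw : HasFDerivWithinAt w w' S x) :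
    tangDiv S w x = ∑ j, w' (projT S x (EuclideanSpace.single j 1)) j :=
  Finset.sum_congr rfl fun j _ => by
    rw [tangGrad_apply (HasFDerivWithinAt.component hw j)]; rfl

theorem tangDiv_eq_trace {w : Amb n → Amb n} {w' : Amb n →L[ℝ] Amb n}
    (hw : HasFDerivWithinAt w w' S x) :
    tangDiv S w x = LinearMap.trace ℝ (Amb n) (w'.comp (projT S x) : Amb n →L[ℝ] Amb n) := by
  rw [tangDiv_eq hw, LinearMap.trace_eq_sum_inner _ (EuclideanSpace.basisFun (Fin (n + 1)) ℝ)]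
  refine Finset.sum_congr rfl fun j _ => ?_
  simp [EuclideanSpace.inner_single_left]

theorem tangDiv_congr {w z : Amb n → Amb n} (hx : x ∈ S) (hwz : EqOn w z S)
    (hw : DifferentiableWithinAt ℝ w S x) : tangDiv S w x = tangDiv S z x := by
  have h1 := hw.hasFDerivWithinAt
  have h2 : HasFDerivWithinAt z _ S x := h1.congr (fun y hy => (hwz hy).symm) (hwz hx).symm
  rw [tangDiv_eq h1, tangDiv_eq h2]

theorem tangGrad_const (c : ℝ) : tangGrad S (fun _ => c) x = 0 :=
  tangGrad_ext (hasFDerivWithinAt_const c x S) fun b => by simp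

theorem tangGrad_mul {g h : Amb n → ℝ} (hg : DifferentiableWithinAt ℝ g S x)
    (hh : DifferentiableWithinAt ℝ h S x) :
    tangGrad S (fun y => g y * h y) x = g x • tangGrad S h x + h x • tangGrad S g x := by
  refine tangGrad_ext (hg.hasFDerivWithinAt.mul hh.hasFDerivWithinAt) fun b => ?_
  rw [inner_add_left, real_inner_smul_left, real_inner_smul_left,
    inner_tangGrad hg.hasFDerivWithinAt, inner_tangGrad hh.hasFDerivWithinAt]
  simp

theorem tangGrad_comp {g : Amb n → ℝ} {h : ℝ → ℝ} (hg : DifferentiableWithinAt ℝ g S x)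
    (hh : DifferentiableAt ℝ h (g x)) :
    tangGrad S (fun y => h (g y)) x = deriv h (g x) • tangGrad S g x := by
  refine tangGrad_ext (hh.hasDerivAt.comp_hasFDerivWithinAt x hg.hasFDerivWithinAt) fun b => ?_
  rw [real_inner_smul_left, inner_tangGrad hg.hasFDerivWithinAt]
  simp

theorem tangDiv_smul {g : Amb n → ℝ} {w : Amb n → Amb n} (hg : DifferentiableWithinAt ℝ g S x)
    (hw : DifferentiableWithinAt ℝ w S x) :
    tangDiv S (fun y => g y • w y) x = g x * tangDiv S w x + inner ℝ (tangGrad S g x) (w x) := by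
  have h1 : HasFDerivWithinAt (fun y => g y • w y) _ S x :=
    hg.hasFDerivWithinAt.smul hw.hasFDerivWithinAt
  rw [tangDiv_eq h1, tangDiv_eq hw.hasFDerivWithinAt,
    Finset.mul_sum, PiLp.inner_apply, ← Finset.sum_add_distrib]
  refine Finset.sum_congr rfl fun j _ => ?_
  rw [tangGrad_apply hg.hasFDerivWithinAt]
  simp [mul_comm]

theorem tangDiv_sub {w z : Amb n → Amb n} (hw : DifferentiableWithinAt ℝ w S x)
    (hz : DifferentiableWithinAt ℝ z S x) :
    tangDiv S (fun y => w y - z y) x = tangDiv S w x - tangDiv S z x := by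
  have h1 : HasFDerivWithinAt (fun y => w y - z y) _ S x :=
    hw.hasFDerivWithinAt.sub hz.hasFDerivWithinAt
  rw [tangDiv_eq h1, tangDiv_eq hw.hasFDerivWithinAt,
    tangDiv_eq hz.hasFDerivWithinAt, ← Finset.sum_sub_distrib]
  simp

theorem tangDiv_sum {ι : Type*} (s : Finset ι) {w : ι → Amb n → Amb n}
    (hw : ∀ i ∈ s, DifferentiableWithinAt ℝ (w i) S x) :
    tangDiv S (fun y => ∑ i ∈ s, w i y) x = ∑ i ∈ s, tangDiv S (w i) x := by
  rw [tangDiv_eq (HasFDerivWithinAt.fun_sum fun i hi => (hw i hi).hasFDerivWithinAt),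
    Finset.sum_congr rfl fun i hi => tangDiv_eq (hw i hi).hasFDerivWithinAt, Finset.sum_comm]
  simp

/-- Chain rule for the divergence of `x ↦ F (x, u x)`. -/
theorem tangDiv_comp_graph {F : Amb n × ℝ → Amb n} {F' : Amb n × ℝ →L[ℝ] Amb n} {u : Amb n → ℝ}
    (hu : DifferentiableWithinAt ℝ u S x)
    (hF : HasFDerivWithinAt F F' (S ×ˢ (univ : Set ℝ)) (x, u x)) :
    tangDiv S (fun y => F (y, u y)) x =
      tangDiv S (fun y => F (y, u x)) x + inner ℝ (tangGrad S u x) (F' (0, 1)) := by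
  have h1 : HasFDerivWithinAt (fun y => F (y, u y)) _ S x :=
    HasFDerivWithinAt.comp (t := S ×ˢ (univ : Set ℝ)) x hF ((hasFDerivWithinAt_id x S).prodMk
      hu.hasFDerivWithinAt) fun y hy => ⟨hy, mem_univ _⟩
  have h2 : HasFDerivWithinAt (fun y => F (y, u x)) _ S x :=
    HasFDerivWithinAt.comp (t := S ×ˢ (univ : Set ℝ)) x hF ((hasFDerivWithinAt_id x S).prodMk
      (hasFDerivWithinAt_const (u x) x S)) fun y hy => ⟨hy, mem_univ _⟩
  rw [tangDiv_eq h1, tangDiv_eq h2, PiLp.inner_apply, ← Finset.sum_add_distrib]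
  refine Finset.sum_congr rfl fun j _ => ?_
  rw [tangGrad_apply hu.hasFDerivWithinAt]
  have : ∀ (a : Amb n) (r : ℝ), F' (a, r) = F' (a, 0) + r • F' (0, 1) := fun a r => by
    rw [← map_smul, ← map_add]; simp
  simp only [ContinuousLinearMap.comp_apply, ContinuousLinearMap.prod_apply,
    ContinuousLinearMap.id_apply, zero_apply]
  rw [this]
  simp [mul_comm]

/-! ### Local parametrizations and tangential operators in coordinates -/

/-- `X : V → S` is a smooth local parametrization of `S` with smooth inverse `L`, onto a relatively
open part of `S`. -/
structure LocalParam (S : Set (Amb n)) (V : Set (EuclideanSpace ℝ (Fin n)))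
    (X : EuclideanSpace ℝ (Fin n) → Amb n) (L : Amb n → EuclideanSpace ℝ (Fin n)) : Prop where
  isOpen : IsOpen V
  contDiffOn : ContDiffOn ℝ ∞ X V
  contDiffOn_inv : ContDiffOn ℝ ∞ L (X '' V)
  left_inv : ∀ y ∈ V, L (X y) = y
  exists_inter : ∃ O, IsOpen O ∧ X '' V = S ∩ O

namespace LocalParam

variable {V : Set (EuclideanSpace ℝ (Fin n))} {X : EuclideanSpace ℝ (Fin n) → Amb n}
  {L : Amb n → EuclideanSpace ℝ (Fin n)} (h : LocalParam S V X L)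
  {y : EuclideanSpace ℝ (Fin n)}
include h

theorem mapsTo : MapsTo X V S := by
  obtain ⟨O, -, hO⟩ := h.exists_inter
  exact mapsTo_iff_image_subset.2 (hO ▸ inter_subset_left)

theorem injOn : InjOn X V := fun a ha b hb hab => by
  rw [← h.left_inv a ha, hab, h.left_inv b hb]

theorem image_mem_nhdsWithin (hy : y ∈ V) : X '' V ∈ 𝓝[S] (X y) := by
  obtain ⟨O, hO, hO'⟩ := h.exists_inter
  rw [hO']
  exact inter_mem self_mem_nhdsWithin (mem_nhdsWithin_of_mem_nhds
    (hO.mem_nhds (hO' ▸ mem_image_of_mem X hy : X y ∈ S ∩ O).2))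

theorem contDiffAt (hy : y ∈ V) : ContDiffAt ℝ ∞ X y :=
  h.contDiffOn.contDiffAt (h.isOpen.mem_nhds hy)

theorem hasFDerivAt (hy : y ∈ V) : HasFDerivAt X (fderiv ℝ X y) y :=
  ((h.contDiffAt hy).differentiableAt (by simp)).hasFDerivAt

theorem contDiffWithinAt_inv (hy : y ∈ V) : ContDiffWithinAt ℝ ∞ L S (X y) :=
  (h.contDiffOn_inv _ (mem_image_of_mem X hy)).mono_of_mem_nhdsWithin (h.image_mem_nhdsWithin hy)

theorem right_inv {x : Amb n} (hx : x ∈ X '' V) : X (L x) = x := by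
  obtain ⟨y, hy, rfl⟩ := hx
  rw [h.left_inv y hy]

theorem inv_mem {x : Amb n} (hx : x ∈ X '' V) : L x ∈ V := by
  obtain ⟨y, hy, rfl⟩ := hx
  rwa [h.left_inv y hy]

/-- Differentiate `L ∘ X = id` on the open set `V`. This left inverse yields the injectivity of `dX`
and the identification of the tangent space. -/
theorem exists_inv_deriv (hy : y ∈ V) : ∃ L' : Amb n →L[ℝ] EuclideanSpace ℝ (Fin n),
    HasFDerivWithinAt L L' S (X y) ∧ ∀ a, L' (fderiv ℝ X y a) = a := by
  obtain ⟨L', hL'⟩ : ∃ L', HasFDerivWithinAt L L' S (X y) :=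
    ⟨_, ((h.contDiffWithinAt_inv hy).differentiableWithinAt (by simp)).hasFDerivWithinAt⟩
  refine ⟨L', hL', fun a => ?_⟩
  have h1 : HasFDerivAt (L ∘ X) (L'.comp (fderiv ℝ X y)) y := by
    have := hL'.comp y (h.hasFDerivAt hy).hasFDerivWithinAt h.mapsTo
    exact this.hasFDerivAt (h.isOpen.mem_nhds hy)
  have h2 : HasFDerivAt (L ∘ X) (ContinuousLinearMap.id ℝ _) y :=
    (hasFDerivAt_id y).congr_of_eventuallyEq
      (Filter.mem_of_superset (h.isOpen.mem_nhds hy) h.left_inv)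
  exact DFunLike.congr_fun (h1.unique h2) a

theorem injective_fderiv (hy : y ∈ V) : Function.Injective (fderiv ℝ X y) := by
  obtain ⟨L', -, hL⟩ := h.exists_inv_deriv hy
  exact Function.LeftInverse.injective hL

/-- Differentiating `X ∘ L = id` along the tangent cone writes a tangent vector `τ` as `dX (L' τ)`.
Conversely `dX` maps the tangent cone of `V`, which is everything because `V` is open, into that of
`S`. -/
theorem tangentSpaceAt_eq (hy : y ∈ V) :
    tangentSpaceAt S (X y) = LinearMap.range (fderiv ℝ X y : EuclideanSpace ℝ (Fin n) →ₗ[ℝ] Amb n) := by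
  refine le_antisymm (Submodule.span_le.2 fun τ hτ => ?_) ?_
  · obtain ⟨L', hL', -⟩ := h.exists_inv_deriv hy
    have hX : HasFDerivAt X (fderiv ℝ X y) (L (X y)) := by
      rw [h.left_inv y hy]; exact h.hasFDerivAt hy
    have h1 : HasFDerivWithinAt (X ∘ L) ((fderiv ℝ X y).comp L') S (X y) :=
      hX.comp_hasFDerivWithinAt (X y) hL'
    have h2 : HasFDerivWithinAt (X ∘ L) (ContinuousLinearMap.id ℝ _) S (X y) :=
      (hasFDerivWithinAt_id (X y) S).congr_of_eventuallyEq
        (Filter.mem_of_superset (h.image_mem_nhdsWithin hy) fun x hx => h.right_inv hx)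
        (h.right_inv (mem_image_of_mem X hy))
    have := h1.unique_on h2 hτ
    exact ⟨L' τ, this⟩
  · rintro _ ⟨a, rfl⟩
    refine Submodule.subset_span ?_
    have h1 := (h.hasFDerivAt hy).hasFDerivWithinAt (s := V) |>.mapsTo_tangent_cone
    have h2 : a ∈ tangentConeAt ℝ V y := by
      rw [tangentConeAt_of_mem_nhds (h.isOpen.mem_nhds hy)]
      exact mem_univ a
    exact tangentConeAt_mono (mapsTo_iff_image_subset.1 h.mapsTo) (h1 h2)

theorem projT_eq (hy : y ∈ V) (a : Amb n) :
    projT S (X y) a = fderiv ℝ X y (pinv (fderiv ℝ X y) a) := by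
  rw [← starProjection_range (h.injective_fderiv hy)]
  simp only [projT]
  congr 2
  exact h.tangentSpaceAt_eq hy

/-- Near `X y` within `S` one has `g = (g ∘ X) ∘ L`, so regularity on `S` can be tested in
coordinates. -/
theorem differentiableWithinAt_of_comp {Y : Type*} [NormedAddCommGroup Y] [NormedSpace ℝ Y]
    {g : Amb n → Y} (hy : y ∈ V) (hg : DifferentiableAt ℝ (g ∘ X) y) :
    DifferentiableWithinAt ℝ g S (X y) := by
  obtain ⟨L', hL', -⟩ := h.exists_inv_deriv hy
  have hg' : DifferentiableAt ℝ (g ∘ X) (L (X y)) := by rwa [h.left_inv y hy]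
  refine (hg'.comp_differentiableWithinAt (X y) hL'.differentiableWithinAt).congr_of_eventuallyEq
    ?_ ?_
  · refine Filter.mem_of_superset (h.image_mem_nhdsWithin hy) fun x hx => ?_
    change g x = g (X (L x))
    rw [h.right_inv hx]
  · change g (X y) = g (X (L (X y)))
    rw [h.left_inv y hy]

theorem fderiv_comp {Y : Type*} [NormedAddCommGroup Y] [NormedSpace ℝ Y]
    {g : Amb n → Y} {g' : Amb n →L[ℝ] Y} (hy : y ∈ V) (hg : HasFDerivWithinAt g g' S (X y)) :
    HasFDerivAt (g ∘ X) (g'.comp (fderiv ℝ X y)) y :=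
  (hg.comp y (h.hasFDerivAt hy).hasFDerivWithinAt h.mapsTo).hasFDerivAt (h.isOpen.mem_nhds hy)

/-- The tangential gradient in local coordinates. -/
theorem tangGrad_eq {g : Amb n → ℝ} (hy : y ∈ V) (hg : DifferentiableAt ℝ (g ∘ X) y) :
    tangGrad S g (X y) = ContinuousLinearMap.adjoint (pinv (fderiv ℝ X y))
      ((InnerProductSpace.toDual ℝ _).symm (fderiv ℝ (g ∘ X) y)) := by
  have hg' := (h.differentiableWithinAt_of_comp hy hg).hasFDerivWithinAt
  refine tangGrad_ext hg' fun b => ?_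
  rw [ContinuousLinearMap.adjoint_inner_left, InnerProductSpace.toDual_symm_apply,
    (h.fderiv_comp hy hg').fderiv, h.projT_eq hy]
  rfl

/-- The tangential divergence in local coordinates. -/
theorem tangDiv_eq {w : Amb n → Amb n} (hy : y ∈ V) (hw : DifferentiableAt ℝ (w ∘ X) y) :
    tangDiv S w (X y) = LinearMap.trace ℝ (EuclideanSpace ℝ (Fin n))
      ((pinv (fderiv ℝ X y)).comp (fderiv ℝ (w ∘ X) y) :
        EuclideanSpace ℝ (Fin n) →L[ℝ] EuclideanSpace ℝ (Fin n)) := by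
  have hw' := (h.differentiableWithinAt_of_comp hy hw).hasFDerivWithinAt
  rw [tangDiv_eq_trace hw', (h.fderiv_comp hy hw').fderiv]
  have : projT S (X y) = (fderiv ℝ X y).comp (pinv (fderiv ℝ X y)) :=
    ContinuousLinearMap.ext fun a => h.projT_eq hy a
  rw [this]
  exact LinearMap.trace_comp_comm' ((pinv (fderiv ℝ X y)).toLinearMap)
    (((fderivWithin ℝ w S (X y)).comp (fderiv ℝ X y)).toLinearMap)

end LocalParam

end MovingSurface

/-! ### The area formula for local parametrizations -/

namespace MovingSurface

/-- An inequality between measures that holds locally on a set holds on its subsets. -/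
theorem measure_le_of_locally {α : Type*} [TopologicalSpace α] [SecondCountableTopology α]
    [MeasurableSpace α] [OpensMeasurableSpace α] {μ ν : Measure α} {V : Set α}
    (h : ∀ x ∈ V, ∃ W ∈ 𝓝 x, ∀ A ⊆ W ∩ V, MeasurableSet A → μ A ≤ ν A) {A : Set α} (hAV : A ⊆ V)
    (hA : MeasurableSet A) : μ A ≤ ν A := by
  choose! W hW hle using h
  -- Lindelöf: countably many of the neighbourhoods cover `V`. Made disjoint, they reduce the claim
  -- to a countable sum of local inequalities.
  obtain ⟨t, htV, htc, hcov⟩ := TopologicalSpace.countable_cover_nhdsWithin (f := fun x => interior (W x))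
    (s := V) fun x hx => mem_nhdsWithin_of_mem_nhds (interior_mem_nhds.2 (hW x hx))
  rcases t.eq_empty_or_nonempty with rfl | hne
  · have : A = ∅ := by
      refine Set.eq_empty_of_subset_empty fun x hx => ?_
      simpa using hcov (hAV hx)
    simp [this]
  obtain ⟨f, rfl⟩ := htc.exists_eq_range hne
  let C : ℕ → Set α := fun k => A ∩ disjointed (fun k => interior (W (f k))) k
  have hCm : ∀ k, MeasurableSet (C k) := fun k =>
    hA.inter (MeasurableSet.disjointed (fun k => isOpen_interior.measurableSet) k)
  have hCd : Pairwise (Function.onFun Disjoint C) := fun i j hij =>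
    (disjoint_disjointed _ hij).mono inter_subset_right inter_subset_right
  have hCA : A = ⋃ k, C k := by
    rw [← inter_iUnion, iUnion_disjointed, eq_comm, inter_eq_left]
    refine hAV.trans (hcov.trans ?_)
    simp
  rw [hCA, measure_iUnion hCd hCm, measure_iUnion hCd hCm]
  refine ENNReal.tsum_le_tsum fun k => hle (f k) (htV ⟨k, rfl⟩) _ ?_ (hCm k)
  exact subset_inter ((inter_subset_right.trans (disjointed_subset _ k)).trans interior_subset)
    (inter_subset_left.trans hAV)

theorem euclideanHausdorffMeasure_image_le {α β : Type*} [MetricSpace α]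
    [MeasurableSpace α] [BorelSpace α] [MetricSpace β] [MeasurableSpace β] [BorelSpace β]
    {d : ℕ} {K : NNReal} {f : α → β} {s : Set α} (h : LipschitzOnWith K f s) :
    (μHE[d] : Measure β) (f '' s) ≤ (K : ENNReal) ^ d * (μHE[d] : Measure α) s := by
  simp_rw [Measure.euclideanHausdorffMeasure_def, Measure.smul_apply, Measure.nnreal_smul_coe_apply]
  rw [mul_left_comm]
  gcongr
  simpa using h.hausdorffMeasure_image_le (d := d) (by positivity)

namespace LocalParam

variable {n : ℕ} {S : Set (Amb n)} {V : Set (EuclideanSpace ℝ (Fin n))}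
  {X : EuclideanSpace ℝ (Fin n) → Amb n} {L : Amb n → EuclideanSpace ℝ (Fin n)}
  (h : LocalParam S V X L) {y : EuclideanSpace ℝ (Fin n)}
include h

/-- The Jacobian of a local parametrization is smooth. -/
theorem contDiffOn_jac : ContDiffOn ℝ ∞ (fun y => jac (fderiv ℝ X y)) V := fun y hy =>
  ((contDiffAt_jac (h.injective_fderiv hy)).comp y
    ((h.contDiffAt hy).fderiv_right (m := ∞) (by simp))).contDiffWithinAt

/-- Near `y` the map `X` differs from its linearization `B` by a map of small Lipschitz constant. As
`B` is bounded below, the error is small relative to `‖B (a - b)‖`. -/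
theorem exists_nhds_lipschitz (hy : y ∈ V) {r : NNReal} (hr : 1 < r) : ∃ W ∈ 𝓝 y, W ⊆ V ∧
    ∀ a ∈ W, ∀ b ∈ W, dist (X a) (X b) ≤ r * dist (fderiv ℝ X y a) (fderiv ℝ X y b) ∧
      dist (fderiv ℝ X y a) (fderiv ℝ X y b) ≤ r * dist (X a) (X b) := by
  set B := fderiv ℝ X y
  obtain ⟨K, hK, hanti⟩ := (B : EuclideanSpace ℝ (Fin n) →ₗ[ℝ] Amb n).exists_antilipschitzWith
    (LinearMap.ker_eq_bot.2 (h.injective_fderiv hy))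
  have hr' : (1 : ℝ) < r := hr
  -- Chosen so that `r (1 - δ) = 1` and `1 + δ ≤ r`: a relative error `δ` costs at most the factor
  -- `r` in either direction.
  set δ : ℝ := (r - 1) / r
  have hδ : 0 < δ := div_pos (by linarith) (by linarith)
  have hδr : r * (1 - δ) = 1 := by simp only [δ]; field_simp; ring
  have hδ' : 1 + δ ≤ r := by
    have : δ ≤ r - 1 := div_le_self (by linarith) hr'.le
    linarith
  have hKr : (0 : ℝ) < K := hK
  have hstrict : HasStrictFDerivAt X B y :=
    (h.contDiffAt hy).hasStrictFDerivAt (by simp)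
  obtain ⟨s, hs, happ⟩ := hstrict.approximates_deriv_on_nhds
    (c := ⟨δ / K, (div_pos hδ hKr).le⟩) (Or.inr (div_pos hδ hKr))
  refine ⟨s ∩ V, inter_mem hs (h.isOpen.mem_nhds hy), inter_subset_right, fun a ha b hb => ?_⟩
  have h1 : ‖X a - X b - B (a - b)‖ ≤ δ / K * ‖a - b‖ := happ _ ha.1 _ hb.1
  have h2 : ‖a - b‖ ≤ K * ‖B a - B b‖ := by
    have := hanti.le_mul_dist a b
    rwa [dist_eq_norm, dist_eq_norm] at this
  have h3 : ‖X a - X b - (B a - B b)‖ ≤ δ * ‖B a - B b‖ := by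
    rw [← map_sub]
    calc _ ≤ δ / K * ‖a - b‖ := h1
      _ ≤ δ / K * (K * ‖B a - B b‖) := by gcongr
      _ = δ * ‖B (a - b)‖ := by rw [map_sub]; field_simp
  rw [dist_eq_norm, dist_eq_norm]
  have h4 := norm_sub_norm_le (X a - X b) (B a - B b)
  have h5 := norm_sub_norm_le (B a - B b) (X a - X b)
  rw [norm_sub_rev (B a - B b)] at h5
  constructor
  · nlinarith [norm_nonneg (B a - B b)]
  · have h6 : (1 - δ) * ‖B a - B b‖ ≤ ‖X a - X b‖ := by linarith
    calc ‖B a - B b‖ = r * ((1 - δ) * ‖B a - B b‖) := by rw [← mul_assoc, hδr, one_mul]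
      _ ≤ _ := by gcongr

/-- The maps `X ∘ B⁻¹` and `B ∘ X⁻¹` are `r`-Lipschitz near `y`, so each distorts `n`-dimensional
measure by at most `r ^ n`, while the linear image `B '' A` has measure `jac B * volume A`. -/
theorem exists_nhds_image_le (hy : y ∈ V) {r : NNReal} (hr : 1 < r) : ∃ W ∈ 𝓝 y, W ⊆ V ∧ ∀ A ⊆ W,
    (μHE[n] : Measure (Amb n)) (X '' A) ≤ r ^ n * (ENNReal.ofReal (jac (fderiv ℝ X y)) * volume A) ∧
    ENNReal.ofReal (jac (fderiv ℝ X y)) * volume A ≤ r ^ n * (μHE[n] : Measure (Amb n)) (X '' A) := by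
  obtain ⟨W, hW, hWV, hlip⟩ := h.exists_nhds_lipschitz hy hr
  refine ⟨W, hW, hWV, fun A hA => ?_⟩
  set B := fderiv ℝ X y
  have hp : ∀ a, pinv B (B a) = a := pinv_apply_apply (h.injective_fderiv hy)
  have hvol : (μHE[n] : Measure (Amb n)) (B '' A) = ENNReal.ofReal (jac B) * volume A := by
    have := LinearMap.euclideanHausdorffMeasure_image_eq_normDet_mul_volume
      (B : EuclideanSpace ℝ (Fin n) →ₗ[ℝ] Amb n) A
    rw [jac_eq_normDet, ← this]
    simp
  rw [← hvol]
  constructor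
  · have h1 : LipschitzOnWith r (fun z => X (pinv B z)) (B '' A) := by
      refine LipschitzOnWith.of_dist_le_mul ?_
      rintro _ ⟨a, ha, rfl⟩ _ ⟨b, hb, rfl⟩
      simp only [hp]
      exact (hlip a (hA ha) b (hA hb)).1
    have h2 := euclideanHausdorffMeasure_image_le (d := n) h1
    rw [image_image] at h2
    simpa only [hp] using h2
  · have h1 : LipschitzOnWith r (fun z => B (L z)) (X '' A) := by
      refine LipschitzOnWith.of_dist_le_mul ?_
      rintro _ ⟨a, ha, rfl⟩ _ ⟨b, hb, rfl⟩
      rw [h.left_inv a (hWV (hA ha)), h.left_inv b (hWV (hA hb))]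
      exact (hlip a (hA ha) b (hA hb)).2
    have h2 := euclideanHausdorffMeasure_image_le (d := n) h1
    rw [image_image] at h2
    have h3 : (fun a => B (L (X a))) '' A = B '' A :=
      image_congr fun a ha => by rw [h.left_inv a (hWV (hA ha))]
    rwa [h3] at h2

theorem measurableSet_image : MeasurableSet (X '' V) :=
  h.isOpen.measurableSet.image_of_continuousOn_injOn h.contDiffOn.continuousOn h.injOn

theorem aemeasurable (μ : Measure (EuclideanSpace ℝ (Fin n))) : AEMeasurable X (μ.restrict V) :=
  h.contDiffOn.continuousOn.aemeasurable h.isOpen.measurableSet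

theorem aemeasurable_inv (μ : Measure (Amb n)) : AEMeasurable L (μ.restrict (X '' V)) :=
  h.contDiffOn_inv.continuousOn.aemeasurable h.measurableSet_image

/-- **Area formula** for a local parametrization. -/
theorem restrict_image : (μHE[n] : Measure (Amb n)).restrict (X '' V) =
    Measure.map X ((volume.restrict V).withDensity
      fun y => ENNReal.ofReal (jac (fderiv ℝ X y))) := by
  set J : EuclideanSpace ℝ (Fin n) → ENNReal := fun y => ENNReal.ofReal (jac (fderiv ℝ X y))
  -- The Hausdorff measure is pulled back by `L`, so that two measures on the coordinate domain `V`
  -- have to be compared.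
  set ν : Measure (EuclideanSpace ℝ (Fin n)) :=
    Measure.map L ((μHE[n] : Measure (Amb n)).restrict (X '' V))
  set lam := (volume.restrict V).withDensity J
  have hVm := h.isOpen.measurableSet
  have hν : ∀ A ⊆ V, MeasurableSet A → ν A = (μHE[n] : Measure (Amb n)) (X '' A) := by
    intro A hAV hA
    rw [Measure.map_apply_of_aemeasurable (h.aemeasurable_inv _) hA,
      Measure.restrict_apply' h.measurableSet_image]
    congr 1
    ext x
    constructor
    · rintro ⟨hx, hx'⟩
      exact ⟨L x, hx, h.right_inv hx'⟩
    · rintro ⟨a, ha, rfl⟩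
      exact ⟨by rwa [mem_preimage, h.left_inv a (hAV ha)], mem_image_of_mem X (hAV ha)⟩
  have hlam : ∀ A ⊆ V, MeasurableSet A → lam A = ∫⁻ y in A, J y := by
    intro A hAV hA
    rw [withDensity_apply _ hA, Measure.restrict_restrict hA, inter_eq_left.2 hAV]
  -- The exponent is `n + 1`: `n` factors `r` come from the comparison with the linearization, one
  -- from the oscillation of the Jacobian near `y`.
  have hloc : ∀ r : NNReal, 1 < r → ∀ y ∈ V, ∃ W ∈ 𝓝 y, ∀ A ⊆ W ∩ V, MeasurableSet A →
      ν A ≤ ((r ^ (n + 1) : NNReal) • lam) A ∧ lam A ≤ ((r ^ (n + 1) : NNReal) • ν) A := by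
    intro r hr y hy
    obtain ⟨W, hW, hWV, hle⟩ := h.exists_nhds_image_le hy hr
    have hJc : ContinuousAt (fun y => jac (fderiv ℝ X y)) y :=
      (h.contDiffOn_jac.contDiffAt (h.isOpen.mem_nhds hy)).continuousAt
    have hpos := jac_pos (h.injective_fderiv hy)
    have hr' : (1 : ℝ) < r := hr
    have hJ1 : ∀ᶠ z in 𝓝 y, jac (fderiv ℝ X z) < r * jac (fderiv ℝ X y) :=
      hJc.eventually_lt continuousAt_const (by nlinarith)
    have hJ2 : ∀ᶠ z in 𝓝 y, jac (fderiv ℝ X y) < r * jac (fderiv ℝ X z) :=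
      continuousAt_const.eventually_lt (continuousAt_const.mul hJc) (by nlinarith)
    refine ⟨W ∩ {z | jac (fderiv ℝ X z) < r * jac (fderiv ℝ X y) ∧
      jac (fderiv ℝ X y) < r * jac (fderiv ℝ X z)}, inter_mem hW (hJ1.and hJ2), fun A hA hAm => ?_⟩
    have hAV : A ⊆ V := hA.trans inter_subset_right
    have hAW : A ⊆ W := fun z hz => (hA hz).1.1
    obtain ⟨h1, h2⟩ := hle A hAW
    have hm1 : J y * volume A ≤ r * ∫⁻ z in A, J z := by
      rw [← setLIntegral_const, ← lintegral_const_mul' _ _ ENNReal.coe_ne_top]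
      refine setLIntegral_mono' hAm fun z hz => ?_
      simp only [J]
      rw [← ENNReal.ofReal_coe_nnreal, ← ENNReal.ofReal_mul (by positivity)]
      exact ENNReal.ofReal_le_ofReal (hA hz).1.2.2.le
    have hm2 : ∫⁻ z in A, J z ≤ r * (J y * volume A) := by
      rw [← mul_assoc, ← setLIntegral_const]
      refine setLIntegral_mono' hAm fun z hz => ?_
      simp only [J]
      rw [← ENNReal.ofReal_coe_nnreal, ← ENNReal.ofReal_mul (by positivity)]
      exact ENNReal.ofReal_le_ofReal (hA hz).1.2.1.le
    have hpow : ((r ^ (n + 1) : NNReal) : ENNReal) = (r : ENNReal) ^ n * r := by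
      push_cast; rw [pow_succ]
    rw [Measure.smul_apply, Measure.smul_apply, ENNReal.smul_def, ENNReal.smul_def, smul_eq_mul,
      smul_eq_mul, hν A hAV hAm, hlam A hAV hAm, hpow, mul_assoc, mul_assoc]
    refine ⟨h1.trans (by gcongr), hm2.trans ?_⟩
    rw [mul_left_comm ((r : ENNReal) ^ n)]
    gcongr
  -- Let `r ↓ 1` in the local comparison.
  have hlim : ∀ a b : ENNReal, (∀ r : NNReal, 1 < r → a ≤ ((r ^ (n + 1) : NNReal) : ENNReal) * b) →
      a ≤ b := by
    intro a b hab
    have hc : Tendsto (fun r : NNReal => ((r ^ (n + 1) : NNReal) : ENNReal) * b) (𝓝[>] 1) (𝓝 b) := by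
      have h1 : Tendsto (fun r : NNReal => ((r ^ (n + 1) : NNReal) : ENNReal)) (𝓝[>] 1) (𝓝 1) := by
        have : Continuous fun r : NNReal => ((r ^ (n + 1) : NNReal) : ENNReal) := by fun_prop
        simpa using (this.tendsto 1).mono_left nhdsWithin_le_nhds
      simpa using ENNReal.Tendsto.mul_const h1 (Or.inl one_ne_zero)
    exact ge_of_tendsto hc (Filter.mem_of_superset self_mem_nhdsWithin hab)
  have heq : ∀ A ⊆ V, MeasurableSet A → ν A = lam A := by
    intro A hAV hA
    refine le_antisymm (hlim _ _ fun r hr => ?_) (hlim _ _ fun r hr => ?_)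
    · refine measure_le_of_locally (ν := (r ^ (n + 1) : NNReal) • lam) (fun y hy => ?_) hAV hA
      obtain ⟨W, hW, hW'⟩ := hloc r hr y hy
      exact ⟨W, hW, fun A hA hAm => (hW' A hA hAm).1⟩
    · refine measure_le_of_locally (ν := (r ^ (n + 1) : NNReal) • ν) (fun y hy => ?_) hAV hA
      obtain ⟨W, hW, hW'⟩ := hloc r hr y hy
      exact ⟨W, hW, fun A hA hAm => (hW' A hA hAm).2⟩
  have hX : AEMeasurable X lam := (h.aemeasurable _).mono_ac (withDensity_absolutelyContinuous _ _)
  ext T hT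
  rw [Measure.restrict_apply hT, Measure.map_apply_of_aemeasurable hX hT]
  -- Nothing is known of `X` off `V`, so only the part of the preimage in `V` is measurable.
  have hTV : MeasurableSet (X ⁻¹' T ∩ V) := by
    have := hVm.subtype_image (h.contDiffOn.continuousOn.domRestrict.measurable hT)
    convert this using 1
    ext z
    simp [and_comm]
  have h1 : lam (X ⁻¹' T) = lam (X ⁻¹' T ∩ V) := by
    have hV0 : lam Vᶜ = 0 := withDensity_absolutelyContinuous _ _ (by
      rw [Measure.restrict_apply hVm.compl, compl_inter_self, measure_empty])
    refine le_antisymm ?_ (measure_mono inter_subset_left)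
    calc lam (X ⁻¹' T) ≤ lam (X ⁻¹' T ∩ V ∪ Vᶜ) := measure_mono fun z hz => by
          by_cases hzV : z ∈ V
          · exact Or.inl ⟨hz, hzV⟩
          · exact Or.inr hzV
      _ ≤ _ := (measure_union_le _ _).trans (by rw [hV0, add_zero])
  rw [h1, ← heq _ inter_subset_right hTV, hν _ inter_subset_right hTV]
  congr 1
  ext x
  constructor
  · rintro ⟨hx, a, ha, rfl⟩
    exact ⟨a, ⟨hx, ha⟩, rfl⟩
  · rintro ⟨a, ⟨hx, ha⟩, rfl⟩
    exact ⟨hx, a, ha, rfl⟩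

end LocalParam

end MovingSurface

/-! ### The divergence theorem on closed surfaces -/

namespace MovingSurface

section Trace

variable {E : Type*} [NormedAddCommGroup E] [InnerProductSpace ℝ E] [FiniteDimensional ℝ E]

/-- The trace of continuous endomorphisms as a continuous linear functional. -/
def traceL : (E →L[ℝ] E) →L[ℝ] ℝ :=
  LinearMap.toContinuousLinearMap
    { toFun := fun A => LinearMap.trace ℝ E (A : E →ₗ[ℝ] E)
      map_add' := fun A B => by simp
      map_smul' := fun c A => by simp }

theorem traceL_apply (A : E →L[ℝ] E) : traceL A = LinearMap.trace ℝ E (A : E →ₗ[ℝ] E) := rfl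

/-- The Riesz representation as a real-linear continuous map. -/
def rieszL : (E →L[ℝ] ℝ) →L[ℝ] E :=
  LinearMap.toContinuousLinearMap
    { toFun := fun l => (InnerProductSpace.toDual ℝ E).symm l
      map_add' := fun A B => by simp
      map_smul' := fun c A => by simp }

theorem contDiff_traceL {k : WithTop ℕ∞} : ContDiff ℝ k (fun A : E →L[ℝ] E => traceL A) :=
  (traceL (E := E)).contDiff

theorem contDiff_rieszL {k : WithTop ℕ∞} : ContDiff ℝ k (fun l : E →L[ℝ] ℝ => rieszL l) :=
  (rieszL (E := E)).contDiff

theorem contDiff_adjL {F : Type*} [NormedAddCommGroup F] [InnerProductSpace ℝ F]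
    [FiniteDimensional ℝ F] {k : WithTop ℕ∞} : ContDiff ℝ k (fun B : E →L[ℝ] F => adjL B) :=
  (adjL (E := E) (F := F)).contDiff

theorem traceL_smulRight (l : E →L[ℝ] ℝ) (a : E) : traceL (l.smulRight a) = l a := by
  rw [traceL_apply, LinearMap.trace_eq_sum_inner _ (stdOrthonormalBasis ℝ E)]
  conv_rhs => rw [← (stdOrthonormalBasis ℝ E).sum_repr' a]
  simp [real_inner_smul_right, mul_comm]

theorem traceL_eq_sum {n : ℕ} (A : EuclideanSpace ℝ (Fin n) →L[ℝ] EuclideanSpace ℝ (Fin n)) :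
    traceL A = ∑ i, A (EuclideanSpace.single i 1) i := by
  rw [traceL_apply, LinearMap.trace_eq_sum_inner _ (EuclideanSpace.basisFun (Fin n) ℝ)]
  simp [EuclideanSpace.inner_single_left]

end Trace

/-- The integral of the divergence of a compactly supported field vanishes. -/
theorem integral_traceL_fderiv_eq_zero {n : ℕ}
    {ζ : EuclideanSpace ℝ (Fin n) → EuclideanSpace ℝ (Fin n)} (hζ : ContDiff ℝ 1 ζ)
    (hc : HasCompactSupport ζ) : ∫ y, traceL (fderiv ℝ ζ y) = 0 := by
  have hcont : Continuous (fderiv ℝ ζ) := hζ.continuous_fderiv one_ne_zero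
  simp only [traceL_eq_sum]
  have hint : ∀ i : Fin n, Integrable (fun y => fderiv ℝ ζ y (EuclideanSpace.single i 1) i) := by
    intro i
    refine Continuous.integrable_of_hasCompactSupport (by fun_prop) ?_
    exact (hc.fderiv ℝ).comp_left (g := fun A : EuclideanSpace ℝ (Fin n) →L[ℝ]
      EuclideanSpace ℝ (Fin n) => A (EuclideanSpace.single i 1) i) (by simp)
  rw [integral_finsetSum _ fun i _ => hint i]
  refine Finset.sum_eq_zero fun i _ => ?_
  have hd : ∀ y, HasFDerivAt (fun y => ζ y i) ((EuclideanSpace.proj i).comp (fderiv ℝ ζ y)) y :=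
    fun y => (EuclideanSpace.proj (𝕜 := ℝ) i : EuclideanSpace ℝ (Fin n) →L[ℝ] ℝ).hasFDerivAt.comp y
      (hζ.differentiable one_ne_zero y).hasFDerivAt
  -- Integration by parts against the constant 1.
  have key := integral_mul_fderiv_eq_neg_fderiv_mul_of_integrable (𝕜 := ℝ)
    (μ := (volume : Measure (EuclideanSpace ℝ (Fin n)))) (f := fun _ => 1) (g := fun y => ζ y i)
    (v := EuclideanSpace.single i 1) (by simp) ?_ ?_ (fun _ _ => differentiableAt_const _)
    (fun y _ => (hd y).differentiableAt)
  · simpa [(hd _).fderiv] using key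
  · simpa [(hd _).fderiv] using hint i
  · simp only [one_mul]
    exact Continuous.integrable_of_hasCompactSupport (by have := hζ.continuous; fun_prop)
      (hc.comp_left (g := fun a : EuclideanSpace ℝ (Fin n) => a i) (by simp))

namespace LocalParam

variable {n : ℕ} {S : Set (Amb n)} {V : Set (EuclideanSpace ℝ (Fin n))}
  {X : EuclideanSpace ℝ (Fin n) → Amb n} {L : Amb n → EuclideanSpace ℝ (Fin n)}
  (h : LocalParam S V X L) {y : EuclideanSpace ℝ (Fin n)}
include h

theorem contDiffWithinAt_of_comp {Y : Type*} [NormedAddCommGroup Y] [NormedSpace ℝ Y]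
    {k : WithTop ℕ∞} (hk : k ≤ ∞) {g : Amb n → Y} (hy : y ∈ V) (hg : ContDiffAt ℝ k (g ∘ X) y) :
    ContDiffWithinAt ℝ k g S (X y) := by
  have hg' : ContDiffAt ℝ k (g ∘ X) (L (X y)) := by rwa [h.left_inv y hy]
  refine (hg'.comp_contDiffWithinAt (X y)
    ((h.contDiffWithinAt_inv hy).of_le hk)).congr_of_eventuallyEq ?_ ?_
  · refine Filter.mem_of_superset (h.image_mem_nhdsWithin hy) fun x hx => ?_
    change g x = g (X (L x))
    rw [h.right_inv hx]
  · change g (X y) = g (X (L (X y)))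
    rw [h.left_inv y hy]

theorem contDiffAt_comp {Y : Type*} [NormedAddCommGroup Y] [NormedSpace ℝ Y]
    {k : WithTop ℕ∞} (hk : k ≤ ∞) {g : Amb n → Y} (hy : y ∈ V) (hg : ContDiffOn ℝ k g S) :
    ContDiffAt ℝ k (g ∘ X) y :=
  ((hg _ (h.mapsTo hy)).comp y ((h.contDiffAt hy).of_le hk).contDiffWithinAt h.mapsTo).contDiffAt
    (h.isOpen.mem_nhds hy)

theorem contDiffAt_pinv (hy : y ∈ V) : ContDiffAt ℝ ∞ (fun z => pinv (fderiv ℝ X z)) y :=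
  (MovingSurface.contDiffAt_pinv (h.injective_fderiv hy)).comp y
    ((h.contDiffAt hy).fderiv_right (m := ∞) (by simp))

theorem contDiffAt_tangDiv_comp {k m : WithTop ℕ∞} (hm : m + 1 ≤ k) (hk : k ≤ ∞)
    {w : Amb n → Amb n} (hy : y ∈ V) (hw : ContDiffOn ℝ k w S) :
    ContDiffAt ℝ m (tangDiv S w ∘ X) y := by
  have hm' : m ≤ ∞ := (le_self_add.trans hm).trans hk
  have h1 : ContDiffAt ℝ m (fun z => traceL ((pinv (fderiv ℝ X z)).comp (fderiv ℝ (w ∘ X) z))) y :=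
    contDiff_traceL.comp_contDiffAt y (((h.contDiffAt_pinv hy).of_le hm').clm_comp
      ((h.contDiffAt_comp hk hy hw).fderiv_right hm))
  refine h1.congr_of_eventuallyEq (Filter.mem_of_superset (h.isOpen.mem_nhds hy) fun z hz => ?_)
  have hk0 : k ≠ 0 := by
    rintro rfl
    simp at hm
  exact h.tangDiv_eq hz ((h.contDiffAt_comp hk hz hw).differentiableAt hk0)

theorem contDiffAt_tangGrad_comp {k m : WithTop ℕ∞} (hm : m + 1 ≤ k) (hk : k ≤ ∞)
    {g : Amb n → ℝ} (hy : y ∈ V) (hg : ContDiffOn ℝ k g S) :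
    ContDiffAt ℝ m (tangGrad S g ∘ X) y := by
  have hm' : m ≤ ∞ := (le_self_add.trans hm).trans hk
  have h1 : ContDiffAt ℝ m (fun z => adjL (pinv (fderiv ℝ X z))
      (rieszL (fderiv ℝ (g ∘ X) z))) y :=
    (contDiff_adjL.comp_contDiffAt y ((h.contDiffAt_pinv hy).of_le hm')).clm_apply
      (contDiff_rieszL.comp_contDiffAt y ((h.contDiffAt_comp hk hy hg).fderiv_right hm))
  refine h1.congr_of_eventuallyEq (Filter.mem_of_superset (h.isOpen.mem_nhds hy) fun z hz => ?_)
  have hk0 : k ≠ 0 := by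
    rintro rfl
    simp at hm
  exact h.tangGrad_eq hz ((h.contDiffAt_comp hk hz hg).differentiableAt hk0)

/-- In local coordinates the tangential divergence is the weighted divergence of the coordinate
field. -/
theorem jac_mul_tangDiv {w : Amb n → Amb n} (hw : ContDiffOn ℝ 1 w S)
    (htan : ∀ x ∈ S, w x ∈ tangentSpaceAt S x) (hy : y ∈ V) :
    jac (fderiv ℝ X y) * tangDiv S w (X y) =
      traceL (fderiv ℝ (fun z => jac (fderiv ℝ X z) • pinv (fderiv ℝ X z) (w (X z))) y) := by
  set B := fderiv ℝ X
  set ξ : EuclideanSpace ℝ (Fin n) → EuclideanSpace ℝ (Fin n) := fun z => pinv (B z) (w (X z))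
  have hB : HasFDerivAt B (fderiv ℝ B y) y :=
    (((h.contDiffAt hy).fderiv_right (m := ∞) (by simp)).differentiableAt (by simp)).hasFDerivAt
  have hwX : ContDiffAt ℝ 1 (w ∘ X) y := h.contDiffAt_comp (by exact_mod_cast le_top) hy hw
  have hξ : HasFDerivAt ξ (fderiv ℝ ξ y) y :=
    ((((h.contDiffAt_pinv hy).of_le (by exact_mod_cast le_top)).clm_apply
      hwX).differentiableAt one_ne_zero).hasFDerivAt
  have hwB : ∀ z ∈ V, w (X z) = B z (ξ z) := fun z hz => by
    rw [← h.projT_eq hz, projT_eq_self (htan _ (h.mapsTo hz))]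
  have hdw : HasFDerivAt (w ∘ X) ((B y).comp (fderiv ℝ ξ y) + (fderiv ℝ B y).flip (ξ y)) y :=
    (hB.clm_apply hξ).congr_of_eventuallyEq
      (Filter.mem_of_superset (h.isOpen.mem_nhds hy) hwB)
  -- Symmetry of the second derivative of `X` turns `a ↦ D²X (a, ξ)` into the derivative of `dX` in
  -- direction `ξ`. By Jacobi's formula the trace of its image under `pinv` is the logarithmic
  -- derivative of the Jacobian along `ξ`.
  have hsymm : (fderiv ℝ B y).flip (ξ y) = fderiv ℝ B y (ξ y) := by
    ext1 a
    have : IsSymmSndFDerivAt ℝ X y := (h.contDiffAt hy).isSymmSndFDerivAt (by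
      rw [minSmoothness_of_isRCLikeNormedField]; exact WithTop.coe_le_coe.2 le_top)
    exact this a (ξ y)
  have hjac : HasFDerivAt (fun z => jac (B z)) ((fderiv ℝ jac (B y)).comp (fderiv ℝ B y)) y :=
    (((contDiffAt_jac (k := 1) (h.injective_fderiv hy)).differentiableAt one_ne_zero).hasFDerivAt).comp
      y hB
  have hJξ : HasFDerivAt (fun z => jac (B z) • ξ z) _ y := hjac.smul hξ
  have hpinv : (pinv (B y)).comp ((B y).comp (fderiv ℝ ξ y)) = fderiv ℝ ξ y := by
    ext1 a
    exact pinv_apply_apply (h.injective_fderiv hy) _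
  rw [hJξ.fderiv, h.tangDiv_eq hy (hwX.differentiableAt one_ne_zero), hdw.fderiv, ← traceL_apply,
    ContinuousLinearMap.comp_add, hpinv, hsymm, map_add, map_add, map_smul, traceL_smulRight]
  rw [ContinuousLinearMap.comp_apply, fderiv_jac (h.injective_fderiv hy), ← traceL_apply]
  simp only [smul_eq_mul]
  ring

theorem setIntegral_image {F : Type*} [NormedAddCommGroup F] [NormedSpace ℝ F] {g : Amb n → F}
    (hg : ContinuousOn g S) : ∫ x in X '' V, g x ∂(μHE[n] : Measure (Amb n)) =
      ∫ y in V, jac (fderiv ℝ X y) • g (X y) := by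
  have hX := (h.aemeasurable volume).mono_ac (withDensity_absolutelyContinuous _
    fun y => ENNReal.ofReal (jac (fderiv ℝ X y)))
  have hJm : AEMeasurable (fun y => Real.toNNReal (jac (fderiv ℝ X y))) (volume.restrict V) :=
    (h.contDiffOn_jac.continuousOn.aemeasurable h.isOpen.measurableSet).real_toNNReal
  have hgm : AEStronglyMeasurable g ((μHE[n] : Measure (Amb n)).restrict (X '' V)) :=
    (hg.mono (mapsTo_iff_image_subset.1 h.mapsTo)).aestronglyMeasurable h.measurableSet_image
  have := h.restrict_image
  rw [this] at hgm ⊢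
  rw [integral_map hX hgm]
  change ∫ y, g (X y) ∂((volume.restrict V).withDensity
    fun y => ((Real.toNNReal (jac (fderiv ℝ X y)) : NNReal) : ENNReal)) = _
  rw [integral_withDensity_eq_integral_smul₀ hJm]
  refine setIntegral_congr_fun h.isOpen.measurableSet fun y hy => ?_
  change ((Real.toNNReal (jac (fderiv ℝ X y)) : NNReal) : ℝ) • g (X y) = _
  rw [Real.coe_toNNReal _ (jac_pos (h.injective_fderiv hy)).le]

/-- In coordinates the integrand is the Euclidean divergence of `jac • pinv w`. The support of `w`
lies in a compact part of the chart, so this field extends by zero to a compactly supported `C¹`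
field. -/
theorem integral_tangDiv_eq_zero_of_support (hS : IsCompact S) {w : Amb n → Amb n}
    (hw : ContDiffOn ℝ 1 w S) (htan : ∀ x ∈ S, w x ∈ tangentSpaceAt S x)
    {K : Set (Amb n)} (hK : IsCompact K) (hKX : K ⊆ X '' V) (hwK : ∀ x ∈ S, x ∉ K → w x = 0)
    (hdiv : ContinuousOn (tangDiv S w) S) :
    ∫ x, tangDiv S w x ∂(surfaceMeasure S) = 0 := by
  have hXS : X '' V ⊆ S := mapsTo_iff_image_subset.1 h.mapsTo
  have h0 : ∀ x ∈ S \ X '' V, tangDiv S w x = 0 := by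
    rintro x ⟨hxS, hx⟩
    have hxK : x ∉ K := fun hx' => hx (hKX hx')
    have h1 : w =ᶠ[𝓝[S] x] fun _ => 0 := by
      filter_upwards [self_mem_nhdsWithin, mem_nhdsWithin_of_mem_nhds
        (hK.isClosed.isOpen_compl.mem_nhds hxK)] with z hz hz'
      exact hwK z hz hz'
    have h2 : HasFDerivWithinAt w (0 : Amb n →L[ℝ] Amb n) S x :=
      (hasFDerivWithinAt_const (0 : Amb n) x S).congr_of_eventuallyEq h1 (hwK x hxS hxK)
    rw [MovingSurface.tangDiv_eq h2]
    simp
  rw [surfaceMeasure, setIntegral_eq_of_subset_of_forall_sdiff_eq_zero hS.measurableSet hXS h0,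
    h.setIntegral_image hdiv]
  set ξ : EuclideanSpace ℝ (Fin n) → EuclideanSpace ℝ (Fin n) :=
    fun z => jac (fderiv ℝ X z) • pinv (fderiv ℝ X z) (w (X z))
  set ζ := V.indicator ξ
  have hK' : IsCompact (L '' K) :=
    hK.image_of_continuousOn (h.contDiffOn_inv.continuousOn.mono hKX)
  have hζ0 : ∀ y, y ∉ L '' K → ζ y = 0 := by
    intro y hy
    by_cases hyV : y ∈ V
    · simp only [ζ, ξ, indicator_of_mem hyV]
      rw [hwK _ (h.mapsTo hyV) fun hy' => hy ⟨X y, hy', h.left_inv y hyV⟩]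
      simp
    · exact indicator_of_notMem hyV _
  have hζV : ∀ y ∈ V, ζ =ᶠ[𝓝 y] ξ := fun y hy =>
    Filter.mem_of_superset (h.isOpen.mem_nhds hy) fun z hz => indicator_of_mem hz _
  have hζ : ContDiff ℝ 1 ζ := by
    rw [contDiff_iff_contDiffAt]
    intro y
    by_cases hyV : y ∈ V
    · refine ContDiffAt.congr_of_eventuallyEq ?_ (hζV y hyV)
      exact ((h.contDiffOn_jac.contDiffAt (h.isOpen.mem_nhds hyV)).of_le
        (by exact_mod_cast le_top)).smul (((h.contDiffAt_pinv hyV).of_le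
        (by exact_mod_cast le_top)).clm_apply
        (h.contDiffAt_comp (by exact_mod_cast le_top) hyV hw))
    · have hyK : y ∉ L '' K := by
        rintro ⟨x, hx, rfl⟩
        exact hyV (h.inv_mem (hKX hx))
      have : ζ =ᶠ[𝓝 y] fun _ => 0 :=
        Filter.mem_of_superset (hK'.isClosed.isOpen_compl.mem_nhds hyK) hζ0
      exact contDiffAt_const.congr_of_eventuallyEq this
  have hζc : HasCompactSupport ζ := HasCompactSupport.intro hK' hζ0
  have hζV' : ∀ y ∈ univ \ V, traceL (fderiv ℝ ζ y) = 0 := by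
    rintro y ⟨-, hyV⟩
    have hyK : y ∉ L '' K := by
      rintro ⟨x, hx, rfl⟩
      exact hyV (h.inv_mem (hKX hx))
    have : ζ =ᶠ[𝓝 y] fun _ => 0 :=
      Filter.mem_of_superset (hK'.isClosed.isOpen_compl.mem_nhds hyK) hζ0
    rw [this.fderiv_eq]
    simp
  rw [← integral_traceL_fderiv_eq_zero hζ hζc,
    ← setIntegral_univ (f := fun y => traceL (fderiv ℝ ζ y)),
    setIntegral_eq_of_subset_of_forall_sdiff_eq_zero MeasurableSet.univ (subset_univ V) hζV']
  refine setIntegral_congr_fun h.isOpen.measurableSet fun y hy => ?_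
  change jac (fderiv ℝ X y) • tangDiv S w (X y) = _
  rw [smul_eq_mul, h.jac_mul_tangDiv hw htan hy, (hζV y hy).fderiv_eq]

end LocalParam

/-- A compact set covered by smooth local parametrizations. -/
def IsParamSurface {n : ℕ} (S : Set (Amb n)) : Prop :=
  IsCompact S ∧ ∀ p ∈ S, ∃ V X L, LocalParam S V X L ∧ p ∈ X '' V

namespace IsParamSurface

variable {n : ℕ} {S : Set (Amb n)} (hS : IsParamSurface S)
include hS

theorem contDiffOn_tangDiv {k m : WithTop ℕ∞} (hm : m + 1 ≤ k) (hk : k ≤ ∞)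
    {w : Amb n → Amb n} (hw : ContDiffOn ℝ k w S) : ContDiffOn ℝ m (tangDiv S w) S := by
  intro p hp
  obtain ⟨V, X, L, h, y, hy, rfl⟩ := hS.2 p hp
  exact h.contDiffWithinAt_of_comp ((le_self_add.trans hm).trans hk) hy
    (h.contDiffAt_tangDiv_comp hm hk hy hw)

theorem contDiffOn_tangGrad {k m : WithTop ℕ∞} (hm : m + 1 ≤ k) (hk : k ≤ ∞)
    {g : Amb n → ℝ} (hg : ContDiffOn ℝ k g S) : ContDiffOn ℝ m (tangGrad S g) S := by
  intro p hp
  obtain ⟨V, X, L, h, y, hy, rfl⟩ := hS.2 p hp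
  exact h.contDiffWithinAt_of_comp ((le_self_add.trans hm).trans hk) hy
    (h.contDiffAt_tangGrad_comp hm hk hy hg)

/-- By compactness local finiteness is enough, and small closed balls in coordinates have images of
finite measure by `exists_nhds_image_le`. -/
theorem isFiniteMeasure : IsFiniteMeasure (surfaceMeasure S) := by
  have h : (μHE[n] : Measure (Amb n)) S < ⊤ := by
    refine hS.1.measure_lt_top_of_nhdsWithin fun p hp => ?_
    obtain ⟨V, X, L, h, y, hy, rfl⟩ := hS.2 p hp
    obtain ⟨r, hr, hrV⟩ := Metric.nhds_basis_closedBall.mem_iff.1 (h.isOpen.mem_nhds hy)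
    obtain ⟨W, hW, hWV, hle⟩ := h.exists_nhds_image_le hy (r := 2) (by norm_num)
    obtain ⟨r', hr', hrW⟩ := Metric.nhds_basis_closedBall.mem_iff.1 hW
    refine ⟨X '' Metric.closedBall y r', ?_, ?_⟩
    · have h1 : L ⁻¹' Metric.closedBall y r' ∈ 𝓝[S] (X y) := by
        refine (h.contDiffWithinAt_inv hy).continuousWithinAt.preimage_mem_nhdsWithin ?_
        rw [h.left_inv y hy]
        exact Metric.closedBall_mem_nhds y hr'
      filter_upwards [h1, h.image_mem_nhdsWithin hy] with x hx hx'
      exact ⟨L x, hx, h.right_inv hx'⟩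
    · refine (hle _ hrW).1.trans_lt ?_
      exact ENNReal.mul_lt_top (by simp) (ENNReal.mul_lt_top
        ENNReal.ofReal_lt_top (isCompact_closedBall y r').measure_lt_top)
  exact ⟨by rwa [surfaceMeasure, Measure.restrict_apply_univ]⟩

theorem integrable_of_continuousOn {F : Type*} [NormedAddCommGroup F] {g : Amb n → F}
    (hg : ContinuousOn g S) : Integrable g (surfaceMeasure S) := by
  have := hS.isFiniteMeasure
  have h1 : IntegrableOn g S (surfaceMeasure S) := hg.integrableOn_compact hS.1
  rwa [IntegrableOn, surfaceMeasure, Measure.restrict_restrict hS.1.measurableSet, inter_self] at h1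

/-- **Divergence theorem** on a closed surface, for tangential fields. -/
theorem integral_tangDiv_eq_zero {w : Amb n → Amb n} (hw : ContDiffOn ℝ 1 w S)
    (htan : ∀ x ∈ S, w x ∈ tangentSpaceAt S x) :
    ∫ x, tangDiv S w x ∂(surfaceMeasure S) = 0 := by
  choose! V X L hX hmem using hS.2
  have hO : ∀ p, ∃ O, IsOpen O ∧ (p ∈ S → X p '' V p = S ∩ O) := fun p => by
    by_cases hp : p ∈ S
    · obtain ⟨O, h1, h2⟩ := (hX p hp).exists_inter
      exact ⟨O, h1, fun _ => h2⟩
    · exact ⟨univ, isOpen_univ, fun h => absurd h hp⟩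
  choose O hO hXO using hO
  obtain ⟨t, htS, hcov⟩ := hS.1.elim_nhds_subcover O fun p hp =>
    (hO p).mem_nhds ((hXO p hp) ▸ hmem p hp : p ∈ S ∩ O p).2
  obtain ⟨ρ, hρ⟩ := SmoothPartitionOfUnity.exists_isSubordinate (modelWithCornersSelf ℝ (Amb n))
    hS.1.isClosed (fun p : t => O p) (fun p => hO p) (by
      intro x hx
      obtain ⟨p, hp, hxp⟩ := mem_iUnion₂.1 (hcov hx)
      exact mem_iUnion.2 ⟨⟨p, hp⟩, hxp⟩)
  have hρs : ∀ p, ContDiff ℝ 1 (ρ p) := fun p =>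
    (contMDiff_iff_contDiff.1 (ρ p).contMDiff).of_le (by exact_mod_cast le_top)
  have hρw : ∀ p, ContDiffOn ℝ 1 (fun x => ρ p x • w x) S := fun p => (hρs p).contDiffOn.smul hw
  -- The partition of unity sums to one only on `S`; this suffices, as the tangential divergence
  -- depends only on the values on `S`.
  have hsum : EqOn w (fun x => ∑ p, ρ p x • w x) S := fun x hx => by
    have := ρ.sum_eq_one hx
    rw [finsum_eq_sum_of_fintype] at this
    simp only [← Finset.sum_smul, this, one_smul]
  have hdiv : ∀ p, ContinuousOn (tangDiv S fun x => ρ p x • w x) S := fun p =>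
    (hS.contDiffOn_tangDiv (m := 0) (by simp) (by exact_mod_cast le_top) (hρw p)).continuousOn
  have h1 : ∀ x ∈ S, tangDiv S w x = ∑ p, tangDiv S (fun x => ρ p x • w x) x := fun x hx => by
    rw [tangDiv_congr hx hsum ((hw x hx).differentiableWithinAt one_ne_zero)]
    exact tangDiv_sum _ fun p _ => (hρw p x hx).differentiableWithinAt one_ne_zero
  rw [surfaceMeasure, setIntegral_congr_fun hS.1.measurableSet h1, ← surfaceMeasure,
    integral_finsetSum]
  · refine Finset.sum_eq_zero fun p _ => ?_
    have hp : (p : Amb n) ∈ S := htS p p.2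
    refine (hX p hp).integral_tangDiv_eq_zero_of_support hS.1 (hρw p)
      (fun x hx => Submodule.smul_mem _ _ (htan x hx))
      (hS.1.inter_right (isClosed_tsupport (ρ p))) ?_ ?_ (hdiv p)
    · rw [hXO p hp]
      exact inter_subset_inter_right _ (hρ p)
    · intro x hx hx'
      rw [image_eq_zero_of_notMem_tsupport fun h => hx' ⟨hx, h⟩, zero_smul]
  · intro p _
    exact hS.integrable_of_continuousOn (hdiv p)

end IsParamSurface

end MovingSurface

/-! ### Smooth functions on arbitrary sets; charts of closed hypersurfaces -/

namespace MovingSurface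

section SmoothOnSet

variable {X Y Z : Type*} [NormedAddCommGroup X] [NormedSpace ℝ X]
  [NormedAddCommGroup Y] [NormedSpace ℝ Y] [NormedAddCommGroup Z] [NormedSpace ℝ Z]

theorem SmoothOnSet.contDiffOn {S : Set X} {g : X → Y} (h : SmoothOnSet S g) :
    ContDiffOn ℝ ∞ g S := fun p hp => by
  obtain ⟨G, hG, he⟩ := h p hp
  exact hG.contDiffWithinAt.congr_of_eventuallyEq
    (he.mono fun q hq => hq.symm) (he.self_of_nhdsWithin hp).symm

theorem SmoothOnSet.comp {S : Set X} {R : Set Z} {g : X → Y} {k : Z → X} (hg : SmoothOnSet S g)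
    (hk : SmoothOnSet R k) (hRS : MapsTo k R S) : SmoothOnSet R (g ∘ k) := fun p hp => by
  obtain ⟨G, hG, he⟩ := hg (k p) (hRS hp)
  obtain ⟨K, hK, hke⟩ := hk p hp
  refine ⟨G ∘ K, hG.comp hK, ?_⟩
  have hc : Tendsto k (𝓝[R] p) (𝓝[S] (k p)) :=
    (hk.contDiffOn.continuousOn p hp).tendsto_nhdsWithin hRS
  filter_upwards [hke, hc.eventually he] with q hq hq'
  simp only [Function.comp_apply, hq, hq']

theorem SmoothOnSet.mono {S R : Set X} {g : X → Y} (h : SmoothOnSet S g) (hRS : R ⊆ S) :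
    SmoothOnSet R g := fun p hp => by
  obtain ⟨G, hG, he⟩ := h p (hRS hp)
  exact ⟨G, hG, he.filter_mono (nhdsWithin_mono _ hRS)⟩

/-- An extension agrees with `F` near every nearby point of `A ×ˢ I`, hence along vertical lines. No
interior point of `A` is needed, and at endpoints of `I` the derivative is one-sided. -/
theorem SmoothOnSet.eventually_hasDerivWithinAt {A : Set X} {I : Set ℝ}
    {F G : X × ℝ → Y} {p : X × ℝ} (hG : ContDiff ℝ ∞ G) (he : ∀ᶠ q in 𝓝[A ×ˢ I] p, G q = F q) :
    ∀ᶠ q in 𝓝[A ×ˢ I] p, HasDerivWithinAt (fun s => F (q.1, s)) (fderiv ℝ G q (0, 1)) I q.2 := by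
  filter_upwards [eventually_eventually_nhdsWithin.2 he, self_mem_nhdsWithin] with q hq hqA
  have h1 : HasDerivAt (fun s => G (q.1, s)) (fderiv ℝ G q (0, 1)) q.2 :=
    ((hG.differentiable (by simp) q).hasFDerivAt).comp_hasDerivAt (x := q.2)
      (f := fun s => (q.1, s)) ((hasDerivAt_const q.2 q.1).prodMk (hasDerivAt_id q.2))
  have hc : Tendsto (fun s => (q.1, s)) (𝓝[I] q.2) (𝓝[A ×ˢ I] q) := by
    refine tendsto_nhdsWithin_iff.2 ⟨?_, ?_⟩
    · exact ((by fun_prop : Continuous fun s : ℝ => (q.1, s)).tendsto q.2).mono_left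
        nhdsWithin_le_nhds
    · filter_upwards [self_mem_nhdsWithin] with s hs
      exact ⟨hqA.1, hs⟩
  exact h1.hasDerivWithinAt.congr_of_eventuallyEq ((hc.eventually hq).mono fun s hs => hs.symm)
    (hq.self_of_nhdsWithin hqA).symm

/-- The derivative in the last variable of a smooth function is smooth. -/
theorem SmoothOnSet.derivWithin_snd {A : Set X} {I : Set ℝ} (hI : UniqueDiffOn ℝ I)
    {F : X × ℝ → Y} (h : SmoothOnSet (A ×ˢ I) F) :
    SmoothOnSet (A ×ˢ I) fun q => derivWithin (fun s => F (q.1, s)) I q.2 := fun p hp => by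
  obtain ⟨G, hG, he⟩ := h p hp
  refine ⟨fun q => fderiv ℝ G q (0, 1),
    (hG.fderiv_right (m := ∞) (by simp)).clm_apply contDiff_const, ?_⟩
  filter_upwards [SmoothOnSet.eventually_hasDerivWithinAt hG he, self_mem_nhdsWithin] with q hq hqA
  exact (hq.derivWithin (hI _ hqA.2)).symm

theorem SmoothOnSet.hasDerivWithinAt_snd {A : Set X} {I : Set ℝ}
    {F : X × ℝ → Y} (h : SmoothOnSet (A ×ˢ I) F) {q : X × ℝ} (hq : q ∈ A ×ˢ I) :
    HasDerivWithinAt (fun s => F (q.1, s)) (derivWithin (fun s => F (q.1, s)) I q.2) I q.2 := by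
  obtain ⟨G, hG, he⟩ := h q hq
  exact ((SmoothOnSet.eventually_hasDerivWithinAt hG he).self_of_nhdsWithin
    hq).differentiableWithinAt.hasDerivWithinAt

/-- The derivative in the first variable of a `C^k` function on a product is `C^(k-1)`. -/
theorem contDiffOn_fderiv_fst {V : Set X} {I : Set ℝ} (hV : IsOpen V) (hI : UniqueDiffOn ℝ I)
    {H : X × ℝ → Y} {k m : WithTop ℕ∞} (hm : m + 1 ≤ k) (hH : ContDiffOn ℝ k H (V ×ˢ I)) :
    ContDiffOn ℝ m (fun z => fderiv ℝ (fun y => H (y, z.2)) z.1) (V ×ˢ I) := by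
  have hk0 : k ≠ 0 := by
    rintro rfl
    simp at hm
  have h1 : ContDiffOn ℝ m (fun z => (fderivWithin ℝ H (V ×ˢ I) z).comp
      (ContinuousLinearMap.inl ℝ X ℝ)) (V ×ˢ I) :=
    (hH.fderivWithin (hV.uniqueDiffOn.prod hI) hm).clm_comp contDiffOn_const
  refine h1.congr fun z hz => ?_
  have h2 := ((hH z hz).differentiableWithinAt hk0).hasFDerivWithinAt
  have h3 : HasFDerivWithinAt (fun y : X => (y, z.2)) (ContinuousLinearMap.inl ℝ X ℝ) V z.1 :=
    (hasFDerivAt_prodMk_left z.1 z.2).hasFDerivWithinAt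
  have h4 : HasFDerivWithinAt (fun y => H (y, z.2)) _ V z.1 :=
    HasFDerivWithinAt.comp (t := V ×ˢ I) z.1 h2 h3 fun y hy => ⟨hy, hz.2⟩
  exact (h4.hasFDerivAt (hV.mem_nhds hz.1)).fderiv

end SmoothOnSet

/-- A closed hypersurface is covered by smooth local parametrizations. -/
theorem IsClosedHypersurface.isParamSurface {n : ℕ} {S : Set (Amb n)}
    (hS : IsClosedHypersurface S) : IsParamSurface S := by
  refine ⟨hS.1, fun p hp => ?_⟩
  obtain ⟨e, hpe, he, hes, hflat⟩ := hS.2 p hp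
  have himg : (fun y : EuclideanSpace ℝ (Fin n) => e.symm (y, (0 : ℝ))) '' {y | (y, 0) ∈ e.target} =
      S ∩ e.source := by
    ext x
    constructor
    · rintro ⟨y, hy, rfl⟩
      have h1 := e.map_target hy
      exact ⟨(hflat _ h1).2 (by rw [e.right_inv hy]), h1⟩
    · rintro ⟨hxS, hxe⟩
      have h1 : e x = ((e x).1, (0 : ℝ)) := Prod.ext rfl ((hflat x hxe).1 hxS)
      refine ⟨(e x).1, ?_, ?_⟩
      · change ((e x).1, (0 : ℝ)) ∈ e.target
        rw [← h1]
        exact e.map_source hxe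
      · change e.symm ((e x).1, (0 : ℝ)) = x
        rw [← h1, e.left_inv hxe]
  refine ⟨{y | (y, 0) ∈ e.target}, fun y => e.symm (y, 0), fun x => (e x).1, ?_, himg ▸ ⟨hp, hpe⟩⟩
  have hc : ContDiff ℝ ∞ fun y : EuclideanSpace ℝ (Fin n) => (y, (0 : ℝ)) :=
    contDiff_id.prodMk contDiff_const
  exact
    { isOpen := e.open_target.preimage hc.continuous
      contDiffOn := hes.comp hc.contDiffOn fun y hy => hy
      contDiffOn_inv := by
        rw [himg]
        exact (contDiff_fst.comp_contDiffOn he).mono inter_subset_right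
      left_inv := fun y hy => by rw [e.right_inv hy]
      exists_inter := ⟨e.source, e.open_source, himg⟩ }

end MovingSurface

open MovingSurface

/-! ### The space-time map, transported charts and regularity of pulled-back operators -/

namespace MovingHypersurface

variable {n : ℕ} {T : ℝ} (M : MovingHypersurface n T)

/-- The space-time map `(p, t) ↦ (Φ(p, t), t)`. -/
def Ψ (z : Amb n × ℝ) : Amb n × ℝ := (M.Φ z, z.2)

/-- The inverse of `Φ(·, t)`. -/
def inv (t : ℝ) : Amb n → Amb n := Function.invFunOn (fun p => M.Φ (p, t)) M.Γ₀

variable {M}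

theorem inv_Φ {t : ℝ} (ht : t ∈ Icc 0 T) {p : Amb n} (hp : p ∈ M.Γ₀) : M.inv t (M.Φ (p, t)) = p :=
  (M.injOn t ht).leftInvOn_invFunOn hp

theorem inv_mem {t : ℝ} {x : Amb n} (hx : x ∈ M.Γ t) : M.inv t x ∈ M.Γ₀ :=
  Function.invFunOn_mem hx

theorem Φ_inv {t : ℝ} {x : Amb n} (hx : x ∈ M.Γ t) : M.Φ (M.inv t x, t) = x :=
  Function.invFunOn_eq hx

theorem Φ_mem {p : Amb n} (hp : p ∈ M.Γ₀) (t : ℝ) : M.Φ (p, t) ∈ M.Γ t := ⟨p, hp, rfl⟩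

theorem Γ_zero : M.Γ 0 = M.Γ₀ := by
  ext x
  constructor
  · rintro ⟨p, hp, rfl⟩
    change M.Φ (p, 0) ∈ M.Γ₀
    rwa [M.initial p hp]
  · intro hx
    exact ⟨x, hx, M.initial x hx⟩

theorem isParamSurface_Γ {t : ℝ} (ht : t ∈ Icc 0 T) : IsParamSurface (M.Γ t) :=
  (M.hypersurface t ht).isParamSurface

theorem isParamSurface_Γ₀ (hT : 0 < T) : IsParamSurface M.Γ₀ :=
  Γ_zero (M := M) ▸ isParamSurface_Γ (left_mem_Icc.2 hT.le)

theorem isCompact_Γ₀ (hT : 0 < T) : IsCompact M.Γ₀ := (isParamSurface_Γ₀ hT).1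

theorem contDiffOn_Φ : ContDiffOn ℝ ∞ M.Φ (M.Γ₀ ×ˢ Icc 0 T) := M.smooth.contDiffOn

theorem contDiffOn_Φ_time {t : ℝ} (ht : t ∈ Icc 0 T) :
    ContDiffOn ℝ ∞ (fun p => M.Φ (p, t)) M.Γ₀ :=
  contDiffOn_Φ.comp (contDiff_id.prodMk contDiff_const).contDiffOn fun _ hp => ⟨hp, ht⟩

theorem contDiffOn_inv {t : ℝ} (ht : t ∈ Icc 0 T) : ContDiffOn ℝ ∞ (M.inv t) (M.Γ t) :=
  (M.smooth_inv t ht).contDiffOn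

section Charts

variable {V : Set (EuclideanSpace ℝ (Fin n))} {X : EuclideanSpace ℝ (Fin n) → Amb n}
  {L : Amb n → EuclideanSpace ℝ (Fin n)}

/-- Local parametrizations are transported by the motion. -/
theorem localParam_Γ (h : LocalParam M.Γ₀ V X L) {t : ℝ} (ht : t ∈ Icc 0 T) :
    LocalParam (M.Γ t) V (fun y => M.Φ (X y, t)) (fun x => L (M.inv t x)) := by
  have himg : (fun y => M.Φ (X y, t)) '' V = M.Γ t ∩ M.inv t ⁻¹' (X '' V) := by
    ext x
    constructor
    · rintro ⟨y, hy, rfl⟩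
      refine ⟨Φ_mem (h.mapsTo hy) t, ?_⟩
      rw [mem_preimage, inv_Φ ht (h.mapsTo hy)]
      exact mem_image_of_mem X hy
    · rintro ⟨hx, y, hy, hxy⟩
      exact ⟨y, hy, by simp only [hxy, Φ_inv hx]⟩
  exact
    { isOpen := h.isOpen
      contDiffOn := (contDiffOn_Φ_time ht).comp h.contDiffOn h.mapsTo
      contDiffOn_inv := by
        rw [himg]
        exact h.contDiffOn_inv.comp ((contDiffOn_inv ht).mono inter_subset_left)
          fun x hx => hx.2
      left_inv := fun y hy => by rw [inv_Φ ht (h.mapsTo hy), h.left_inv y hy]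
      exists_inter := by
        obtain ⟨O, hO, hO'⟩ := h.exists_inter
        -- Relative openness of the transported chart is the continuity of the inverse of `Φ(·, t)`
        -- on `Γ(t)`.
        obtain ⟨O₂, hO₂, hO₂'⟩ := continuousOn_iff'.1 (contDiffOn_inv ht).continuousOn O hO
        refine ⟨O₂, hO₂, ?_⟩
        rw [himg, inter_comm (M.Γ t) O₂, ← hO₂', hO']
        ext x
        simp only [mem_inter_iff, mem_preimage]
        exact ⟨fun hx => ⟨hx.2.2, hx.1⟩, fun hx => ⟨hx.2, inv_mem hx.2, hx.1⟩⟩ }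

theorem contDiffOn_comp_chart {Y : Type*} [NormedAddCommGroup Y] [NormedSpace ℝ Y]
    {k : WithTop ℕ∞} (hk : k ≤ ∞) {I : Set ℝ} {F : Amb n × ℝ → Y} (h : LocalParam M.Γ₀ V X L)
    (hF : ContDiffOn ℝ k F (M.Γ₀ ×ˢ I)) :
    ContDiffOn ℝ k (fun z : EuclideanSpace ℝ (Fin n) × ℝ => F (X z.1, z.2)) (V ×ˢ I) :=
  hF.comp (((h.contDiffOn.of_le hk).comp contDiffOn_fst fun _ hz => hz.1).prodMk contDiffOn_snd)
    fun _ hz => ⟨h.mapsTo hz.1, hz.2⟩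

end Charts

theorem contDiffOn_of_charts {Y : Type*} [NormedAddCommGroup Y] [NormedSpace ℝ Y]
    (hT : 0 < T) {k : WithTop ℕ∞} (hk : k ≤ ∞) {I : Set ℝ} {F : Amb n × ℝ → Y}
    (hF : ∀ V X L, LocalParam M.Γ₀ V X L →
      ContDiffOn ℝ k (fun z : EuclideanSpace ℝ (Fin n) × ℝ => F (X z.1, z.2)) (V ×ˢ I)) :
    ContDiffOn ℝ k F (M.Γ₀ ×ˢ I) := by
  rintro ⟨p, t⟩ ⟨hp, ht⟩
  obtain ⟨V, X, L, h, hpX⟩ := (isParamSurface_Γ₀ hT).2 p hp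
  have h1 : ContDiffOn ℝ k (fun z : Amb n × ℝ => F (X (L z.1), z.2)) ((X '' V) ×ˢ I) :=
    (hF V X L h).comp (g := fun z : EuclideanSpace ℝ (Fin n) × ℝ => F (X z.1, z.2))
      (f := fun z : Amb n × ℝ => (L z.1, z.2))
      (((h.contDiffOn_inv.of_le hk).comp contDiffOn_fst fun z hz => hz.1).prodMk contDiffOn_snd)
      fun z hz => ⟨h.inv_mem hz.1, hz.2⟩
  have h2 : ContDiffOn ℝ k F ((X '' V) ×ˢ I) := h1.congr fun z hz => by
    rw [h.right_inv hz.1]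
  refine (h2 (p, t) ⟨hpX, ht⟩).mono_of_mem_nhdsWithin ?_
  obtain ⟨y, hy, rfl⟩ := hpX
  rw [nhdsWithin_prod_eq]
  exact prod_mem_prod (h.image_mem_nhdsWithin hy) self_mem_nhdsWithin

section Regularity

variable {k m : WithTop ℕ∞} {I : Set ℝ}

/-- The tangential gradient of a `C^k` function, pulled back to the initial surface, is
`C^(k-1)`. -/
theorem contDiffOn_grad (hT : 0 < T) (hI : UniqueDiffOn ℝ I) (hIT : I ⊆ Icc 0 T) (hm : m + 1 ≤ k)
    (hk : k ≤ ∞) {g : Amb n × ℝ → ℝ} (hg : ContDiffOn ℝ k (fun z => g (M.Ψ z)) (M.Γ₀ ×ˢ I)) :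
    ContDiffOn ℝ m (fun z => M.grad g (M.Ψ z)) (M.Γ₀ ×ˢ I) := by
  have hm' : m ≤ ∞ := (le_self_add.trans hm).trans hk
  have hk0 : k ≠ 0 := by
    rintro rfl
    simp at hm
  refine contDiffOn_of_charts hT hm' fun V X L h => ?_
  have hgX := contDiffOn_comp_chart hk h hg
  have hΦX := contDiffOn_comp_chart le_rfl h (contDiffOn_Φ.mono (prod_mono_right hIT))
  -- The transported charts share the domain `V` for all times, so their differentials can be
  -- studied jointly in `(y, t)`.
  have hB : ContDiffOn ℝ m (fun z : EuclideanSpace ℝ (Fin n) × ℝ =>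
      fderiv ℝ (fun y => M.Φ (X y, z.2)) z.1) (V ×ˢ I) := contDiffOn_fderiv_fst h.isOpen hI ((add_le_add_left hm' 1).trans (by simp)) hΦX
  have hgd := contDiffOn_fderiv_fst h.isOpen hI hm hgX
  have hpinv : ContDiffOn ℝ m (fun z : EuclideanSpace ℝ (Fin n) × ℝ =>
      pinv (fderiv ℝ (fun y => M.Φ (X y, z.2)) z.1)) (V ×ˢ I) := fun z hz => by
    have := MovingSurface.contDiffAt_pinv (k := m)
      ((localParam_Γ h (hIT hz.2)).injective_fderiv hz.1)
    exact this.comp_contDiffWithinAt z (hB z hz)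
  have h1 : ContDiffOn ℝ m (fun z : EuclideanSpace ℝ (Fin n) × ℝ =>
      adjL (pinv (fderiv ℝ (fun y => M.Φ (X y, z.2)) z.1))
        (rieszL (fderiv ℝ (fun y => g (M.Ψ (X y, z.2))) z.1))) (V ×ˢ I) :=
    (contDiff_adjL.comp_contDiffOn hpinv).clm_apply (contDiff_rieszL.comp_contDiffOn hgd)
  refine h1.congr fun z hz => ?_
  refine (localParam_Γ h (hIT hz.2)).tangGrad_eq (g := fun y => g (y, z.2)) hz.1 ?_
  have h2 : ContDiffOn ℝ k (fun y => g (M.Ψ (X y, z.2))) V :=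
    hgX.comp (contDiff_id.prodMk contDiff_const).contDiffOn fun y hy => ⟨hy, hz.2⟩
  exact (h2.contDiffAt (h.isOpen.mem_nhds hz.1)).differentiableAt hk0

theorem contDiffOn_div (hT : 0 < T) (hI : UniqueDiffOn ℝ I) (hIT : I ⊆ Icc 0 T) (hm : m + 1 ≤ k)
    (hk : k ≤ ∞) {w : Amb n × ℝ → Amb n}
    (hw : ContDiffOn ℝ k (fun z => w (M.Ψ z)) (M.Γ₀ ×ˢ I)) :
    ContDiffOn ℝ m (fun z => M.div w (M.Ψ z)) (M.Γ₀ ×ˢ I) := by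
  change ContDiffOn ℝ m (fun z => ∑ j, M.grad (fun q => w q j) (M.Ψ z) j) (M.Γ₀ ×ˢ I)
  refine ContDiffOn.sum fun j _ => ?_
  have h1 : ContDiffOn ℝ m (fun z => M.grad (fun q => w q j) (M.Ψ z)) (M.Γ₀ ×ˢ I) :=
    contDiffOn_grad hT hI hIT hm hk (contDiffOn_euclidean.1 hw j)
  exact contDiffOn_euclidean.1 h1 j

theorem contDiffOn_lap (hT : 0 < T) (hI : UniqueDiffOn ℝ I) (hIT : I ⊆ Icc 0 T)
    {g : Amb n × ℝ → ℝ} (hg : ContDiffOn ℝ ∞ (fun z => g (M.Ψ z)) (M.Γ₀ ×ˢ I)) :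
    ContDiffOn ℝ ∞ (fun z => M.lap g (M.Ψ z)) (M.Γ₀ ×ˢ I) :=
  contDiffOn_div (w := M.grad g) hT hI hIT (by simp) le_rfl
    (contDiffOn_grad hT hI hIT (by simp) le_rfl hg)

end Regularity

theorem smoothOnSet_Ψ : SmoothOnSet (M.Γ₀ ×ˢ Icc 0 T) M.Ψ := fun p hp => by
  obtain ⟨G, hG, he⟩ := M.smooth p hp
  exact ⟨fun z => (G z, z.2), hG.prodMk contDiff_snd, he.mono fun z hz => by
    simp only [Ψ, hz]⟩

theorem mapsTo_Ψ_Gbar : MapsTo M.Ψ (M.Γ₀ ×ˢ Icc 0 T) M.Gbar := fun z hz => ⟨hz.2, z.1, hz.1, rfl⟩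

theorem mapsTo_Ψ_G : MapsTo M.Ψ (M.Γ₀ ×ˢ Ioo 0 T) M.G := fun z hz => ⟨hz.2, z.1, hz.1, rfl⟩

theorem v_Ψ {z : Amb n × ℝ} (hz : z ∈ M.Γ₀ ×ˢ Icc 0 T) :
    M.v (M.Ψ z) = derivWithin (fun s => M.Φ (z.1, s)) (Icc 0 T) z.2 := by
  have : Function.invFunOn (fun y => M.Φ (y, z.2)) M.Γ₀ (M.Φ z) = z.1 := inv_Φ hz.2 hz.1
  simp only [v, Ψ, this]

theorem contDiffOn_v (hT : 0 < T) : ContDiffOn ℝ ∞ (fun z => M.v (M.Ψ z)) (M.Γ₀ ×ˢ Icc 0 T) :=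
  (M.smooth.derivWithin_snd (uniqueDiffOn_Icc hT)).contDiffOn.congr fun _ hz => v_Ψ hz

theorem contDiffOn_div_v (hT : 0 < T) :
    ContDiffOn ℝ ∞ (fun z => M.div M.v (M.Ψ z)) (M.Γ₀ ×ˢ Icc 0 T) :=
  contDiffOn_div hT (uniqueDiffOn_Icc hT) Subset.rfl (by simp) le_rfl (contDiffOn_v hT)

theorem hasDerivAt_Φ {p : Amb n} {t : ℝ} (hp : p ∈ M.Γ₀) (ht : t ∈ Ioo 0 T) :
    HasDerivAt (fun s => M.Φ (p, s)) (M.v (M.Ψ (p, t))) t := by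
  have hz : (p, t) ∈ M.Γ₀ ×ˢ Icc 0 T := ⟨hp, Ioo_subset_Icc_self ht⟩
  rw [v_Ψ hz]
  exact (M.smooth.hasDerivWithinAt_snd hz).hasDerivAt (Icc_mem_nhds ht.1 ht.2)

/-- Trajectories `s ↦ Ψ(p, s)` stay in `G_T` and have velocity `(v, 1)`. Hence any derivative of `g`
within `G_T` gives the same material derivative, an ordinary time derivative on the cylinder `Γ₀ ×
(0, T)`. -/
theorem hasDerivAt_comp_Ψ {g : Amb n × ℝ → ℝ} {p : Amb n} {t : ℝ} (hp : p ∈ M.Γ₀) (ht : t ∈ Ioo 0 T)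
    (hg : DifferentiableWithinAt ℝ g M.G (M.Ψ (p, t))) :
    HasDerivAt (fun s => g (M.Ψ (p, s))) (M.materialDeriv g (M.Ψ (p, t))) t := by
  have h1 : HasDerivAt (fun s => M.Ψ (p, s)) (M.v (M.Ψ (p, t)), 1) t :=
    (hasDerivAt_Φ hp ht).prodMk (hasDerivAt_id t)
  have h2 := HasFDerivWithinAt.comp_hasDerivWithinAt (f := fun s => M.Ψ (p, s)) (s := Ioo 0 T) t
    hg.hasFDerivWithinAt h1.hasDerivWithinAt fun s hs => mapsTo_Ψ_G ⟨hp, hs⟩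
  exact h2.hasDerivAt (Ioo_mem_nhds ht.1 ht.2)

end MovingHypersurface

/-! ### Liouville's formula and the transport of surface measure -/

namespace MovingSurface

theorem LocalParam.lintegral_image {n : ℕ} {S : Set (Amb n)} {V : Set (EuclideanSpace ℝ (Fin n))}
    {X : EuclideanSpace ℝ (Fin n) → Amb n} {L : Amb n → EuclideanSpace ℝ (Fin n)}
    (h : LocalParam S V X L) {g : Amb n → ENNReal}
    (hg : AEMeasurable g ((μHE[n] : Measure (Amb n)).restrict (X '' V))) :
    ∫⁻ x in X '' V, g x ∂(μHE[n] : Measure (Amb n)) =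
      ∫⁻ y in V, ENNReal.ofReal (jac (fderiv ℝ X y)) * g (X y) := by
  have hX := (h.aemeasurable volume).mono_ac (withDensity_absolutelyContinuous _
    fun y => ENNReal.ofReal (jac (fderiv ℝ X y)))
  have hJm : AEMeasurable (fun y => ENNReal.ofReal (jac (fderiv ℝ X y))) (volume.restrict V) :=
    (h.contDiffOn_jac.continuousOn.aemeasurable h.isOpen.measurableSet).ennreal_ofReal
  have := h.restrict_image
  rw [this] at hg ⊢
  rw [lintegral_map' hg hX]
  exact lintegral_withDensity_eq_lintegral_mul₀' hJm (hg.comp_aemeasurable hX)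

end MovingSurface

open MovingSurface

namespace MovingHypersurface

variable {n : ℕ} {T : ℝ} (M : MovingHypersurface n T)

/-- The divergence of the velocity, pulled back to the initial surface and extended constantly in
time. -/
def D (z : Amb n × ℝ) : ℝ := M.div M.v (M.Ψ (z.1, max 0 (min z.2 T)))

/-- The area density of `Γ(t)` with respect to the initial surface. -/
def J (z : Amb n × ℝ) : ℝ := Real.exp (∫ s in (0 : ℝ)..z.2, M.D (z.1, s))

variable {M}

theorem D_eq {z : Amb n × ℝ} (hz : z.2 ∈ Icc 0 T) : M.D z = M.div M.v (M.Ψ z) := by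
  simp only [D, min_eq_left hz.2, max_eq_right hz.1]

theorem continuousOn_D (hT : 0 < T) : ContinuousOn M.D (M.Γ₀ ×ˢ univ) :=
  (contDiffOn_div_v hT).continuousOn.comp
    (f := fun z : Amb n × ℝ => (z.1, max 0 (min z.2 T))) (by fun_prop)
    fun z hz => ⟨hz.1, le_max_left _ _, max_le hT.le (min_le_right _ _)⟩

theorem continuous_D (hT : 0 < T) {p : Amb n} (hp : p ∈ M.Γ₀) : Continuous fun s => M.D (p, s) :=
  (continuousOn_D hT).comp_continuous (by fun_prop) fun _ => ⟨hp, mem_univ _⟩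

theorem continuousOn_J (hT : 0 < T) : ContinuousOn M.J (M.Γ₀ ×ˢ univ) := by
  refine Real.continuous_exp.comp_continuousOn ?_
  rw [continuousOn_iff_continuous_domRestrict]
  refine intervalIntegral.continuous_parametric_intervalIntegral_of_continuous
    (f := fun (z : ↥(M.Γ₀ ×ˢ (univ : Set ℝ))) s => M.D (z.1.1, s)) ?_ (by fun_prop)
  exact (continuousOn_D hT).comp_continuous (by fun_prop) fun z => ⟨z.1.2.1, mem_univ _⟩

theorem J_pos (z : Amb n × ℝ) : 0 < M.J z := Real.exp_pos _

theorem J_zero (p : Amb n) : M.J (p, 0) = 1 := by simp [J]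

theorem hasDerivAt_J (hT : 0 < T) {p : Amb n} (hp : p ∈ M.Γ₀) (t : ℝ) :
    HasDerivAt (fun s => M.J (p, s)) (M.J (p, t) * M.D (p, t)) t :=
  (intervalIntegral.integral_hasDerivAt_right ((continuous_D hT hp).intervalIntegrable _ _)
    ((continuous_D hT hp).stronglyMeasurableAtFilter _ _) (continuous_D hT hp).continuousAt).exp

section Charts

variable {V : Set (EuclideanSpace ℝ (Fin n))} {X : EuclideanSpace ℝ (Fin n) → Amb n}
  {L : Amb n → EuclideanSpace ℝ (Fin n)} {y : EuclideanSpace ℝ (Fin n)} {t : ℝ}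

/-- The mixed derivatives of `(y, t) ↦ Φ(X y, t)` commute, and its time derivative is the velocity.
-/
theorem hasDerivAt_fderiv_chart (h : LocalParam M.Γ₀ V X L) (hy : y ∈ V) (ht : t ∈ Ioo 0 T) :
    HasDerivAt (fun s => fderiv ℝ (fun y => M.Φ (X y, s)) y)
      (fderiv ℝ (fun y => M.v (M.Ψ (X y, t))) y) t := by
  set H : EuclideanSpace ℝ (Fin n) × ℝ → Amb n := fun z => M.Φ (X z.1, z.2)
  have hU : IsOpen (V ×ˢ Ioo 0 T) := h.isOpen.prod isOpen_Ioo
  have hH : ContDiffOn ℝ ∞ H (V ×ˢ Ioo 0 T) :=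
    contDiffOn_comp_chart le_rfl h (contDiffOn_Φ.mono (prod_mono_right Ioo_subset_Icc_self))
  have hHat : ∀ z ∈ V ×ˢ Ioo 0 T, ContDiffAt ℝ ∞ H z := fun z hz =>
    hH.contDiffAt (hU.mem_nhds hz)
  have hHd : ∀ z ∈ V ×ˢ Ioo 0 T, HasFDerivAt H (fderiv ℝ H z) z := fun z hz =>
    ((hHat z hz).differentiableAt (by simp)).hasFDerivAt
  have hz : (y, t) ∈ V ×ˢ Ioo 0 T := ⟨hy, ht⟩
  have hH2 : HasFDerivAt (fderiv ℝ H) (fderiv ℝ (fderiv ℝ H) (y, t)) (y, t) :=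
    (((hHat _ hz).fderiv_right (m := ∞) (by simp)).differentiableAt (by simp)).hasFDerivAt
  have e1 : ∀ s ∈ Ioo 0 T, fderiv ℝ (fun y => M.Φ (X y, s)) y =
      (fderiv ℝ H (y, s)).comp (ContinuousLinearMap.inl ℝ _ ℝ) := fun s hs => by
    have h1 : HasFDerivAt (fun y => M.Φ (X y, s)) ((fderiv ℝ H (y, s)).comp
        (ContinuousLinearMap.inl ℝ _ ℝ)) y :=
      HasFDerivAt.comp (g := H) (f := fun y => (y, s)) y (hHd (y, s) ⟨hy, hs⟩)
        (hasFDerivAt_prodMk_left y s)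
    exact h1.fderiv
  have e2 : ∀ x ∈ V, M.v (M.Ψ (X x, t)) = fderiv ℝ H (x, t) (0, 1) := fun x hx => by
    have h1 : HasDerivAt (fun s => M.Φ (X x, s)) (fderiv ℝ H (x, t) (0, 1)) t :=
      (hHd (x, t) ⟨hx, ht⟩).comp_hasDerivAt (x := t) (f := fun s => (x, s))
        ((hasDerivAt_const t x).prodMk (hasDerivAt_id t))
    exact (hasDerivAt_Φ (h.mapsTo hx) ht).unique h1
  have d2 : HasFDerivAt (fun x => M.v (M.Ψ (X x, t)))
      (((fderiv ℝ (fderiv ℝ H) (y, t)).comp (ContinuousLinearMap.inl ℝ _ ℝ)).flip (0, 1)) y := by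
    have h1 : HasFDerivAt (fun x => fderiv ℝ H (x, t))
        ((fderiv ℝ (fderiv ℝ H) (y, t)).comp (ContinuousLinearMap.inl ℝ _ ℝ)) y :=
      hH2.comp y (hasFDerivAt_prodMk_left y t)
    have h2 := h1.clm_apply (hasFDerivAt_const ((0, 1) : EuclideanSpace ℝ (Fin n) × ℝ) y)
    refine (h2.congr_fderiv ?_).congr_of_eventuallyEq
      (Filter.mem_of_superset (h.isOpen.mem_nhds hy) e2)
    ext1 a
    simp
  have d1 : HasDerivAt (fun s => (fderiv ℝ H (y, s)).comp (ContinuousLinearMap.inl ℝ _ ℝ))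
      ((fderiv ℝ (fderiv ℝ H) (y, t) (0, 1)).comp (ContinuousLinearMap.inl ℝ _ ℝ)) t := by
    have h1 : HasDerivAt (fun s => fderiv ℝ H (y, s)) (fderiv ℝ (fderiv ℝ H) (y, t) (0, 1)) t :=
      hH2.comp_hasDerivAt (x := t) (f := fun s => (y, s))
        ((hasDerivAt_const t y).prodMk (hasDerivAt_id t))
    have h2 := h1.clm_comp (hasDerivAt_const t (ContinuousLinearMap.inl ℝ
      (EuclideanSpace ℝ (Fin n)) ℝ))
    simpa using h2
  rw [d2.fderiv]
  refine (d1.congr_of_eventuallyEq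
    (Filter.mem_of_superset (Ioo_mem_nhds ht.1 ht.2) e1)).congr_deriv ?_
  have hsymm : IsSymmSndFDerivAt ℝ H (y, t) := (hHat _ hz).isSymmSndFDerivAt (by
    rw [minSmoothness_of_isRCLikeNormedField]; exact WithTop.coe_le_coe.2 le_top)
  ext1 a
  exact hsymm _ _

/-- Liouville's formula: the density `J` describes the change of the Jacobian of a local
parametrization. -/
theorem jac_chart (hT : 0 < T) (h : LocalParam M.Γ₀ V X L) (hy : y ∈ V) (ht : t ∈ Icc 0 T) :
    jac (fderiv ℝ (fun y => M.Φ (X y, t)) y) = jac (fderiv ℝ X y) * M.J (X y, t) := by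
  -- This quotient is constant: by Jacobi's formula numerator and denominator both have logarithmic
  -- derivative `∇_Γ · v` on `(0, T)`. At the endpoints only continuity is available, which is all
  -- that the mean value theorem asks for.
  set φ : ℝ → ℝ := fun s => jac (fderiv ℝ (fun y => M.Φ (X y, s)) y) / M.J (X y, s)
  have hB : ContDiffOn ℝ ∞ (fun z : EuclideanSpace ℝ (Fin n) × ℝ =>
      fderiv ℝ (fun y => M.Φ (X y, z.2)) z.1) (V ×ˢ Icc 0 T) :=
    contDiffOn_fderiv_fst h.isOpen (uniqueDiffOn_Icc hT) (by simp)
      (contDiffOn_comp_chart le_rfl h contDiffOn_Φ)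
  have hcont : ContinuousOn φ (Icc 0 T) := by
    refine ContinuousOn.div (fun s hs => ?_) ?_ fun s _ => (J_pos _).ne'
    · have h1 : ContinuousWithinAt (fun s => fderiv ℝ (fun y => M.Φ (X y, s)) y) (Icc 0 T) s :=
        (hB.continuousOn.comp (f := fun s => (y, s)) (by fun_prop) fun s hs => ⟨hy, hs⟩) s hs
      have h2 := (contDiffAt_jac (k := 0)
        ((localParam_Γ h hs).injective_fderiv hy)).continuousAt
      exact ContinuousAt.comp_continuousWithinAt
        (f := fun s => fderiv ℝ (fun y => M.Φ (X y, s)) y) h2 h1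
    · exact (continuousOn_J hT).comp (f := fun s => (X y, s)) (by fun_prop)
        fun s _ => ⟨h.mapsTo hy, mem_univ _⟩
  have hderiv : ∀ s ∈ Ioo 0 T, HasDerivAt φ 0 s := by
    intro s hs
    have hs' := Ioo_subset_Icc_self hs
    have hinj := (localParam_Γ h hs').injective_fderiv hy
    have h1 := ((contDiffAt_jac (k := 1) hinj).differentiableAt one_ne_zero).hasFDerivAt
    have h2 := h1.comp_hasDerivAt s (hasDerivAt_fderiv_chart h hy hs)
    rw [fderiv_jac hinj] at h2
    have h3 : ContDiffOn ℝ ∞ (fun y => M.v (M.Ψ (X y, s))) V :=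
      (contDiffOn_comp_chart le_rfl h (contDiffOn_v hT)).comp
        (contDiff_id.prodMk contDiff_const).contDiffOn fun y hy => ⟨hy, hs'⟩
    have h4 := (localParam_Γ h hs').tangDiv_eq (w := fun x => M.v (x, s)) hy
      ((h3.contDiffAt (h.isOpen.mem_nhds hy)).differentiableAt (by simp))
    have h5 : M.D (X y, s) = LinearMap.trace ℝ (EuclideanSpace ℝ (Fin n))
        ((pinv (fderiv ℝ (fun y => M.Φ (X y, s)) y)).comp
          (fderiv ℝ (fun y => M.v (M.Ψ (X y, s))) y) :
          EuclideanSpace ℝ (Fin n) →L[ℝ] EuclideanSpace ℝ (Fin n)) := by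
      rw [D_eq hs']
      exact h4
    rw [← h5] at h2
    refine (h2.div (hasDerivAt_J hT (h.mapsTo hy) s) (J_pos _).ne').congr_deriv ?_
    rw [div_eq_zero_iff]
    left
    simp only [Function.comp_apply]
    ring
  have key : φ t = φ 0 := by
    rcases ht.1.eq_or_lt with h0 | h0
    · rw [← h0]
    · obtain ⟨c, hc, hc'⟩ := exists_deriv_eq_slope φ h0
        (hcont.mono (Icc_subset_Icc_right ht.2)) fun s hs =>
          (hderiv s ⟨hs.1, hs.2.trans_le ht.2⟩).differentiableAt.differentiableWithinAt
      rw [(hderiv c ⟨hc.1, hc.2.trans_le ht.2⟩).deriv, eq_comm, div_eq_zero_iff] at hc'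
      rcases hc' with hc' | hc' <;> linarith
  have h0 : φ 0 = jac (fderiv ℝ X y) := by
    have : fderiv ℝ (fun y => M.Φ (X y, 0)) y = fderiv ℝ X y := by
      refine Filter.EventuallyEq.fderiv_eq (Filter.mem_of_superset (h.isOpen.mem_nhds hy) ?_)
      exact fun x hx => M.initial _ (h.mapsTo hx)
    simp only [φ, this, J_zero, div_one]
  rw [← h0, ← key]
  simp only [φ]
  rw [div_mul_cancel₀ _ (J_pos _).ne']

end Charts

theorem σ_zero : M.σ 0 = (μHE[n] : Measure (Amb n)).restrict M.Γ₀ := by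
  rw [σ, surfaceMeasure, Γ_zero]

theorem aemeasurable_Φ_time (hT : 0 < T) {t : ℝ} (ht : t ∈ Icc 0 T) :
    AEMeasurable (fun p => M.Φ (p, t)) (M.σ 0) := by
  rw [σ_zero]
  exact (contDiffOn_Φ_time ht).continuousOn.aemeasurable (isCompact_Γ₀ hT).measurableSet

/-- The surface measures are transported by the motion. -/
theorem σ_eq_map (hT : 0 < T) {t : ℝ} (ht : t ∈ Icc 0 T) : M.σ t =
    ((M.σ 0).withDensity fun p => ENNReal.ofReal (M.J (p, t))).map fun p => M.Φ (p, t) := by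
  have hΓ₀ := (isCompact_Γ₀ (M := M) hT).measurableSet
  have hΓt := (isParamSurface_Γ (M := M) ht).1.measurableSet
  set ν := ((M.σ 0).withDensity fun p => ENNReal.ofReal (M.J (p, t))).map fun p => M.Φ (p, t)
  have hpre : ∀ A : Set (Amb n), MeasurableSet A →
      MeasurableSet (M.Γ₀ ∩ (fun p => M.Φ (p, t)) ⁻¹' A) := fun A hA => by
    have := hΓ₀.subtype_image ((contDiffOn_Φ_time (M := M) ht).continuousOn.domRestrict.measurable hA)
    convert this using 1
    ext z
    simp [and_comm]
  have hν : ∀ A : Set (Amb n), MeasurableSet A → ν A =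
      ∫⁻ p in M.Γ₀ ∩ (fun p => M.Φ (p, t)) ⁻¹' A, ENNReal.ofReal (M.J (p, t))
        ∂(μHE[n] : Measure (Amb n)) := by
    intro A hA
    have h1 : AEMeasurable (fun p => M.Φ (p, t))
        ((M.σ 0).withDensity fun p => ENNReal.ofReal (M.J (p, t))) :=
      (aemeasurable_Φ_time hT ht).mono_ac (withDensity_absolutelyContinuous _ _)
    have h2 : ((M.σ 0).withDensity fun p => ENNReal.ofReal (M.J (p, t)))
        ((fun p => M.Φ (p, t)) ⁻¹' A) = ((M.σ 0).withDensity fun p => ENNReal.ofReal (M.J (p, t)))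
        (M.Γ₀ ∩ (fun p => M.Φ (p, t)) ⁻¹' A) := by
      refine measure_congr ?_
      have h3 : ∀ᵐ p ∂((M.σ 0).withDensity fun p => ENNReal.ofReal (M.J (p, t))), p ∈ M.Γ₀ := by
        refine (withDensity_absolutelyContinuous _ _).ae_le ?_
        rw [σ_zero]
        exact ae_restrict_mem hΓ₀
      filter_upwards [h3] with p hp
      exact propext ⟨fun h => ⟨hp, h⟩, fun h => h.2⟩
    rw [Measure.map_apply_of_aemeasurable h1 hA, h2, withDensity_apply _ (hpre A hA), σ_zero,
      Measure.restrict_restrict (hpre A hA), inter_assoc, inter_comm _ M.Γ₀, ← inter_assoc,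
      inter_self]
  -- Inside a transported chart both measures are integrals over `V`. By the area formulas for `X`
  -- and for `Φ(X ·, t)` their densities agree thanks to `jac_chart`.
  have hloc : ∀ x ∈ M.Γ t, ∃ W ∈ 𝓝 x, ∀ A ⊆ W ∩ M.Γ t, MeasurableSet A → M.σ t A = ν A := by
    rintro _ ⟨p, hp, rfl⟩
    obtain ⟨V, X, L, h, y, hy, rfl⟩ := (isParamSurface_Γ₀ (M := M) hT).2 p hp
    have ht' := localParam_Γ h ht
    obtain ⟨O, hO, hO'⟩ := ht'.exists_inter
    refine ⟨O, hO.mem_nhds (hO' ▸ mem_image_of_mem _ hy : M.Φ (X y, t) ∈ M.Γ t ∩ O).2,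
      fun A hA hAm => ?_⟩
    have hAt : A ⊆ (fun y => M.Φ (X y, t)) '' V := by
      rw [hO', inter_comm]
      exact hA
    set A₀ := M.Γ₀ ∩ (fun p => M.Φ (p, t)) ⁻¹' A
    have hA₀ : A₀ ⊆ X '' V := by
      rintro p ⟨hp, hpA⟩
      obtain ⟨y, hy, hyp⟩ := hAt hpA
      exact ⟨y, hy, M.injOn t ht (h.mapsTo hy) hp hyp⟩
    have hJm : AEMeasurable (A₀.indicator fun p => ENNReal.ofReal (M.J (p, t)))
        ((μHE[n] : Measure (Amb n)).restrict (X '' V)) := by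
      refine AEMeasurable.indicator ?_ (hpre A hAm)
      refine (ContinuousOn.aemeasurable ?_ h.measurableSet_image).ennreal_ofReal
      exact (continuousOn_J hT).comp (f := fun p => (p, t)) (by fun_prop)
        fun p hp => ⟨(mapsTo_iff_image_subset.1 h.mapsTo) hp, mem_univ _⟩
    have e1 : ν A = ∫⁻ x in X '' V, A₀.indicator (fun p => ENNReal.ofReal (M.J (p, t))) x
        ∂(μHE[n] : Measure (Amb n)) := by
      rw [hν A hAm, lintegral_indicator (hpre A hAm), Measure.restrict_restrict (hpre A hAm),
        inter_eq_left.2 hA₀]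
    have e2 : M.σ t A = ∫⁻ x in (fun y => M.Φ (X y, t)) '' V, A.indicator 1 x
        ∂(μHE[n] : Measure (Amb n)) := by
      rw [lintegral_indicator_one hAm, Measure.restrict_apply hAm, inter_eq_left.2 hAt, σ,
        surfaceMeasure, Measure.restrict_apply hAm, inter_eq_left.2 (hA.trans inter_subset_right)]
    rw [e1, e2, h.lintegral_image hJm,
      ht'.lintegral_image ((measurable_one.indicator hAm).aemeasurable)]
    refine setLIntegral_congr_fun h.isOpen.measurableSet fun z hz => ?_
    by_cases hzA : M.Φ (X z, t) ∈ A
    · have : X z ∈ A₀ := ⟨h.mapsTo hz, hzA⟩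
      simp only [indicator_of_mem hzA, indicator_of_mem this, Pi.one_apply, mul_one]
      rw [jac_chart hT h hz ht, ENNReal.ofReal_mul (jac_pos (h.injective_fderiv hz)).le]
    · have : X z ∉ A₀ := fun h => hzA h.2
      simp only [indicator_of_notMem hzA, indicator_of_notMem this, mul_zero]
  have heq : ∀ A ⊆ M.Γ t, MeasurableSet A → M.σ t A = ν A := fun A hA hAm => by
    refine le_antisymm (measure_le_of_locally (fun x hx => ?_) hA hAm)
      (measure_le_of_locally (fun x hx => ?_) hA hAm)
    all_goals
      obtain ⟨W, hW, hW'⟩ := hloc x hx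
      exact ⟨W, hW, fun A hA hAm => by rw [hW' A hA hAm]⟩
  ext A hA
  have h1 : M.σ t A = M.σ t (A ∩ M.Γ t) := by
    rw [σ, surfaceMeasure, Measure.restrict_apply hA, Measure.restrict_apply (hA.inter hΓt),
      inter_assoc, inter_self]
  have h2 : ν A = ν (A ∩ M.Γ t) := by
    rw [hν A hA, hν _ (hA.inter hΓt)]
    congr 2
    ext p
    simp only [mem_inter_iff, mem_preimage]
    exact ⟨fun hp => ⟨hp.1, hp.2, Φ_mem hp.1 t⟩, fun hp => ⟨hp.1, hp.2.1⟩⟩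
  rw [h1, h2, heq _ inter_subset_right (hA.inter hΓt)]

end MovingHypersurface

open MovingSurface

/-! ### The space-time measure as an image of the reference cylinder -/

namespace MovingHypersurface

variable {n : ℕ} {T : ℝ} (M : MovingHypersurface n T)

/-- The product of the initial surface measure with Lebesgue measure on `(0, T)`. -/
def ref : Measure (Amb n × ℝ) := (M.σ 0).prod (volume.restrict (Ioo 0 T))

variable {M}

theorem isFiniteMeasure_σ {t : ℝ} (ht : t ∈ Icc 0 T) : IsFiniteMeasure (M.σ t) :=
  (isParamSurface_Γ ht).isFiniteMeasure

theorem isFiniteMeasure_σ_zero (hT : 0 < T) : IsFiniteMeasure (M.σ 0) :=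
  isFiniteMeasure_σ (left_mem_Icc.2 hT.le)

theorem isFiniteMeasure_ref (hT : 0 < T) : IsFiniteMeasure M.ref := by
  have := isFiniteMeasure_σ_zero (M := M) hT
  rw [ref]
  infer_instance

theorem ae_σ_zero_mem (hT : 0 < T) : ∀ᵐ p ∂(M.σ 0), p ∈ M.Γ₀ := by
  rw [σ_zero]
  exact ae_restrict_mem (isCompact_Γ₀ hT).measurableSet

theorem ae_ref_mem (hT : 0 < T) : ∀ᵐ z ∂M.ref, z ∈ M.Γ₀ ×ˢ Ioo 0 T := by
  have := isFiniteMeasure_σ_zero (M := M) hT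
  have h1 : ∀ᵐ z ∂M.ref, z.1 ∈ M.Γ₀ := Measure.quasiMeasurePreserving_fst.ae (ae_σ_zero_mem hT)
  have h2 : ∀ᵐ z ∂M.ref, z.2 ∈ Ioo 0 T :=
    Measure.quasiMeasurePreserving_snd.ae (ae_restrict_mem measurableSet_Ioo)
  filter_upwards [h1, h2] with z h1 h2 using ⟨h1, h2⟩

theorem measurableSet_prod (hT : 0 < T) {I : Set ℝ} (hI : MeasurableSet I) :
    MeasurableSet (M.Γ₀ ×ˢ I) := (isCompact_Γ₀ hT).measurableSet.prod hI

theorem ref_restrict (hT : 0 < T) : M.ref.restrict (M.Γ₀ ×ˢ Ioo 0 T) = M.ref :=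
  Measure.restrict_eq_self_of_ae_mem (ae_ref_mem hT)

theorem aemeasurable_ref {Y : Type*} [TopologicalSpace Y] [MeasurableSpace Y] [BorelSpace Y]
    (hT : 0 < T) {g : Amb n × ℝ → Y} (hg : ContinuousOn g (M.Γ₀ ×ˢ Ioo 0 T)) :
    AEMeasurable g M.ref := by
  rw [← ref_restrict hT]
  exact hg.aemeasurable (measurableSet_prod hT measurableSet_Ioo)

theorem aestronglyMeasurable_ref {Y : Type*} [TopologicalSpace Y]
    [TopologicalSpace.PseudoMetrizableSpace Y] [SecondCountableTopology Y]
    (hT : 0 < T) {g : Amb n × ℝ → Y} (hg : ContinuousOn g (M.Γ₀ ×ˢ Ioo 0 T)) :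
    AEStronglyMeasurable g M.ref := by
  rw [← ref_restrict hT]
  exact hg.aestronglyMeasurable (measurableSet_prod hT measurableSet_Ioo)

theorem continuousOn_Ψ : ContinuousOn M.Ψ (M.Γ₀ ×ˢ Icc 0 T) := smoothOnSet_Ψ.contDiffOn.continuousOn

/-- The reference measure with the area density. -/
def lam (M : MovingHypersurface n T) : Measure (Amb n × ℝ) :=
  M.ref.withDensity fun z => ENNReal.ofReal (M.J z)

theorem aemeasurable_J (hT : 0 < T) : AEMeasurable M.J M.ref :=
  aemeasurable_ref hT ((continuousOn_J hT).mono (prod_mono_right (subset_univ _)))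

theorem aemeasurable_Ψ (hT : 0 < T) : AEMeasurable M.Ψ M.ref :=
  aemeasurable_ref hT (continuousOn_Ψ.mono (prod_mono_right Ioo_subset_Icc_self))

theorem aemeasurable_Ψ_lam (hT : 0 < T) : AEMeasurable M.Ψ M.lam :=
  (aemeasurable_Ψ hT).mono_ac (withDensity_absolutelyContinuous _ _)

open Classical in
/-- The space-time measure is the image of the weighted reference measure. -/
theorem μ_eq_map (hT : 0 < T) : M.μ = M.lam.map M.Ψ := by
  have := isFiniteMeasure_σ_zero (M := M) hT
  have hQ : MeasurableSet (M.Γ₀ ×ˢ Ioo 0 T) := measurableSet_prod hT measurableSet_Ioo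
  -- The values of `Φ` off `Γ₀ × [0, T]` are arbitrary, whereas `Measure.bind` calls for a
  -- measurable kernel. Setting `Ψ` and `J` to zero off the cylinder makes the kernel measurable and
  -- changes it only for a null set of times.
  set Ψ' : Amb n × ℝ → Amb n × ℝ := (M.Γ₀ ×ˢ Ioo 0 T).piecewise M.Ψ fun _ => 0
  set J' : Amb n × ℝ → ℝ := (M.Γ₀ ×ˢ Ioo 0 T).piecewise M.J fun _ => 0
  have hΨ' : Measurable Ψ' := (continuousOn_Ψ.mono
    (prod_mono_right Ioo_subset_Icc_self)).measurable_piecewise continuousOn_const hQ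
  have hJ' : Measurable J' := ((continuousOn_J hT).mono
    (prod_mono_right (subset_univ _))).measurable_piecewise continuousOn_const hQ
  have hΨeq : ∀ z ∈ M.Γ₀ ×ˢ Ioo 0 T, Ψ' z = M.Ψ z := fun z hz => piecewise_eq_of_mem _ _ _ hz
  have hJeq : ∀ z ∈ M.Γ₀ ×ˢ Ioo 0 T, J' z = M.J z := fun z hz => piecewise_eq_of_mem _ _ _ hz
  have hJ'm : Measurable fun z => ENNReal.ofReal (J' z) := hJ'.ennreal_ofReal
  set κ : ℝ → Measure (Amb n × ℝ) := fun t =>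
    ((M.σ 0).withDensity fun p => ENNReal.ofReal (J' (p, t))).map fun p => Ψ' (p, t)
  have hκA : ∀ t, ∀ A : Set (Amb n × ℝ), MeasurableSet A → κ t A =
      ∫⁻ p, (Ψ' ⁻¹' A).indicator (fun z => ENNReal.ofReal (J' z)) (p, t) ∂(M.σ 0) := by
    intro t A hA
    have h1 : Measurable fun p : Amb n => (p, t) := measurable_prodMk_right
    have h2 : Measurable fun p : Amb n => Ψ' (p, t) := hΨ'.comp h1
    simp only [κ]
    rw [Measure.map_apply h2 hA, withDensity_apply _ (h2 hA), ← lintegral_indicator (h2 hA)]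
    rfl
  have hind : ∀ A : Set (Amb n × ℝ), MeasurableSet A →
      Measurable ((Ψ' ⁻¹' A).indicator fun z => ENNReal.ofReal (J' z)) := fun A hA =>
    hJ'm.indicator (hΨ' hA)
  have hκm : Measurable κ := by
    refine Measure.measurable_of_measurable_coe _ fun A hA => ?_
    simp only [hκA _ A hA]
    exact (hind A hA).lintegral_prod_left'
  have hκ : (fun t => (M.σ t).map fun x => (x, t)) =ᵐ[volume.restrict (Ioo 0 T)] κ := by
    filter_upwards [ae_restrict_mem measurableSet_Ioo] with t ht
    have ht' := Ioo_subset_Icc_self ht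
    have h1 : Measurable fun p : Amb n => (p, t) := measurable_prodMk_right
    have h2 : AEMeasurable (fun p => M.Φ (p, t))
        ((M.σ 0).withDensity fun p => ENNReal.ofReal (M.J (p, t))) :=
      (aemeasurable_Φ_time hT ht').mono_ac (withDensity_absolutelyContinuous _ _)
    rw [σ_eq_map hT ht', AEMeasurable.map_map_of_aemeasurable h1.aemeasurable h2]
    have h3 : (fun p => ENNReal.ofReal (M.J (p, t))) =ᵐ[M.σ 0]
        fun p => ENNReal.ofReal (J' (p, t)) := by
      filter_upwards [ae_σ_zero_mem hT] with p hp
      rw [hJeq (p, t) ⟨hp, ht⟩]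
    rw [withDensity_congr_ae h3]
    refine Measure.map_congr ((withDensity_absolutelyContinuous _ _).ae_le ?_)
    filter_upwards [ae_σ_zero_mem hT] with p hp
    rw [hΨeq (p, t) ⟨hp, ht⟩]
    rfl
  have hΨ : M.Ψ =ᵐ[M.ref] Ψ' := by
    filter_upwards [ae_ref_mem hT] with z hz
    rw [hΨeq z hz]
  have hJ : (fun z => ENNReal.ofReal (M.J z)) =ᵐ[M.ref] fun z => ENNReal.ofReal (J' z) := by
    filter_upwards [ae_ref_mem hT] with z hz
    rw [hJeq z hz]
  rw [lam, Measure.map_congr ((withDensity_absolutelyContinuous _ _).ae_le hΨ),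
    withDensity_congr_ae hJ]
  have hμ : M.μ = (volume.restrict (Ioo 0 T)).bind κ := by
    rw [μ, Measure.bind, Measure.bind, Measure.map_congr hκ]
  rw [hμ]
  ext A hA
  rw [Measure.bind_apply hA hκm.aemeasurable, Measure.map_apply hΨ' hA,
    withDensity_apply _ (hΨ' hA), ← lintegral_indicator (hΨ' hA), ref,
    lintegral_prod_symm _ (hind A hA).aemeasurable]
  exact lintegral_congr fun t => hκA t A hA

/-- The inverse of the space-time map. -/
def Θ (M : MovingHypersurface n T) (q : Amb n × ℝ) : Amb n × ℝ := (M.inv q.2 q.1, q.2)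

theorem Θ_Ψ {z : Amb n × ℝ} (hz : z ∈ M.Γ₀ ×ˢ Icc 0 T) : M.Θ (M.Ψ z) = z :=
  Prod.ext (inv_Φ hz.2 hz.1) rfl

theorem Ψ_Θ {q : Amb n × ℝ} (hq : q ∈ M.Gbar) : M.Ψ (M.Θ q) = q :=
  Prod.ext (Φ_inv hq.2) rfl

theorem Θ_mem {q : Amb n × ℝ} (hq : q ∈ M.Gbar) : M.Θ q ∈ M.Γ₀ ×ˢ Icc 0 T :=
  ⟨inv_mem hq.2, hq.1⟩

theorem isCompact_prod (hT : 0 < T) : IsCompact (M.Γ₀ ×ˢ Icc 0 T) :=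
  (isCompact_Γ₀ hT).prod isCompact_Icc

theorem image_Ψ : M.Ψ '' (M.Γ₀ ×ˢ Icc 0 T) = M.Gbar :=
  Subset.antisymm (mapsTo_iff_image_subset.1 mapsTo_Ψ_Gbar) fun q hq => ⟨M.Θ q, Θ_mem hq, Ψ_Θ hq⟩

theorem isCompact_Gbar (hT : 0 < T) : IsCompact M.Gbar :=
  image_Ψ (M := M) ▸ (isCompact_prod hT).image_of_continuousOn continuousOn_Ψ

/-- The inverse motion is assumed smooth only for each fixed time. Joint continuity comes from
compactness: `Ψ` maps closed subsets of the compact cylinder to closed sets. -/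
theorem continuousOn_Θ (hT : 0 < T) : ContinuousOn M.Θ M.Gbar := by
  rw [continuousOn_iff_isClosed]
  intro C hC
  refine ⟨M.Ψ '' ((M.Γ₀ ×ˢ Icc 0 T) ∩ C), ?_, ?_⟩
  · exact (((isCompact_prod hT).inter_right hC).image_of_continuousOn
      (continuousOn_Ψ.mono inter_subset_left)).isClosed
  · ext q
    constructor
    · rintro ⟨h1, h2⟩
      exact ⟨⟨M.Θ q, ⟨Θ_mem h2, h1⟩, Ψ_Θ h2⟩, h2⟩
    · rintro ⟨⟨z, ⟨hz, hzC⟩, rfl⟩, h2⟩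
      exact ⟨by rwa [mem_preimage, Θ_Ψ hz], h2⟩

theorem ae_lam_of_ref {P : Amb n × ℝ → Prop} (h : ∀ᵐ z ∂M.ref, P z) : ∀ᵐ z ∂M.lam, P z :=
  (withDensity_absolutelyContinuous _ _).ae_le h

theorem ae_ref_of_lam (hT : 0 < T) {P : Amb n × ℝ → Prop} (h : ∀ᵐ z ∂M.lam, P z) :
    ∀ᵐ z ∂M.ref, P z := by
  have := (ae_withDensity_iff_ae_restrict' (aemeasurable_J (M := M) hT).ennreal_ofReal).1 h
  rwa [show {z | ENNReal.ofReal (M.J z) ≠ 0} = univ from eq_univ_of_forall fun z => by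
    simp [J_pos z], Measure.restrict_univ] at this

theorem ae_ref_of_μ (hT : 0 < T) {P : Amb n × ℝ → Prop} (h : ∀ᵐ q ∂M.μ, P q) :
    ∀ᵐ z ∂M.ref, P (M.Ψ z) := by
  rw [μ_eq_map hT] at h
  exact ae_ref_of_lam hT (ae_of_ae_map (aemeasurable_Ψ_lam hT) h)

theorem ae_μ_mem (hT : 0 < T) : ∀ᵐ q ∂M.μ, q ∈ M.Gbar := by
  rw [μ_eq_map hT]
  refine (ae_map_iff (p := fun q => q ∈ M.Gbar) (aemeasurable_Ψ_lam hT)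
    (isCompact_Gbar hT).measurableSet).2 (ae_lam_of_ref ?_)
  filter_upwards [ae_ref_mem hT] with z hz
  exact mapsTo_Ψ_Gbar ⟨hz.1, Ioo_subset_Icc_self hz.2⟩

theorem aemeasurable_Θ (hT : 0 < T) : AEMeasurable M.Θ M.μ := by
  have h := (continuousOn_Θ (M := M) hT).aemeasurable (μ := M.μ) (isCompact_Gbar hT).measurableSet
  rwa [Measure.restrict_eq_self_of_ae_mem (ae_μ_mem hT)] at h

theorem map_Θ_μ (hT : 0 < T) : M.μ.map M.Θ = M.lam := by
  have h := aemeasurable_Θ (M := M) hT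
  rw [μ_eq_map hT] at h ⊢
  rw [AEMeasurable.map_map_of_aemeasurable h (aemeasurable_Ψ_lam hT)]
  conv_rhs => rw [← Measure.map_id (μ := M.lam)]
  refine Measure.map_congr (ae_lam_of_ref ?_)
  filter_upwards [ae_ref_mem hT] with z hz
  exact Θ_Ψ ⟨hz.1, Ioo_subset_Icc_self hz.2⟩

section Measurability

variable {Y : Type*} [TopologicalSpace Y]

/-- Measurability can be checked after pulling back. -/
theorem aestronglyMeasurable_μ (hT : 0 < T) {g : Amb n × ℝ → Y}
    (hg : AEStronglyMeasurable (fun z => g (M.Ψ z)) M.ref) : AEStronglyMeasurable g M.μ := by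
  have h1 : AEStronglyMeasurable (fun z => g (M.Ψ z)) (M.μ.map M.Θ) := by
    rw [map_Θ_μ hT]
    exact hg.mono_ac (withDensity_absolutelyContinuous _ _)
  refine (h1.comp_aemeasurable (aemeasurable_Θ hT)).congr ?_
  filter_upwards [ae_μ_mem hT] with q hq
  simp only [Function.comp_apply, Ψ_Θ hq]

end Measurability

theorem exists_J_bounds (hT : 0 < T) :
    ∃ C, 0 < C ∧ ∀ z ∈ M.Γ₀ ×ˢ Icc 0 T, M.J z ≤ C := by
  obtain ⟨C, hC⟩ := (isCompact_prod (M := M) hT).exists_bound_of_continuousOn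
    ((continuousOn_J hT).mono (prod_mono_right (subset_univ _)))
  exact ⟨max C 1, by positivity, fun z hz =>
    ((le_abs_self _).trans (hC z hz)).trans (le_max_left _ _)⟩

theorem integral_μ (hT : 0 < T) {g : Amb n × ℝ → ℝ} (hg : AEStronglyMeasurable g M.μ) :
    ∫ q, g q ∂M.μ = ∫ z, M.J z * g (M.Ψ z) ∂M.ref := by
  rw [μ_eq_map hT] at hg ⊢
  rw [integral_map (aemeasurable_Ψ_lam hT) hg]
  change ∫ z, g (M.Ψ z) ∂(M.ref.withDensity fun z => ((Real.toNNReal (M.J z) : NNReal) : ENNReal)) = _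
  rw [integral_withDensity_eq_integral_smul₀ (aemeasurable_J hT).real_toNNReal]
  refine integral_congr_ae (Eventually.of_forall fun z => ?_)
  change ((Real.toNNReal (M.J z) : NNReal) : ℝ) • g (M.Ψ z) = _
  rw [Real.coe_toNNReal _ (J_pos z).le, smul_eq_mul]

theorem isFiniteMeasure_μ (hT : 0 < T) : IsFiniteMeasure M.μ := by
  have := isFiniteMeasure_ref (M := M) hT
  obtain ⟨C, hC, hJ⟩ := exists_J_bounds (M := M) hT
  have : IsFiniteMeasure M.lam := by
    refine isFiniteMeasure_withDensity ?_
    refine ne_top_of_le_ne_top (b := ∫⁻ _, ENNReal.ofReal C ∂M.ref) (by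
      rw [lintegral_const]
      exact ENNReal.mul_ne_top ENNReal.ofReal_ne_top (measure_ne_top _ _)) (lintegral_mono_ae ?_)
    filter_upwards [ae_ref_mem hT] with z hz
    exact ENNReal.ofReal_le_ofReal (hJ z ⟨hz.1, Ioo_subset_Icc_self hz.2⟩)
  rw [μ_eq_map hT]
  infer_instance

theorem integral_σ (hT : 0 < T) {t : ℝ} (ht : t ∈ Icc 0 T) {g : Amb n → ℝ}
    (hg : ContinuousOn g (M.Γ t)) :
    ∫ x, g x ∂(M.σ t) = ∫ p, M.J (p, t) * g (M.Φ (p, t)) ∂(M.σ 0) := by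
  have hgm : AEStronglyMeasurable g (M.σ t) :=
    hg.aestronglyMeasurable (isParamSurface_Γ ht).1.measurableSet
  have hJm : AEMeasurable (fun p => M.J (p, t)) (M.σ 0) := by
    rw [σ_zero]
    refine ContinuousOn.aemeasurable ?_ (isCompact_Γ₀ hT).measurableSet
    exact (continuousOn_J hT).comp (f := fun p => (p, t)) (by fun_prop) fun p hp => ⟨hp, mem_univ _⟩
  have hΦ := (aemeasurable_Φ_time (M := M) hT ht).mono_ac
    (withDensity_absolutelyContinuous (M.σ 0) fun p => ENNReal.ofReal (M.J (p, t)))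
  rw [σ_eq_map hT ht] at hgm ⊢
  rw [integral_map hΦ hgm]
  change ∫ p, g (M.Φ (p, t))
    ∂((M.σ 0).withDensity fun p => ((Real.toNNReal (M.J (p, t)) : NNReal) : ENNReal)) = _
  rw [integral_withDensity_eq_integral_smul₀ hJm.real_toNNReal]
  refine integral_congr_ae (Eventually.of_forall fun z => ?_)
  change ((Real.toNNReal (M.J (z, t)) : NNReal) : ℝ) • g (M.Φ (z, t)) = _
  rw [Real.coe_toNNReal _ (J_pos _).le, smul_eq_mul]

end MovingHypersurface

/-! ### Fubini on compact cylinders -/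

namespace MovingSurface

section Fubini

variable {E : Type*} [NormedAddCommGroup E] [MeasurableSpace E] [BorelSpace E] {m : Measure E} [IsFiniteMeasure m] {K : Set E} {a b : ℝ} {g : E × ℝ → ℝ}

theorem integrable_prod_of_continuousOn (hK : IsCompact K) (hm : ∀ᵐ p ∂m, p ∈ K)
    (hg : ContinuousOn g (K ×ˢ Icc a b)) : Integrable g (m.prod (volume.restrict (Ioc a b))) := by
  have h1 : IntegrableOn g (K ×ˢ Icc a b) (m.prod (volume.restrict (Ioc a b))) :=
    hg.integrableOn_compact (hK.prod isCompact_Icc)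
  have h2 : ∀ᵐ z ∂(m.prod (volume.restrict (Ioc a b))), z ∈ K ×ˢ Icc a b := by
    have h3 : ∀ᵐ z ∂(m.prod (volume.restrict (Ioc a b))), z.1 ∈ K :=
      Measure.quasiMeasurePreserving_fst.ae hm
    have h4 : ∀ᵐ z ∂(m.prod (volume.restrict (Ioc a b))), z.2 ∈ Ioc a b :=
      Measure.quasiMeasurePreserving_snd.ae (ae_restrict_mem measurableSet_Ioc)
    filter_upwards [h3, h4] with z h3 h4 using ⟨h3, Ioc_subset_Icc_self h4⟩
  rwa [IntegrableOn, Measure.restrict_eq_self_of_ae_mem h2] at h1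

theorem integral_intervalIntegral_swap (hK : IsCompact K) (hm : ∀ᵐ p ∂m, p ∈ K) (hab : a ≤ b)
    (hg : ContinuousOn g (K ×ˢ Icc a b)) :
    ∫ p, (∫ t in a..b, g (p, t)) ∂m = ∫ t in a..b, ∫ p, g (p, t) ∂m := by
  simp only [intervalIntegral.integral_of_le hab]
  exact integral_integral_swap (f := fun p t => g (p, t)) (integrable_prod_of_continuousOn hK hm hg)

theorem intervalIntegrable_integral (hK : IsCompact K) (hm : ∀ᵐ p ∂m, p ∈ K) (hab : a ≤ b)
    (hg : ContinuousOn g (K ×ˢ Icc a b)) :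
    IntervalIntegrable (fun t => ∫ p, g (p, t) ∂m) volume a b := by
  rw [intervalIntegrable_iff_integrableOn_Ioc_of_le hab]
  exact (integrable_prod_of_continuousOn hK hm hg).integral_prod_right

end Fubini

/-! ### Integration by parts for diffusion and flux on a fixed surface -/

section FixedSurface

variable {n : ℕ} {S : Set (Amb n)} {u ψ : Amb n → ℝ} {h : ℝ → ℝ}

theorem IsParamSurface.ae_mem (hS : IsParamSurface S) : ∀ᵐ x ∂(surfaceMeasure S), x ∈ S :=
  ae_restrict_mem hS.1.measurableSet

theorem contDiff_deriv_of_two (hh : ContDiff ℝ 2 h) : ContDiff ℝ 1 (deriv h) :=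
  ((contDiff_succ_iff_deriv (n := 1)).1 (by simpa [one_add_one_eq_two] using hh)).2.2

/-- Integration by parts for the diffusion term. -/
theorem IsParamSurface.integral_laplace_le (hS : IsParamSurface S) (hu : ContDiffOn ℝ ∞ u S)
    (hψ : ContDiffOn ℝ ∞ ψ S) (hψ0 : ∀ x ∈ S, 0 ≤ ψ x) (hh : ContDiff ℝ 2 h)
    (hconv : ∀ s, 0 ≤ deriv (deriv h) s) :
    ∫ x, deriv h (u x) * laplaceBeltrami S u x * ψ x ∂(surfaceMeasure S) ≤
      ∫ x, h (u x) * laplaceBeltrami S ψ x ∂(surfaceMeasure S) := by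
  have hh' : ContDiff ℝ 1 (deriv h) := contDiff_deriv_of_two hh
  have h1le : (1 : WithTop ℕ∞) ≤ ∞ := by exact_mod_cast le_top
  have hgu := hS.contDiffOn_tangGrad (m := ∞) (by simp) le_rfl hu
  have hgψ := hS.contDiffOn_tangGrad (m := ∞) (by simp) le_rfl hψ
  have hlu : ContDiffOn ℝ ∞ (laplaceBeltrami S u) S :=
    hS.contDiffOn_tangDiv (m := ∞) (by simp) le_rfl hgu
  have hlψ : ContDiffOn ℝ ∞ (laplaceBeltrami S ψ) S :=
    hS.contDiffOn_tangDiv (m := ∞) (by simp) le_rfl hgψ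
  have c1 : ContDiffOn ℝ 1 (fun x => deriv h (u x)) S := hh'.comp_contDiffOn (hu.of_le h1le)
  have c2 : ContDiffOn ℝ 1 (fun x => deriv h (u x) * ψ x) S := c1.mul (hψ.of_le h1le)
  have c3 : ContDiffOn ℝ 1 (fun x => h (u x)) S :=
    (hh.of_le (by norm_num)).comp_contDiffOn (hu.of_le h1le)
  have c4 : ContDiffOn ℝ 1 (fun x => (deriv h (u x) * ψ x) • tangGrad S u x) S :=
    c2.smul (hgu.of_le h1le)
  have c5 : ContDiffOn ℝ 1 (fun x => h (u x) • tangGrad S ψ x) S := c3.smul (hgψ.of_le h1le)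
  -- Divergence theorem for `h'(u) ψ ∇u - h(u) ∇ψ`. The cross terms `h'(u) ∇u · ∇ψ` cancel, and
  -- besides the two Laplacian terms only `ψ h''(u) |∇u|² ≥ 0` is left.
  have key := hS.integral_tangDiv_eq_zero (c4.sub c5) fun x _ =>
    Submodule.sub_mem _ (Submodule.smul_mem _ _ (tangGrad_mem _ _ _))
      (Submodule.smul_mem _ _ (tangGrad_mem _ _ _))
  have hdiv : ∀ x ∈ S, tangDiv S (fun x => (deriv h (u x) * ψ x) • tangGrad S u x -
      h (u x) • tangGrad S ψ x) x = deriv h (u x) * laplaceBeltrami S u x * ψ x -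
      h (u x) * laplaceBeltrami S ψ x +
      ψ x * deriv (deriv h) (u x) * inner ℝ (tangGrad S u x) (tangGrad S u x) := by
    intro x hx
    have du := (hu x hx).differentiableWithinAt (by simp)
    have dψ := (hψ x hx).differentiableWithinAt (by simp)
    rw [tangDiv_sub ((c4 x hx).differentiableWithinAt one_ne_zero)
      ((c5 x hx).differentiableWithinAt one_ne_zero),
      tangDiv_smul ((c2 x hx).differentiableWithinAt one_ne_zero)
        ((hgu x hx).differentiableWithinAt (by simp)),
      tangDiv_smul ((c3 x hx).differentiableWithinAt one_ne_zero)
        ((hgψ x hx).differentiableWithinAt (by simp)),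
      tangGrad_mul ((c1 x hx).differentiableWithinAt one_ne_zero) dψ,
      tangGrad_comp du ((hh'.differentiable one_ne_zero) _),
      tangGrad_comp du ((hh.differentiable two_ne_zero) _)]
    simp only [inner_add_left, real_inner_smul_left, laplaceBeltrami]
    rw [real_inner_comm (tangGrad S ψ x) (tangGrad S u x)]
    ring
  have i1 : Integrable (fun x => deriv h (u x) * laplaceBeltrami S u x * ψ x) (surfaceMeasure S) :=
    hS.integrable_of_continuousOn ((c1.continuousOn.mul hlu.continuousOn).mul hψ.continuousOn)
  have i2 : Integrable (fun x => h (u x) * laplaceBeltrami S ψ x) (surfaceMeasure S) :=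
    hS.integrable_of_continuousOn (c3.continuousOn.mul hlψ.continuousOn)
  have i3 : Integrable (fun x => ψ x * deriv (deriv h) (u x) *
      inner ℝ (tangGrad S u x) (tangGrad S u x)) (surfaceMeasure S) := by
    refine hS.integrable_of_continuousOn ((hψ.continuousOn.mul ?_).mul
      (hgu.continuousOn.inner hgu.continuousOn))
    exact ((hh'.continuous_deriv (by norm_num)).comp_continuousOn hu.continuousOn)
  have i12 : Integrable (fun x => deriv h (u x) * laplaceBeltrami S u x * ψ x -
      h (u x) * laplaceBeltrami S ψ x) (surfaceMeasure S) := i1.sub i2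
  rw [integral_congr_ae (hS.ae_mem.mono hdiv), integral_add i12 i3,
    integral_sub i1 i2] at key
  have : 0 ≤ ∫ x, ψ x * deriv (deriv h) (u x) *
      inner ℝ (tangGrad S u x) (tangGrad S u x) ∂(surfaceMeasure S) :=
    integral_nonneg_of_ae (hS.ae_mem.mono fun x hx =>
      mul_nonneg (mul_nonneg (hψ0 x hx) (hconv _)) real_inner_self_nonneg)
  linarith

variable {F : Amb n × ℝ → Amb n}

/-- The derivative of a flux in its last argument. -/
def dsnd (F : Amb n × ℝ → Amb n) (q : Amb n × ℝ) : Amb n := deriv (fun s => F (q.1, s)) q.2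

theorem smoothOnSet_dsnd (hF : SmoothOnSet (S ×ˢ (univ : Set ℝ)) F) :
    SmoothOnSet (S ×ˢ (univ : Set ℝ)) (dsnd F) := by
  have := hF.derivWithin_snd uniqueDiffOn_univ
  simp only [derivWithin_univ] at this
  exact this

theorem hasDerivAt_dsnd (hF : SmoothOnSet (S ×ˢ (univ : Set ℝ)) F) {x : Amb n} (hx : x ∈ S) (s : ℝ) :
    HasDerivAt (fun s => F (x, s)) (dsnd F (x, s)) s := by
  have := hF.hasDerivWithinAt_snd (q := (x, s)) ⟨hx, mem_univ _⟩
  simp only [derivWithin_univ, hasDerivWithinAt_univ] at this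
  exact this

/-- Differentiate `F(x, s) = P F(x, s)` in `s`, where `P` is the projection to the tangent space,
linear and independent of `s`. -/
theorem dsnd_mem (hF : SmoothOnSet (S ×ˢ (univ : Set ℝ)) F)
    (htan : ∀ x ∈ S, ∀ s, F (x, s) ∈ tangentSpaceAt S x) {x : Amb n} (hx : x ∈ S) (s : ℝ) :
    dsnd F (x, s) ∈ tangentSpaceAt S x := by
  have h1 := hasDerivAt_dsnd hF hx s
  have h2 : HasDerivAt (fun s => F (x, s)) (projT S x (dsnd F (x, s))) s := by
    have h3 := (projT S x).hasFDerivAt.comp_hasDerivAt s h1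
    refine h3.congr_of_eventuallyEq (Eventually.of_forall fun s => ?_)
    exact (projT_eq_self (htan x hx s)).symm
  rw [h1.unique h2]
  exact projT_mem _ _ _

/-- Differentiate the vanishing divergence in `s`. The `s`-derivative commutes with the tangential
one by symmetry of the second derivative of a local extension, the projection being independent of
`s`. -/
theorem tangDiv_dsnd_eq_zero (hF : SmoothOnSet (S ×ˢ (univ : Set ℝ)) F)
    (hdiv : ∀ x ∈ S, ∀ s, tangDiv S (fun y => F (y, s)) x = 0) {x : Amb n} (hx : x ∈ S) (s : ℝ) :
    tangDiv S (fun y => dsnd F (y, s)) x = 0 := by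
  obtain ⟨G, hG, he⟩ := hF (x, s) ⟨hx, mem_univ _⟩
  have hGd : ∀ q, HasFDerivAt G (fderiv ℝ G q) q := fun q =>
    (hG.differentiable (by simp) q).hasFDerivAt
  have hG2 : HasFDerivAt (fderiv ℝ G) (fderiv ℝ (fderiv ℝ G) (x, s)) (x, s) :=
    ((hG.fderiv_right (m := ∞) (by simp)).differentiable (by simp) _).hasFDerivAt
  have hx1 : ∀ r, Tendsto (fun y => (y, r)) (𝓝[S] x) (𝓝[S ×ˢ (univ : Set ℝ)] (x, r)) := fun r => by
    refine tendsto_nhdsWithin_iff.2 ⟨?_, ?_⟩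
    · exact ((by fun_prop : Continuous fun y : Amb n => (y, r)).tendsto x).mono_left
        nhdsWithin_le_nhds
    · filter_upwards [self_mem_nhdsWithin] with y hy using ⟨hy, mem_univ _⟩
  have hs1 : Tendsto (fun r : ℝ => (x, r)) (𝓝 s) (𝓝[S ×ˢ (univ : Set ℝ)] (x, s)) :=
    tendsto_nhdsWithin_iff.2 ⟨(by fun_prop : Continuous fun r : ℝ => (x, r)).tendsto s,
      Eventually.of_forall fun r => ⟨hx, mem_univ _⟩⟩
  have h1 : ∀ᶠ r in 𝓝 s, ∑ j, fderiv ℝ G (x, r) (projT S x (EuclideanSpace.single j 1), 0) j = 0 := by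
    filter_upwards [hs1.eventually (eventually_eventually_nhdsWithin.2 he)] with r hr
    have h2 : HasFDerivWithinAt (fun y => F (y, r)) ((fderiv ℝ G (x, r)).comp
        (ContinuousLinearMap.inl ℝ _ ℝ)) S x := by
      have h3 : HasFDerivAt (fun y => G (y, r)) ((fderiv ℝ G (x, r)).comp
          (ContinuousLinearMap.inl ℝ _ ℝ)) x :=
        HasFDerivAt.comp (g := G) (f := fun y => (y, r)) x (hGd (x, r))
          (hasFDerivAt_prodMk_left x r)
      refine h3.hasFDerivWithinAt.congr_of_eventuallyEq
        (((hx1 r).eventually hr).mono fun y hy => hy.symm) ?_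
      exact (hr.self_of_nhdsWithin (show (x, r) ∈ S ×ˢ (univ : Set ℝ) from ⟨hx, mem_univ _⟩)).symm
    have h3 := hdiv x hx r
    rw [tangDiv_eq h2] at h3
    exact h3
  have h2 : HasDerivAt (fun r => ∑ j, fderiv ℝ G (x, r)
      (projT S x (EuclideanSpace.single j 1), 0) j)
      (∑ j, fderiv ℝ (fderiv ℝ G) (x, s) (0, 1) (projT S x (EuclideanSpace.single j 1), 0) j) s := by
    refine HasDerivAt.fun_sum fun j _ => ?_
    have h3 : HasDerivAt (fun r => fderiv ℝ G (x, r)) (fderiv ℝ (fderiv ℝ G) (x, s) (0, 1)) s :=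
      hG2.comp_hasDerivAt (x := s) (f := fun r => (x, r))
        ((hasDerivAt_const s x).prodMk (hasDerivAt_id s))
    have h4 := h3.clm_apply (hasDerivAt_const s
      ((projT S x (EuclideanSpace.single j 1), 0) : Amb n × ℝ))
    have h5 : HasDerivAt (fun r => fderiv ℝ G (x, r) (projT S x (EuclideanSpace.single j 1), 0) j)
        _ s := (EuclideanSpace.proj (𝕜 := ℝ) j : Amb n →L[ℝ] ℝ).hasFDerivAt.comp_hasDerivAt s h4
    exact h5.congr_deriv (by simp)
  have h3 := h2.unique ((hasDerivAt_const s (0 : ℝ)).congr_of_eventuallyEq h1)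
  have h4 : HasFDerivWithinAt (fun y => dsnd F (y, s))
      (((fderiv ℝ (fderiv ℝ G) (x, s)).comp (ContinuousLinearMap.inl ℝ _ ℝ)).flip (0, 1)) S x := by
    have h5 : HasFDerivAt (fun y => fderiv ℝ G (y, s))
        ((fderiv ℝ (fderiv ℝ G) (x, s)).comp (ContinuousLinearMap.inl ℝ _ ℝ)) x :=
      HasFDerivAt.comp (g := fderiv ℝ G) (f := fun y => (y, s)) x hG2 (hasFDerivAt_prodMk_left x s)
    have h6 := h5.clm_apply (hasFDerivAt_const ((0, 1) : Amb n × ℝ) x)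
    have h7 := SmoothOnSet.eventually_hasDerivWithinAt hG he
    have h8 : ∀ q : Amb n × ℝ, HasDerivWithinAt (fun s => F (q.1, s)) (fderiv ℝ G q (0, 1)) univ q.2 →
        dsnd F q = fderiv ℝ G q (0, 1) := fun q hq => (hasDerivWithinAt_univ.1 hq).deriv
    refine ((h6.congr_fderiv ?_).hasFDerivWithinAt).congr_of_eventuallyEq
      (((hx1 s).eventually h7).mono fun y hy => h8 _ hy) (h8 _ (h7.self_of_nhdsWithin
        (show (x, s) ∈ S ×ˢ (univ : Set ℝ) from ⟨hx, mem_univ _⟩)))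
    ext1 a
    simp
  have hsymm : IsSymmSndFDerivAt ℝ G (x, s) := hG.contDiffAt.isSymmSndFDerivAt (by
    rw [minSmoothness_of_isRCLikeNormedField]; exact WithTop.coe_le_coe.2 le_top)
  rw [tangDiv_eq h4, ← h3]
  refine Finset.sum_congr rfl fun j _ => ?_
  rw [hsymm]
  rfl

/-- The entropy flux along the graph of `u`, in weak form. -/
theorem IsParamSurface.integral_flux (hS : IsParamSurface S) (hu : ContDiffOn ℝ ∞ u S)
    (hψ : ContDiffOn ℝ ∞ ψ S) (hh : ContDiff ℝ 2 h) (hF : SmoothOnSet (S ×ˢ (univ : Set ℝ)) F)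
    (htan : ∀ x ∈ S, ∀ s, F (x, s) ∈ tangentSpaceAt S x)
    (hdiv : ∀ x ∈ S, ∀ s, tangDiv S (fun y => F (y, s)) x = 0) (s₀ : ℝ) :
    ∫ x, deriv h (u x) * tangDiv S (fun y => F (y, u y)) x * ψ x ∂(surfaceMeasure S) =
      -∫ x, inner ℝ (∫ τ in s₀..u x, deriv h τ • dsnd F (x, τ)) (tangGrad S ψ x)
        ∂(surfaceMeasure S) := by
  have := hS.isFiniteMeasure
  have hh' : ContDiff ℝ 1 (deriv h) := contDiff_deriv_of_two hh
  have hh'd : ∀ s, HasDerivAt (deriv h) (deriv (deriv h) s) s := fun s =>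
    ((hh'.differentiable one_ne_zero) s).hasDerivAt
  have h1le : (1 : WithTop ℕ∞) ≤ ∞ := by exact_mod_cast le_top
  have hgu := hS.contDiffOn_tangGrad (m := ∞) (by simp) le_rfl hu
  have hgψ := hS.contDiffOn_tangGrad (m := ∞) (by simp) le_rfl hψ
  have hF1 := smoothOnSet_dsnd hF
  have hF2 := smoothOnSet_dsnd hF1
  -- The entropy flux is `∫₀¹ (u - s₀) K(x, s₀ + l (u - s₀)) dl`. The divergence theorem is applied
  -- for each fixed `l` and the result integrated in `l`, so that the parameter integral itself
  -- never has to be differentiated in `x`; `K'` is the derivative of `K` in `s`.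
  set K : Amb n × ℝ → Amb n := fun q => deriv h q.2 • dsnd F q
  set K' : Amb n × ℝ → Amb n := fun q =>
    deriv h q.2 • dsnd (dsnd F) q + deriv (deriv h) q.2 • dsnd F q
  have hK : ContDiffOn ℝ 1 K (S ×ˢ (univ : Set ℝ)) :=
    (hh'.comp contDiff_snd).contDiffOn.smul (hF1.contDiffOn.of_le h1le)
  have hK'c : ContinuousOn K' (S ×ˢ (univ : Set ℝ)) :=
    ((hh'.continuous.comp continuous_snd).continuousOn.smul hF2.contDiffOn.continuousOn).add
      (((hh'.continuous_deriv (by norm_num)).comp continuous_snd).continuousOn.smul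
        hF1.contDiffOn.continuousOn)
  have hKd : ∀ x ∈ S, ∀ s, HasDerivAt (fun s => K (x, s)) (K' (x, s)) s := fun x hx s =>
    (hh'd s).smul (hasDerivAt_dsnd hF1 hx s)
  have hKtan : ∀ x ∈ S, ∀ s, K (x, s) ∈ tangentSpaceAt S x := fun x hx s =>
    Submodule.smul_mem _ _ (dsnd_mem hF htan hx s)
  have hKdiv : ∀ x ∈ S, ∀ s, tangDiv S (fun y => K (y, s)) x = 0 := fun x hx s => by
    have h1 : DifferentiableWithinAt ℝ (fun y => dsnd F (y, s)) S x := by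
      have h2 := (hF1.contDiffOn.comp (contDiff_id.prodMk contDiff_const).contDiffOn
        (fun y hy => ⟨hy, mem_univ s⟩) : ContDiffOn ℝ ∞ (fun y => dsnd F (y, s)) S)
      exact (h2 x hx).differentiableWithinAt (by simp)
    have := tangDiv_smul (g := fun _ => deriv h s) (differentiableWithinAt_const _) h1
    simp only [K]
    rw [this, tangDiv_dsnd_eq_zero hF hdiv hx, tangGrad_const, inner_zero_left, mul_zero, add_zero]
  have hl : ∀ l : ℝ, ContDiffOn ℝ ∞ (fun x => s₀ + l * (u x - s₀)) S := fun l =>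
    contDiffOn_const.add (contDiffOn_const.mul (hu.sub contDiffOn_const))
  -- the identity for each fixed `l`
  have hfix : ∀ l : ℝ, ∫ x, (u x - s₀) * inner ℝ (K (x, s₀ + l * (u x - s₀))) (tangGrad S ψ x)
      ∂(surfaceMeasure S) = -∫ x, ψ x * inner ℝ (tangGrad S u x) (K (x, s₀ + l * (u x - s₀)) +
        (l * (u x - s₀)) • K' (x, s₀ + l * (u x - s₀))) ∂(surfaceMeasure S) := by
    intro l
    have cZ : ContDiffOn ℝ 1 (fun x => K (x, s₀ + l * (u x - s₀))) S :=
      hK.comp (contDiffOn_id.prodMk ((hl l).of_le h1le)) fun x hx => ⟨hx, mem_univ _⟩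
    have cK' : ContinuousOn (fun x => K' (x, s₀ + l * (u x - s₀))) S :=
      hK'c.comp (continuousOn_id.prodMk (hl l).continuousOn) fun x hx => ⟨hx, mem_univ _⟩
    have cu : ContDiffOn ℝ ∞ (fun x => u x - s₀) S := hu.sub contDiffOn_const
    have cg : ContDiffOn ℝ 1 (fun x => (u x - s₀) * ψ x) S := (cu.mul hψ).of_le h1le
    have csm : ContDiffOn ℝ 1 (fun x => ((u x - s₀) * ψ x) • K (x, s₀ + l * (u x - s₀))) S :=
      cg.smul cZ
    have key := hS.integral_tangDiv_eq_zero csm fun x hx =>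
      Submodule.smul_mem _ _ (hKtan x hx _)
    have hval : ∀ x ∈ S, tangDiv S (fun x => ((u x - s₀) * ψ x) • K (x, s₀ + l * (u x - s₀))) x =
        (u x - s₀) * inner ℝ (K (x, s₀ + l * (u x - s₀))) (tangGrad S ψ x) +
        ψ x * inner ℝ (tangGrad S u x) (K (x, s₀ + l * (u x - s₀)) +
        (l * (u x - s₀)) • K' (x, s₀ + l * (u x - s₀))) := by
      intro x hx
      have du := (hu x hx).differentiableWithinAt (by simp)
      have dcu := (cu x hx).differentiableWithinAt (by simp)
      have dψ := (hψ x hx).differentiableWithinAt (by simp)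
      have g1 : tangGrad S (fun x => u x - s₀) x = tangGrad S u x := by
        rw [tangGrad_comp (h := fun s => s - s₀) du (by fun_prop)]
        simp
      have g2 : tangGrad S (fun x => s₀ + l * (u x - s₀)) x = l • tangGrad S u x := by
        rw [tangGrad_comp (h := fun s => s₀ + l * (s - s₀)) du (by fun_prop)]
        simp
      have hKx := ((hK (x, s₀ + l * (u x - s₀)) ⟨hx, mem_univ _⟩).differentiableWithinAt
        one_ne_zero).hasFDerivWithinAt
      have hK01 : fderivWithin ℝ K (S ×ˢ (univ : Set ℝ)) (x, s₀ + l * (u x - s₀)) (0, 1) =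
          K' (x, s₀ + l * (u x - s₀)) := by
        have h1 := HasFDerivWithinAt.comp_hasDerivWithinAt (f := fun s : ℝ => (x, s)) (s := univ)
          (s₀ + l * (u x - s₀)) hKx ((hasDerivAt_const _ x).prodMk (hasDerivAt_id _)).hasDerivWithinAt
          fun s _ => ⟨hx, mem_univ _⟩
        exact (hasDerivWithinAt_univ.1 h1).unique (hKd x hx _)
      rw [tangDiv_smul ((cg x hx).differentiableWithinAt one_ne_zero)
        ((cZ x hx).differentiableWithinAt one_ne_zero), tangGrad_mul dcu dψ, g1,
        tangDiv_comp_graph (((hl l) x hx).differentiableWithinAt (by simp)) hKx, hK01, g2,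
        hKdiv x hx]
      simp only [inner_add_left, inner_add_right, real_inner_smul_left, real_inner_smul_right]
      rw [real_inner_comm (tangGrad S ψ x)]
      ring
    rw [integral_congr_ae (hS.ae_mem.mono hval), integral_add] at key
    · linarith
    · exact hS.integrable_of_continuousOn (cu.continuousOn.mul
        (cZ.continuousOn.inner hgψ.continuousOn))
    · exact hS.integrable_of_continuousOn (hψ.continuousOn.mul (hgu.continuousOn.inner
        (cZ.continuousOn.add ((continuousOn_const.mul cu.continuousOn).smul cK'))))
  -- integrate over `l`
  have hmap : ContinuousOn (fun z : Amb n × ℝ => (z.1, s₀ + z.2 * (u z.1 - s₀)))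
      (S ×ˢ Icc (0 : ℝ) 1) := by
    have : ContinuousOn (fun z : Amb n × ℝ => u z.1) (S ×ˢ Icc (0 : ℝ) 1) :=
      hu.continuousOn.comp continuousOn_fst fun z hz => hz.1
    exact continuousOn_fst.prodMk (continuousOn_const.add
      (continuousOn_snd.mul (this.sub continuousOn_const)))
  have hmaps : MapsTo (fun z : Amb n × ℝ => (z.1, s₀ + z.2 * (u z.1 - s₀)))
      (S ×ˢ Icc (0 : ℝ) 1) (S ×ˢ (univ : Set ℝ)) := fun z hz => ⟨hz.1, mem_univ _⟩
  have e1 : ContinuousOn (fun z : Amb n × ℝ => u z.1) (S ×ˢ Icc (0 : ℝ) 1) :=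
    hu.continuousOn.comp continuousOn_fst fun z hz => hz.1
  have e2 : ContinuousOn (fun z : Amb n × ℝ => ψ z.1) (S ×ˢ Icc (0 : ℝ) 1) :=
    hψ.continuousOn.comp continuousOn_fst fun z hz => hz.1
  have e3 : ContinuousOn (fun z : Amb n × ℝ => tangGrad S ψ z.1) (S ×ˢ Icc (0 : ℝ) 1) :=
    hgψ.continuousOn.comp continuousOn_fst fun z hz => hz.1
  have e4 : ContinuousOn (fun z : Amb n × ℝ => tangGrad S u z.1) (S ×ˢ Icc (0 : ℝ) 1) :=
    hgu.continuousOn.comp continuousOn_fst fun z hz => hz.1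
  have e5 : ContinuousOn (fun z : Amb n × ℝ => K (z.1, s₀ + z.2 * (u z.1 - s₀)))
      (S ×ˢ Icc (0 : ℝ) 1) := hK.continuousOn.comp hmap hmaps
  have e6 : ContinuousOn (fun z : Amb n × ℝ => K' (z.1, s₀ + z.2 * (u z.1 - s₀)))
      (S ×ˢ Icc (0 : ℝ) 1) := hK'c.comp hmap hmaps
  have sw1 := integral_intervalIntegral_swap (m := surfaceMeasure S) hS.1 hS.ae_mem zero_le_one
    (g := fun z => (u z.1 - s₀) * inner ℝ (K (z.1, s₀ + z.2 * (u z.1 - s₀))) (tangGrad S ψ z.1))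
    ((e1.sub continuousOn_const).mul (e5.inner e3))
  have sw2 := integral_intervalIntegral_swap (m := surfaceMeasure S) hS.1 hS.ae_mem zero_le_one
    (g := fun z => ψ z.1 * inner ℝ (tangGrad S u z.1) (K (z.1, s₀ + z.2 * (u z.1 - s₀)) +
        (z.2 * (u z.1 - s₀)) • K' (z.1, s₀ + z.2 * (u z.1 - s₀))))
    (e2.mul (e4.inner (e5.add ((continuousOn_snd.mul (e1.sub continuousOn_const)).smul e6))))
  simp only [hfix, intervalIntegral.integral_neg] at sw1
  rw [← sw2] at sw1
  have hKc : ∀ x ∈ S, Continuous fun s => K (x, s) := fun x hx =>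
    continuous_iff_continuousAt.2 fun s => (hKd x hx s).continuousAt
  have hq : ∀ x ∈ S, ∫ l in (0 : ℝ)..1, (u x - s₀) * inner ℝ (K (x, s₀ + l * (u x - s₀)))
      (tangGrad S ψ x) = inner ℝ (∫ τ in s₀..u x, K (x, τ)) (tangGrad S ψ x) := by
    intro x hx
    have h1 := intervalIntegral.smul_integral_comp_add_mul (a := 0) (b := 1) (fun s => K (x, s))
      (u x - s₀) s₀
    have h2 : s₀ + (u x - s₀) * 1 = u x := by ring
    rw [mul_zero, add_zero, h2] at h1
    rw [intervalIntegral.integral_const_mul, ← h1, real_inner_smul_left, real_inner_comm]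
    congr 1
    have h3 : IntervalIntegrable (fun l => K (x, s₀ + (u x - s₀) * l)) volume 0 1 :=
      ((hKc x hx).comp (by fun_prop : Continuous fun l => s₀ + (u x - s₀) * l)).intervalIntegrable _ _
    have h4 := (innerSL ℝ (tangGrad S ψ x)).intervalIntegral_comp_comm h3
    simp only [innerSL_apply_apply] at h4
    rw [← h4]
    refine intervalIntegral.integral_congr fun l _ => ?_
    rw [real_inner_comm, mul_comm l]
  -- The integrand is the `l`-derivative of `ψ ∇u · (l K(x, s₀ + l (u - s₀)))`. At `l = 1` this is
  -- `h'(u) ψ ∇u · f_u(x, u)`, and `∇u · f_u` is the total divergence since `f` is divergence free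
  -- for fixed `s`.
  have hp : ∀ x ∈ S, ∫ l in (0 : ℝ)..1, ψ x * inner ℝ (tangGrad S u x)
      (K (x, s₀ + l * (u x - s₀)) + (l * (u x - s₀)) • K' (x, s₀ + l * (u x - s₀))) =
      deriv h (u x) * tangDiv S (fun y => F (y, u y)) x * ψ x := by
    intro x hx
    have hd : ∀ l ∈ uIcc (0 : ℝ) 1, HasDerivAt (fun l : ℝ => ψ x * inner ℝ (tangGrad S u x)
        (l • K (x, s₀ + l * (u x - s₀)))) (ψ x * inner ℝ (tangGrad S u x)
      (K (x, s₀ + l * (u x - s₀)) + (l * (u x - s₀)) • K' (x, s₀ + l * (u x - s₀)))) l := by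
      intro l _
      have h1 : HasDerivAt (fun l : ℝ => s₀ + l * (u x - s₀)) (u x - s₀) l := by
        simpa using ((hasDerivAt_id l).mul_const (u x - s₀)).const_add s₀
      have h2 := (hKd x hx (s₀ + l * (u x - s₀))).scomp l h1
      have h3 := (hasDerivAt_id l).smul h2
      have h4 := ((innerSL ℝ (tangGrad S u x)).hasFDerivAt.comp_hasDerivAt l h3).const_mul (ψ x)
      refine h4.congr_deriv ?_
      simp only [id_eq, Function.comp_apply, one_smul, innerSL_apply_apply, smul_smul]
      exact congrArg (fun y => ψ x * inner ℝ (tangGrad S u x) y) (add_comm _ _)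
    rw [intervalIntegral.integral_eq_sub_of_hasDerivAt hd]
    · have hFx := ((hF.contDiffOn (x, u x) ⟨hx, mem_univ _⟩).differentiableWithinAt
        (by simp)).hasFDerivWithinAt
      have hF01 : fderivWithin ℝ F (S ×ˢ (univ : Set ℝ)) (x, u x) (0, 1) = dsnd F (x, u x) := by
        have h1 := HasFDerivWithinAt.comp_hasDerivWithinAt (f := fun s : ℝ => (x, s)) (s := univ)
          (u x) hFx ((hasDerivAt_const _ x).prodMk (hasDerivAt_id _)).hasDerivWithinAt
          fun s _ => ⟨hx, mem_univ _⟩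
        exact (hasDerivWithinAt_univ.1 h1).unique (hasDerivAt_dsnd hF hx _)
      rw [tangDiv_comp_graph ((hu x hx).differentiableWithinAt (by simp)) hFx, hF01, hdiv x hx]
      simp only [one_smul, zero_smul, inner_zero_right, one_mul, K, real_inner_smul_right]
      rw [show s₀ + (u x - s₀) = u x by ring]
      ring
    · refine Continuous.intervalIntegrable ?_ _ _
      have k1 : Continuous fun l : ℝ => K (x, s₀ + l * (u x - s₀)) := (hKc x hx).comp (by fun_prop)
      have k2 : Continuous fun l : ℝ => K' (x, s₀ + l * (u x - s₀)) :=
        hK'c.comp_continuous (by fun_prop) fun l => ⟨hx, mem_univ _⟩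
      exact continuous_const.mul (continuous_const.inner (k1.add
        ((by fun_prop : Continuous fun l : ℝ => l * (u x - s₀)).smul k2)))
  rw [integral_congr_ae (hS.ae_mem.mono hq), integral_congr_ae (hS.ae_mem.mono hp)] at sw1
  rw [sw1, neg_neg]

end FixedSurface

end MovingSurface

/-! ### A smooth convex approximation of the positive part -/

namespace MovingSurface

section Ramp

variable {δ a : ℝ}

/-- A smooth convex approximation, at scale `δ`, of the positive part. -/
def ramp (δ a : ℝ) : ℝ := ∫ τ in (0 : ℝ)..a, Real.smoothTransition (τ / δ)

theorem continuous_smoothTransition_div (δ : ℝ) : Continuous fun τ => Real.smoothTransition (τ / δ) :=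
  Real.smoothTransition.continuous.comp (by fun_prop)

theorem hasDerivAt_ramp (δ a : ℝ) : HasDerivAt (ramp δ) (Real.smoothTransition (a / δ)) a :=
  intervalIntegral.integral_hasDerivAt_right
    ((continuous_smoothTransition_div δ).intervalIntegrable _ _)
    ((continuous_smoothTransition_div δ).stronglyMeasurableAtFilter _ _)
    (continuous_smoothTransition_div δ).continuousAt

theorem deriv_ramp (δ : ℝ) : deriv (ramp δ) = fun a => Real.smoothTransition (a / δ) :=
  funext fun a => (hasDerivAt_ramp δ a).deriv

theorem contDiff_ramp (δ : ℝ) : ContDiff ℝ ∞ (ramp δ) := by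
  rw [contDiff_infty_iff_deriv, deriv_ramp]
  exact ⟨fun a => (hasDerivAt_ramp δ a).differentiableAt,
    Real.smoothTransition.contDiff.comp (contDiff_id.div_const δ)⟩

theorem ramp_of_nonpos (hδ : 0 < δ) (ha : a ≤ 0) : ramp δ a = 0 := by
  rw [ramp, intervalIntegral.integral_congr (g := fun _ => (0 : ℝ)) fun τ hτ => ?_]
  · simp
  · rw [uIcc_of_ge ha] at hτ
    exact Real.smoothTransition.zero_of_nonpos (div_nonpos_of_nonpos_of_nonneg hτ.2 hδ.le)

theorem ramp_nonneg (hδ : 0 < δ) (a : ℝ) : 0 ≤ ramp δ a := by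
  rcases le_total a 0 with h | h
  · exact (ramp_of_nonpos hδ h).ge
  · exact intervalIntegral.integral_nonneg h fun _ _ => Real.smoothTransition.nonneg _

theorem ramp_le (ha : 0 ≤ a) : ramp δ a ≤ a := by
  have := intervalIntegral.integral_mono_on ha
    ((continuous_smoothTransition_div δ).intervalIntegrable _ _)
    (continuous_const.intervalIntegrable (μ := volume) _ _)
    (g := fun _ => (1 : ℝ)) fun x _ => Real.smoothTransition.le_one _
  simpa [ramp] using this

theorem ramp_of_le (hδ : 0 < δ) (ha : δ ≤ a) : ramp δ a = ramp δ δ + (a - δ) := by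
  have h1 : ∫ τ in δ..a, Real.smoothTransition (τ / δ) = a - δ := by
    rw [intervalIntegral.integral_congr (g := fun _ => (1 : ℝ)) fun τ hτ => ?_]
    · simp
    · rw [uIcc_of_le ha] at hτ
      exact Real.smoothTransition.one_of_one_le ((one_le_div hδ).2 hτ.1)
  rw [← h1, ramp, ramp, intervalIntegral.integral_add_adjacent_intervals
    ((continuous_smoothTransition_div δ).intervalIntegrable _ _)
    ((continuous_smoothTransition_div δ).intervalIntegrable _ _)]

theorem sub_le_ramp (hδ : 0 < δ) (a : ℝ) : a - δ ≤ ramp δ a := by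
  rcases le_total δ a with h | h
  · rw [ramp_of_le hδ h]
    linarith [ramp_nonneg hδ δ]
  · linarith [ramp_nonneg hδ a]

/-- Up to `δ`, the ramp satisfies Euler's relation for functions homogeneous of degree one, as the
positive part does exactly. The difference is the factor of `∇_Γ · v` in the entropy balance, so
dilation contributes only `O(δ)`. -/
theorem abs_ramp_sub_le (hδ : 0 < δ) (a : ℝ) :
    |ramp δ a - a * Real.smoothTransition (a / δ)| ≤ δ := by
  rcases le_total a 0 with h0 | h0
  · rw [ramp_of_nonpos hδ h0, Real.smoothTransition.zero_of_nonpos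
      (div_nonpos_of_nonpos_of_nonneg h0 hδ.le)]
    simpa using hδ.le
  have h1 := ramp_nonneg hδ a
  have h2 := ramp_le (δ := δ) h0
  rcases le_total δ a with h | h
  · rw [Real.smoothTransition.one_of_one_le ((one_le_div hδ).2 h), ramp_of_le hδ h, abs_le]
    constructor <;> linarith [ramp_nonneg hδ δ, ramp_le (δ := δ) hδ.le]
  · have h3 := mul_nonneg h0 (Real.smoothTransition.nonneg (a / δ))
    have h4 := mul_le_mul_of_nonneg_left (Real.smoothTransition.le_one (a / δ)) h0
    rw [abs_le]
    constructor <;> linarith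

theorem monotone_smoothTransition_div (hδ : 0 < δ) :
    Monotone fun τ => Real.smoothTransition (τ / δ) := fun _ _ h =>
  Real.smoothTransition.monotone (div_le_div_of_nonneg_right h hδ.le)

end Ramp

end MovingSurface

/-! ### The transport theorem and the entropy inequality at a fixed time -/

namespace MovingHypersurface
open MovingSurface

variable {n : ℕ} {T : ℝ} {M : MovingHypersurface n T} {f : Amb n × ℝ → ℝ → Amb n}

/-- The transport theorem, pulled back to the initial surface. -/
theorem integral_mul_J_sub (hT : 0 < T) {F F' : Amb n × ℝ → ℝ} {a b : ℝ} (hab : a ≤ b)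
    (hF : ContinuousOn F (M.Γ₀ ×ˢ Icc a b)) (hF' : ContinuousOn F' (M.Γ₀ ×ˢ Icc a b))
    (hd : ∀ p ∈ M.Γ₀, ∀ t ∈ Ioo a b, HasDerivAt (fun s => F (p, s)) (F' (p, t)) t) :
    (∫ p, M.J (p, b) * F (p, b) ∂(M.σ 0)) - ∫ p, M.J (p, a) * F (p, a) ∂(M.σ 0) =
      ∫ t in a..b, ∫ p, M.J (p, t) * (F' (p, t) + F (p, t) * M.D (p, t)) ∂(M.σ 0) := by
  have := isFiniteMeasure_σ_zero (M := M) hT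
  have hJ : ContinuousOn M.J (M.Γ₀ ×ˢ Icc a b) :=
    (continuousOn_J hT).mono (prod_mono_right (subset_univ _))
  have hD : ContinuousOn M.D (M.Γ₀ ×ˢ Icc a b) :=
    (continuousOn_D hT).mono (prod_mono_right (subset_univ _))
  have hc : ContinuousOn (fun z => M.J z * (F' z + F z * M.D z)) (M.Γ₀ ×ˢ Icc a b) :=
    hJ.mul (hF'.add (hF.mul hD))
  have hfix : ∀ c ∈ Icc a b, Integrable (fun p => M.J (p, c) * F (p, c)) (M.σ 0) := fun c hc => by
    have h1 : ContinuousOn (fun p => M.J (p, c) * F (p, c)) M.Γ₀ :=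
      (hJ.mul hF).comp (f := fun p => (p, c)) (by fun_prop) fun p hp => ⟨hp, hc⟩
    rw [σ, Γ_zero]
    exact (isParamSurface_Γ₀ hT).integrable_of_continuousOn h1
  rw [← integral_intervalIntegral_swap (m := M.σ 0) (isCompact_Γ₀ hT) (ae_σ_zero_mem hT) hab hc,
    ← integral_sub (hfix b (right_mem_Icc.2 hab)) (hfix a (left_mem_Icc.2 hab))]
  refine integral_congr_ae ((ae_σ_zero_mem hT).mono fun p hp => ?_)
  have hcp : ∀ {g : Amb n × ℝ → ℝ}, ContinuousOn g (M.Γ₀ ×ˢ Icc a b) →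
      ContinuousOn (fun t => g (p, t)) (Icc a b) := fun hg =>
    hg.comp (f := fun t => (p, t)) (by fun_prop) fun t ht => ⟨hp, ht⟩
  refine (intervalIntegral.integral_eq_sub_of_hasDerivAt_of_le hab (hcp (hJ.mul hF))
    (fun t ht => ?_) ((hcp hc).intervalIntegrable_of_Icc hab)).symm
  refine ((hasDerivAt_J hT hp t).mul (hd p hp t ht)).congr_deriv ?_
  ring

theorem IsFlux.continuousOn_deriv (hf : M.IsFlux f) :
    ContinuousOn (fun y : (Amb n × ℝ) × ℝ => deriv (f y.1) y.2) (M.Gbar ×ˢ univ) := by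
  have := hf.smooth.derivWithin_snd uniqueDiffOn_univ
  simp only [derivWithin_univ] at this
  exact this.contDiffOn.continuousOn

theorem IsFlux.continuousOn_entropyFlux (hf : M.IsFlux f) {h : ℝ → ℝ} (hh : ContDiff ℝ 2 h) (s₀ : ℝ) :
    ContinuousOn (fun y : (Amb n × ℝ) × ℝ => entropyFlux h f s₀ y.1 y.2) (M.Gbar ×ˢ univ) := by
  rw [continuousOn_iff_continuous_domRestrict]
  refine intervalIntegral.continuous_parametric_intervalIntegral_of_continuous
    (f := fun (y : ↥(M.Gbar ×ˢ (univ : Set ℝ))) τ => deriv h τ • deriv (f y.1.1) τ) ?_ (by fun_prop)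
  refine ((contDiff_deriv_of_two hh).continuous.comp continuous_snd).smul ?_
  exact hf.continuousOn_deriv.comp_continuous
    (f := fun z : ↥(M.Gbar ×ˢ (univ : Set ℝ)) × ℝ => (z.1.1.1, z.2)) (by fun_prop)
    fun z => ⟨z.1.2.1, mem_univ _⟩

theorem D_of_mem_Ioo {p : Amb n} {t : ℝ} (ht : t ∈ Ioo 0 T) :
    M.D (p, t) = M.div M.v (M.Ψ (p, t)) := D_eq (Ioo_subset_Icc_self ht)

variable {ε : ℝ} {w : Amb n × ℝ → ℝ} {w₀ : Amb n → ℝ} {h : ℝ → ℝ} {ψ : Amb n × ℝ → ℝ}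

/-- The entropy inequality on a fixed surface, pulled back to the initial surface. -/
theorem IsViscousSolution.integral_entropy_le (hT : 0 < T) (hf : M.IsFlux f) (hε : 0 ≤ ε)
    (hw : M.IsViscousSolution f ε w w₀) (hh : ContDiff ℝ 2 h)
    (hconv : ∀ s, 0 ≤ deriv (deriv h) s) (s₀ : ℝ) {t : ℝ} (ht : t ∈ Ioo 0 T)
    (hψ : ContDiff ℝ ∞ ψ) (hψ0 : ∀ q, 0 ≤ ψ q) :
    ∫ p, M.J (p, t) * (deriv h (w (M.Ψ (p, t))) * (M.materialDeriv w (M.Ψ (p, t)) +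
      w (M.Ψ (p, t)) * M.D (p, t)) * ψ (M.Ψ (p, t))) ∂(M.σ 0) ≤
    ∫ p, M.J (p, t) * (inner ℝ (entropyFlux h f s₀ (M.Ψ (p, t)) (w (M.Ψ (p, t))))
      (M.grad ψ (M.Ψ (p, t))) + ε * (h (w (M.Ψ (p, t))) * M.lap ψ (M.Ψ (p, t)))) ∂(M.σ 0) := by
  have ht' := Ioo_subset_Icc_self ht
  have hS := isParamSurface_Γ (M := M) ht'
  have hh' := contDiff_deriv_of_two hh
  set S := M.Γ t
  set u : Amb n → ℝ := fun x => w (x, t)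
  set χ : Amb n → ℝ := fun x => ψ (x, t)
  set F : Amb n × ℝ → Amb n := fun y => f (y.1, t) y.2
  have hu : ContDiffOn ℝ ∞ u S := hw.smooth.contDiffOn.comp
    (contDiff_id.prodMk contDiff_const).contDiffOn fun x hx => ⟨ht, hx⟩
  have hχ : ContDiffOn ℝ ∞ χ S := (hψ.comp (contDiff_id.prodMk contDiff_const)).contDiffOn
  have hF : SmoothOnSet (S ×ˢ (univ : Set ℝ)) F :=
    hf.smooth.comp (k := fun y : Amb n × ℝ => ((y.1, t), y.2))
      (fun p _ => ⟨fun y => ((y.1, t), y.2), by fun_prop, Eventually.of_forall fun _ => rfl⟩)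
      fun y hy => ⟨⟨ht', hy.1⟩, mem_univ _⟩
  have hFu : ContDiffOn ℝ ∞ (fun y => F (y, u y)) S :=
    hF.contDiffOn.comp (contDiffOn_id.prodMk hu) fun x hx => ⟨hx, mem_univ _⟩
  have hgu := hS.contDiffOn_tangGrad (m := ∞) (by simp) le_rfl hu
  have hgχ := hS.contDiffOn_tangGrad (m := ∞) (by simp) le_rfl hχ
  have hlu : ContDiffOn ℝ ∞ (laplaceBeltrami S u) S :=
    hS.contDiffOn_tangDiv (m := ∞) (by simp) le_rfl hgu
  have hlχ : ContDiffOn ℝ ∞ (laplaceBeltrami S χ) S :=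
    hS.contDiffOn_tangDiv (m := ∞) (by simp) le_rfl hgχ
  have hdF := hS.contDiffOn_tangDiv (m := ∞) (by simp) le_rfl hFu
  have c1 : ContinuousOn (fun x => deriv h (u x)) S := hh'.continuous.comp_continuousOn hu.continuousOn
  have c2 : ContinuousOn (fun x => h (u x)) S := hh.continuous.comp_continuousOn hu.continuousOn
  have c3 : ContinuousOn (fun x => deriv h (u x) * laplaceBeltrami S u x * χ x) S :=
    (c1.mul hlu.continuousOn).mul hχ.continuousOn
  have c4 : ContinuousOn (fun x => deriv h (u x) * tangDiv S (fun y => F (y, u y)) x * χ x) S :=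
    (c1.mul hdF.continuousOn).mul hχ.continuousOn
  have c5 : ContinuousOn (fun x => inner ℝ (entropyFlux h f s₀ (x, t) (u x)) (tangGrad S χ x)) S :=
    ((hf.continuousOn_entropyFlux hh s₀).comp (f := fun x => ((x, t), u x))
      ((by fun_prop : Continuous fun x : Amb n => (x, t)).continuousOn.prodMk hu.continuousOn)
      fun x hx => ⟨⟨ht', hx⟩, mem_univ _⟩).inner hgχ.continuousOn
  have c6 : ContinuousOn (fun x => h (u x) * laplaceBeltrami S χ x) S := c2.mul hlχ.continuousOn
  -- The Laplacian moves to the test function at the price of an inequality, the flux by an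
  -- identity; multiplication by `ε ≥ 0` preserves the direction.
  have k1 := hS.integral_laplace_le hu hχ (fun x _ => hψ0 _) hh hconv
  have k2 := hS.integral_flux hu hχ hh hF (fun x hx s => hf.tangent (x, t) ⟨ht', hx⟩ s)
    (fun x hx s => hf.div_free (x, t) ⟨ht', hx⟩ s) s₀
  have i1 := hS.integrable_of_continuousOn c3
  have i2 := hS.integrable_of_continuousOn c4
  have i3 := hS.integrable_of_continuousOn c5
  have i4 := hS.integrable_of_continuousOn c6
  have e1 := integral_σ (M := M) hT ht' ((continuousOn_const (c := ε)).mul c3 |>.sub c4)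
  have e2 := integral_σ (M := M) hT ht' (c5.add ((continuousOn_const (c := ε)).mul c6))
  have key : ∫ x, (ε * (deriv h (u x) * laplaceBeltrami S u x * χ x) -
      deriv h (u x) * tangDiv S (fun y => F (y, u y)) x * χ x) ∂(M.σ t) ≤
      ∫ x, (inner ℝ (entropyFlux h f s₀ (x, t) (u x)) (tangGrad S χ x) +
        ε * (h (u x) * laplaceBeltrami S χ x)) ∂(M.σ t) := by
    change ∫ x, _ ∂(surfaceMeasure S) ≤ ∫ x, _ ∂(surfaceMeasure S)
    rw [integral_sub (i1.const_mul ε) i2, integral_add i3 (i4.const_mul ε), k2,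
      integral_const_mul, integral_const_mul]
    have : ∫ x, inner ℝ (∫ τ in s₀..u x, deriv h τ • dsnd F (x, τ)) (tangGrad S χ x)
        ∂(surfaceMeasure S) =
      ∫ x, inner ℝ (entropyFlux h f s₀ (x, t) (u x)) (tangGrad S χ x) ∂(surfaceMeasure S) := rfl
    rw [this]
    linarith [mul_le_mul_of_nonneg_left k1 hε]
  refine le_of_eq_of_le ?_ (key.trans_eq e2)
  refine Eq.trans ?_ e1.symm
  refine integral_congr_ae ((ae_σ_zero_mem hT).mono fun p hp => ?_)
  have h1 := hw.pde (M.Ψ (p, t)) (mapsTo_Ψ_G ⟨hp, ht⟩)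
  -- The equation replaces material derivative plus dilation by diffusion minus flux.
  have h2 : M.materialDeriv w (M.Ψ (p, t)) + w (M.Ψ (p, t)) * M.D (p, t) =
      ε * laplaceBeltrami S u (M.Φ (p, t)) - tangDiv S (fun y => F (y, u y)) (M.Φ (p, t)) := by
    rw [D_of_mem_Ioo ht]
    have h3 : M.lap w (M.Ψ (p, t)) = laplaceBeltrami S u (M.Φ (p, t)) := rfl
    have h4 : M.div (fun z => f z (w z)) (M.Ψ (p, t)) =
      tangDiv S (fun y => F (y, u y)) (M.Φ (p, t)) := rfl
    rw [h3, h4] at h1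
    linarith
  change M.J (p, t) * (deriv h (w (M.Ψ (p, t))) * (M.materialDeriv w (M.Ψ (p, t)) +
      w (M.Ψ (p, t)) * M.D (p, t)) * ψ (M.Ψ (p, t))) = M.J (p, t) *
      (ε * (deriv h (w (M.Ψ (p, t))) * laplaceBeltrami S u (M.Φ (p, t)) * ψ (M.Ψ (p, t))) -
      deriv h (w (M.Ψ (p, t))) * tangDiv S (fun y => F (y, u y)) (M.Φ (p, t)) * ψ (M.Ψ (p, t)))
  rw [h2]
  ring

end MovingHypersurface

/-! ### The maximum principle for viscous solutions -/

namespace MovingHypersurface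
open MovingSurface

variable {n : ℕ} {T : ℝ} {M : MovingHypersurface n T} {f : Amb n × ℝ → ℝ → Amb n}
  {ε : ℝ} {w : Amb n × ℝ → ℝ} {w₀ : Amb n → ℝ}

theorem integrable_σ_zero (hT : 0 < T) {g : Amb n → ℝ} (hg : ContinuousOn g M.Γ₀) :
    Integrable g (M.σ 0) := by
  rw [σ, Γ_zero]
  exact (isParamSurface_Γ₀ hT).integrable_of_continuousOn hg

theorem aestronglyMeasurable_σ_zero (hT : 0 < T) {g : Amb n → ℝ} (hg : ContinuousOn g M.Γ₀) :
    AEStronglyMeasurable g (M.σ 0) := (integrable_σ_zero hT hg).1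

theorem continuousOn_slice {Y : Type*} [TopologicalSpace Y] {I : Set ℝ} {g : Amb n × ℝ → Y}
    (hg : ContinuousOn g (M.Γ₀ ×ˢ I)) {t : ℝ} (ht : t ∈ I) :
    ContinuousOn (fun p => g (p, t)) M.Γ₀ :=
  hg.comp (f := fun p => (p, t)) (by fun_prop) fun _ hp => ⟨hp, ht⟩

theorem continuousOn_J_slice (hT : 0 < T) (t : ℝ) : ContinuousOn (fun p => M.J (p, t)) M.Γ₀ :=
  continuousOn_slice (continuousOn_J hT) (mem_univ t)

theorem exists_D_bound (hT : 0 < T) : ∃ B, 0 ≤ B ∧ ∀ z ∈ M.Γ₀ ×ˢ Icc 0 T, |M.D z| ≤ B := by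
  obtain ⟨B, hB⟩ := (isCompact_prod (M := M) hT).exists_bound_of_continuousOn
    ((continuousOn_D hT).mono (prod_mono_right (subset_univ _)))
  exact ⟨max B 0, le_max_right _ _, fun z hz => (hB z hz).trans (le_max_left _ _)⟩

theorem grad_const (c : ℝ) (q : Amb n × ℝ) : M.grad (fun _ => c) q = 0 := tangGrad_const _

theorem lap_const (c : ℝ) (q : Amb n × ℝ) : M.lap (fun _ => c) q = 0 := by
  have h : tangGrad (M.Γ q.2) (fun _ => c) = fun _ => 0 := funext fun x => tangGrad_const _
  simp only [lap, laplaceBeltrami, h, tangDiv]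
  refine Finset.sum_eq_zero fun j _ => ?_
  change tangGrad (M.Γ q.2) (fun _ => (0 : ℝ)) q.1 j = 0
  rw [tangGrad_const]
  rfl

namespace IsViscousSolution

theorem smoothOnSet_comp (hw : M.IsViscousSolution f ε w w₀) :
    SmoothOnSet (M.Γ₀ ×ˢ Ioo 0 T) (fun z => w (M.Ψ z)) :=
  hw.smooth.comp (smoothOnSet_Ψ.mono (prod_mono_right Ioo_subset_Icc_self)) mapsTo_Ψ_G

theorem continuousOn_comp (hw : M.IsViscousSolution f ε w w₀) :
    ContinuousOn (fun z => w (M.Ψ z)) (M.Γ₀ ×ˢ Ioo 0 T) :=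
  hw.smoothOnSet_comp.contDiffOn.continuousOn

theorem hasDerivAt_comp (hw : M.IsViscousSolution f ε w w₀) {p : Amb n} (hp : p ∈ M.Γ₀) {t : ℝ}
    (ht : t ∈ Ioo 0 T) :
    HasDerivAt (fun s => w (M.Ψ (p, s))) (M.materialDeriv w (M.Ψ (p, t))) t :=
  hasDerivAt_comp_Ψ hp ht
    ((hw.smooth.contDiffOn _ (mapsTo_Ψ_G ⟨hp, ht⟩)).differentiableWithinAt (by simp))

theorem continuousOn_materialDeriv (hw : M.IsViscousSolution f ε w w₀) :
    ContinuousOn (fun z => M.materialDeriv w (M.Ψ z)) (M.Γ₀ ×ˢ Ioo 0 T) := by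
  refine (hw.smoothOnSet_comp.derivWithin_snd
    isOpen_Ioo.uniqueDiffOn).contDiffOn.continuousOn.congr fun z hz => ?_
  have h1 := (hw.hasDerivAt_comp hz.1 hz.2).hasDerivWithinAt (s := Ioo 0 T)
  exact (h1.derivWithin (isOpen_Ioo.uniqueDiffOn _ hz.2)).symm

variable {B C δ c k₀ : ℝ}

theorem hasDerivAt_ramp_comp (δ c k s : ℝ) : HasDerivAt (fun s => ramp δ (c * s - k))
    (c * Real.smoothTransition ((c * s - k) / δ)) s := by
  have h1 : HasDerivAt (fun s => c * s - k) c s := by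
    simpa using ((hasDerivAt_id s).const_mul c).sub_const k
  refine ((hasDerivAt_ramp δ (c * s - k)).comp s h1).congr_deriv (mul_comm _ _)

/-- The first derivative is nondecreasing for either sign of `c`: a negative `c` reverses the order
twice. -/
theorem deriv_deriv_ramp_comp_nonneg (hδ : 0 < δ) (c k s : ℝ) :
    0 ≤ deriv (deriv fun s => ramp δ (c * s - k)) s := by
  have h1 : (deriv fun s => ramp δ (c * s - k)) =
      fun s => c * Real.smoothTransition ((c * s - k) / δ) :=
    funext fun s => (hasDerivAt_ramp_comp δ c k s).deriv
  rw [h1]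
  refine Monotone.deriv_nonneg fun a b hab => ?_
  rcases le_total 0 c with hc | hc
  · exact mul_le_mul_of_nonneg_left (monotone_smoothTransition_div hδ
      (sub_le_sub_right (mul_le_mul_of_nonneg_left hab hc) _)) hc
  · exact mul_le_mul_of_nonpos_left (monotone_smoothTransition_div hδ
      (sub_le_sub_right (mul_le_mul_of_nonpos_left hab hc) _)) hc

/-- The growth of the part of `c * w` above the barrier `k₀ * exp (B * t)`. -/
theorem integral_ramp_sub_le (hT : 0 < T) (hf : M.IsFlux f) (hε : 0 ≤ ε)
    (hw : M.IsViscousSolution f ε w w₀) (hB : ∀ z ∈ M.Γ₀ ×ˢ Icc 0 T, |M.D z| ≤ B)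
    (hB0 : 0 ≤ B) (hC : ∀ z ∈ M.Γ₀ ×ˢ Icc 0 T, M.J z ≤ C) (hk : 0 ≤ k₀) (hδ : 0 < δ) (c : ℝ)
    {a b : ℝ} (ha : 0 < a) (hab : a ≤ b) (hb : b < T) :
    (∫ p, M.J (p, b) * ramp δ (c * w (M.Ψ (p, b)) - k₀ * Real.exp (B * b)) ∂(M.σ 0)) -
      ∫ p, M.J (p, a) * ramp δ (c * w (M.Ψ (p, a)) - k₀ * Real.exp (B * a)) ∂(M.σ 0) ≤
      (b - a) * ((M.σ 0).real univ * (C * (B * δ))) := by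
  have := isFiniteMeasure_σ_zero (M := M) hT
  have hI : Icc a b ⊆ Ioo 0 T := fun t ht => ⟨ha.trans_le ht.1, ht.2.trans_lt hb⟩
  set W : Amb n × ℝ → ℝ := fun z => w (M.Ψ z)
  set W' : Amb n × ℝ → ℝ := fun z => M.materialDeriv w (M.Ψ z)
  -- The barrier grows at rate `B ≥ |∇_Γ · v|`, fast enough to absorb any growth caused by
  -- compression of the surface.
  set k : ℝ → ℝ := fun t => k₀ * Real.exp (B * t)
  set st : ℝ → ℝ := fun r => Real.smoothTransition (r / δ)
  have hW : ContinuousOn W (M.Γ₀ ×ˢ Icc a b) := hw.continuousOn_comp.mono (prod_mono_right hI)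
  have hW' : ContinuousOn W' (M.Γ₀ ×ˢ Icc a b) :=
    hw.continuousOn_materialDeriv.mono (prod_mono_right hI)
  have hst : Continuous st := continuous_smoothTransition_div δ
  have hkc : Continuous k := by fun_prop
  have hk' : ∀ t, HasDerivAt k (B * k t) t := fun t => by
    have h1 : HasDerivAt (fun t => B * t) B t := by simpa using (hasDerivAt_id t).const_mul B
    refine (h1.exp.const_mul k₀).congr_deriv ?_
    simp only [k]
    ring
  have hk0 : ∀ t, 0 ≤ k t := fun t => mul_nonneg hk (Real.exp_pos _).le
  have harg : ContinuousOn (fun z : Amb n × ℝ => c * W z - k z.2) (M.Γ₀ ×ˢ Icc a b) :=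
    (continuousOn_const.mul hW).sub (hkc.comp continuous_snd).continuousOn
  have hJ : ContinuousOn M.J (M.Γ₀ ×ˢ Icc a b) :=
    (continuousOn_J hT).mono (prod_mono_right (subset_univ _))
  have hD : ContinuousOn M.D (M.Γ₀ ×ˢ Icc a b) :=
    (continuousOn_D hT).mono (prod_mono_right (subset_univ _))
  set F : Amb n × ℝ → ℝ := fun z => ramp δ (c * W z - k z.2)
  set F' : Amb n × ℝ → ℝ := fun z => st (c * W z - k z.2) * (c * W' z - B * k z.2)
  have hFc : ContinuousOn F (M.Γ₀ ×ˢ Icc a b) :=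
    (contDiff_ramp δ).continuous.comp_continuousOn harg
  have hF'c : ContinuousOn F' (M.Γ₀ ×ˢ Icc a b) :=
    (hst.comp_continuousOn harg).mul ((continuousOn_const.mul hW').sub
      (continuousOn_const.mul (hkc.comp continuous_snd).continuousOn))
  have hFd : ∀ p ∈ M.Γ₀, ∀ t ∈ Ioo a b, HasDerivAt (fun s => F (p, s)) (F' (p, t)) t := by
    intro p hp t ht
    exact (hasDerivAt_ramp δ _).comp t
      (((hw.hasDerivAt_comp hp (hI (Ioo_subset_Icc_self ht))).const_mul c).sub (hk' t))
  have hc : ContinuousOn (fun z => M.J z * (F' z + F z * M.D z)) (M.Γ₀ ×ˢ Icc a b) :=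
    hJ.mul (hF'c.add (hFc.mul hD))
  rw [integral_mul_J_sub hT (F := F) hab hFc hF'c hFd, ← smul_eq_mul (b - a),
    ← intervalIntegral.integral_const]
  refine intervalIntegral.integral_mono_on hab (intervalIntegrable_integral (isCompact_Γ₀ hT)
    (ae_σ_zero_mem hT) hab hc) (continuous_const.intervalIntegrable _ _) fun t ht => ?_
  have ht0 : t ∈ Ioo 0 T := hI ht
  have hh : ContDiff ℝ 2 fun s => ramp δ (c * s - k t) :=
    ((contDiff_ramp δ).of_le (WithTop.coe_le_coe.2 le_top)).comp (by fun_prop)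
  -- The barrier is frozen at time `t`. With test function 1 the flux and the diffusion drop out, so
  -- the base point `0` of the entropy flux plays no role.
  have key := hw.integral_entropy_le hT hf hε hh (deriv_deriv_ramp_comp_nonneg hδ c (k t)) 0 ht0
    (ψ := fun _ => 1) contDiff_const fun _ => zero_le_one
  simp only [grad_const, lap_const, inner_zero_right, mul_zero, add_zero, integral_zero,
    (hasDerivAt_ramp_comp δ c (k t) _).deriv, mul_one] at key
  have hcont : ContinuousOn (fun p => M.J (p, t) * (c * st (c * W (p, t) - k t) *
      (W' (p, t) + W (p, t) * M.D (p, t)))) M.Γ₀ := by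
    have h1 : ContinuousOn (fun z : Amb n × ℝ => M.J z * (c * st (c * W z - k z.2) *
      (W' z + W z * M.D z))) (M.Γ₀ ×ˢ Icc a b) :=
      hJ.mul ((continuousOn_const.mul (hst.comp_continuousOn harg)).mul (hW'.add (hW.mul hD)))
    exact continuousOn_slice h1 ht
  have hmono : ∫ p, M.J (p, t) * (F' (p, t) + F (p, t) * M.D (p, t)) ∂(M.σ 0) ≤
      ∫ p, (M.J (p, t) * (c * st (c * W (p, t) - k t) *
      (W' (p, t) + W (p, t) * M.D (p, t))) + C * (B * δ)) ∂(M.σ 0) := by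
    refine integral_mono_ae (integrable_σ_zero hT (continuousOn_slice hc ht))
      ((integrable_σ_zero hT hcont).add (integrable_const _)) ?_
    filter_upwards [ae_σ_zero_mem hT] with p hp
    have hz : (p, t) ∈ M.Γ₀ ×ˢ Icc 0 T := ⟨hp, Ioo_subset_Icc_self ht0⟩
    have b1 := abs_le.1 (hB _ hz)
    have b2 := abs_ramp_sub_le hδ (c * W (p, t) - k t)
    have b3 : 0 ≤ st (c * W (p, t) - k t) := Real.smoothTransition.nonneg _
    have b4 : M.D (p, t) * (ramp δ (c * W (p, t) - k t) -
        (c * W (p, t) - k t) * st (c * W (p, t) - k t)) ≤ B * δ := by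
      refine (le_abs_self _).trans ?_
      rw [abs_mul]
      exact mul_le_mul (hB _ hz) b2 (abs_nonneg _) hB0
    -- The contribution of the moving barrier, `B k`, dominates the dilation term left by replacing
    -- `c W` with `c W - k`.
    have b5 : 0 ≤ st (c * W (p, t) - k t) * k t * (B + M.D (p, t)) :=
      mul_nonneg (mul_nonneg b3 (hk0 t)) (by linarith)
    have b6 : F' (p, t) + F (p, t) * M.D (p, t) ≤ c * st (c * W (p, t) - k t) *
        (W' (p, t) + W (p, t) * M.D (p, t)) + B * δ := by
      simp only [F, F']
      nlinarith
    have b7 := mul_le_mul_of_nonneg_left b6 (J_pos (M := M) (p, t)).le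
    have b8 := mul_le_mul_of_nonneg_right (hC _ hz) (mul_nonneg hB0 hδ.le)
    linarith
  rw [integral_add (integrable_σ_zero hT hcont) (integrable_const _), integral_const,
    smul_eq_mul] at hmono
  linarith

theorem integrable_initial (hT : 0 < T) {K : ℝ} (hm : AEStronglyMeasurable w₀ (M.σ 0))
    (h0 : ∀ᵐ p ∂(M.σ 0), |w₀ p| ≤ K) : Integrable w₀ (M.σ 0) := by
  have := isFiniteMeasure_σ_zero (M := M) hT
  exact Integrable.of_bound hm K h0

theorem tendsto_integral_abs_sub (hw : M.IsViscousSolution f ε w w₀) (hT : 0 < T)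
    (hm : AEStronglyMeasurable w₀ (M.σ 0)) :
    Tendsto (fun t => ∫ p, |w (M.Ψ (p, t)) - w₀ p| ∂(M.σ 0)) (𝓝[>] 0) (𝓝 0) := by
  have h1 := (ENNReal.tendsto_toReal ENNReal.zero_ne_top).comp hw.initial
  rw [ENNReal.toReal_zero] at h1
  refine h1.congr' ?_
  filter_upwards [Ioo_mem_nhdsGT hT] with t ht
  have h2 : AEStronglyMeasurable (fun p => w (M.Ψ (p, t)) - w₀ p) (M.σ 0) :=
    (aestronglyMeasurable_σ_zero hT (continuousOn_slice hw.continuousOn_comp ht)).sub hm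
  have h3 := integral_norm_eq_lintegral_enorm h2
  simp only [Real.norm_eq_abs] at h3
  rw [h3, Function.comp_apply, eLpNorm_one_eq_lintegral_enorm]
  rfl

/-- The part of `c w` above the barrier vanishes initially in the `L¹` sense and grows by at most
`O(δ)`. Letting the starting time and then `δ` tend to zero shows that it stays zero. The factor `c
= ±1` serves to bound `w` from both sides. -/
theorem mul_le_barrier (hT : 0 < T) (hf : M.IsFlux f) (hε : 0 ≤ ε)
    (hw : M.IsViscousSolution f ε w w₀) (hB : ∀ z ∈ M.Γ₀ ×ˢ Icc 0 T, |M.D z| ≤ B)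
    (hB0 : 0 ≤ B) (hi : Integrable w₀ (M.σ 0)) (hk : 0 ≤ k₀)
    (h0 : ∀ᵐ p ∂(M.σ 0), c * w₀ p ≤ k₀) {t : ℝ} (ht : t ∈ Ioo 0 T) :
    ∀ᵐ p ∂(M.σ 0), c * w (M.Ψ (p, t)) ≤ k₀ * Real.exp (B * t) := by
  have := isFiniteMeasure_σ_zero (M := M) hT
  obtain ⟨C, hC0, hC⟩ := exists_J_bounds (M := M) hT
  set V := (M.σ 0).real univ
  have hV : 0 ≤ V := measureReal_nonneg
  have hWi : ∀ s ∈ Ioo 0 T, Integrable (fun p => w (M.Ψ (p, s))) (M.σ 0) := fun s hs =>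
    integrable_σ_zero hT (continuousOn_slice hw.continuousOn_comp hs)
  have harg : ContinuousOn (fun p => c * w (M.Ψ (p, t)) - k₀ * Real.exp (B * t)) M.Γ₀ :=
    (continuousOn_const.mul (continuousOn_slice hw.continuousOn_comp ht)).sub continuousOn_const
  -- the initial contribution vanishes
  have hstart : ∀ δ, 0 < δ → ∀ a ∈ Ioo 0 T,
      ∫ p, M.J (p, a) * ramp δ (c * w (M.Ψ (p, a)) - k₀ * Real.exp (B * a)) ∂(M.σ 0) ≤
      C * |c| * ∫ p, |w (M.Ψ (p, a)) - w₀ p| ∂(M.σ 0) := by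
    intro δ hδ a ha
    rw [← integral_const_mul]
    refine integral_mono_of_nonneg (Eventually.of_forall fun p =>
      mul_nonneg (J_pos _).le (ramp_nonneg hδ _)) (((hWi a ha).sub hi).abs.const_mul _) ?_
    filter_upwards [h0, ae_σ_zero_mem hT] with p hp0 hp
    have h1 : k₀ ≤ k₀ * Real.exp (B * a) :=
      le_mul_of_one_le_right hk (Real.one_le_exp (mul_nonneg hB0 ha.1.le))
    have h2 : ramp δ (c * w (M.Ψ (p, a)) - k₀ * Real.exp (B * a)) ≤
        |c| * |w (M.Ψ (p, a)) - w₀ p| := by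
      rcases le_total (c * w (M.Ψ (p, a)) - k₀ * Real.exp (B * a)) 0 with h | h
      · rw [ramp_of_nonpos hδ h]
        positivity
      · rw [← abs_mul]
        refine (ramp_le h).trans (le_trans ?_ (le_abs_self _))
        linarith
    have h3 := mul_le_mul (hC (p, a) ⟨hp, Ioo_subset_Icc_self ha⟩) h2 (ramp_nonneg hδ _) hC0.le
    linarith
  have hbound : ∀ δ, 0 < δ →
      ∫ p, M.J (p, t) * ramp δ (c * w (M.Ψ (p, t)) - k₀ * Real.exp (B * t)) ∂(M.σ 0) ≤
      t * (V * (C * (B * δ))) := by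
    intro δ hδ
    have h1 := (hw.tendsto_integral_abs_sub hT hi.1).const_mul (C * |c|)
    have h2 := h1.const_add (t * (V * (C * (B * δ))))
    rw [mul_zero, add_zero] at h2
    refine ge_of_tendsto h2 ?_
    filter_upwards [Ioo_mem_nhdsGT ht.1] with a ha
    have h3 := hw.integral_ramp_sub_le hT hf hε hB hB0 hC hk hδ c ha.1 ha.2.le ht.2
    have h4 := hstart δ hδ a ⟨ha.1, ha.2.trans ht.2⟩
    have h5 : (t - a) * (V * (C * (B * δ))) ≤ t * (V * (C * (B * δ))) :=
      mul_le_mul_of_nonneg_right (by linarith [ha.1]) (by positivity)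
    linarith
  set g : Amb n → ℝ := fun p => M.J (p, t) * max (c * w (M.Ψ (p, t)) - k₀ * Real.exp (B * t)) 0
  have hJc := continuousOn_J_slice (M := M) hT t
  have hgi : Integrable g (M.σ 0) :=
    integrable_σ_zero hT (hJc.mul (harg.sup continuousOn_const))
  have hg0 : ∀ p, 0 ≤ g p := fun p => mul_nonneg (J_pos _).le (le_max_right _ _)
  have hgδ : ∀ δ, 0 < δ → ∫ p, g p ∂(M.σ 0) ≤ δ * (t * (V * (C * B)) + V * C) := by
    intro δ hδ
    have hr : Integrable (fun p => M.J (p, t) *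
        ramp δ (c * w (M.Ψ (p, t)) - k₀ * Real.exp (B * t))) (M.σ 0) :=
      integrable_σ_zero hT (hJc.mul ((contDiff_ramp δ).continuous.comp_continuousOn harg))
    have h1 : ∫ p, g p ∂(M.σ 0) ≤ ∫ p, (M.J (p, t) *
        ramp δ (c * w (M.Ψ (p, t)) - k₀ * Real.exp (B * t)) + C * δ) ∂(M.σ 0) := by
      refine integral_mono_ae hgi (hr.add (integrable_const _)) ?_
      filter_upwards [ae_σ_zero_mem hT] with p hp
      have h2 : max (c * w (M.Ψ (p, t)) - k₀ * Real.exp (B * t)) 0 ≤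
          ramp δ (c * w (M.Ψ (p, t)) - k₀ * Real.exp (B * t)) + δ :=
        max_le (by linarith [sub_le_ramp hδ (c * w (M.Ψ (p, t)) - k₀ * Real.exp (B * t))])
          (by linarith [ramp_nonneg hδ (c * w (M.Ψ (p, t)) - k₀ * Real.exp (B * t))])
      have h3 := mul_le_mul_of_nonneg_left h2 (J_pos (M := M) (p, t)).le
      have h4 := mul_le_mul_of_nonneg_right (hC (p, t) ⟨hp, Ioo_subset_Icc_self ht⟩) hδ.le
      simp only [g]
      linarith
    rw [integral_add hr (integrable_const _), integral_const, smul_eq_mul] at h1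
    linarith [hbound δ hδ]
  have hg : ∫ p, g p ∂(M.σ 0) = 0 := by
    refine le_antisymm ?_ (integral_nonneg hg0)
    have h1 : Tendsto (fun δ : ℝ => δ * (t * (V * (C * B)) + V * C)) (𝓝[>] 0) (𝓝 0) := by
      have := ((continuous_mul_const (t * (V * (C * B)) + V * C)).tendsto 0).mono_left
        (nhdsWithin_le_nhds (s := Ioi 0))
      rwa [zero_mul] at this
    exact ge_of_tendsto h1 (eventually_mem_nhdsWithin.mono fun δ hδ => hgδ δ hδ)
  filter_upwards [(integral_eq_zero_iff_of_nonneg hg0 hgi).1 hg] with p hp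
  have h1 : max (c * w (M.Ψ (p, t)) - k₀ * Real.exp (B * t)) 0 = 0 :=
    (mul_eq_zero.1 hp).resolve_left (J_pos _).ne'
  linarith [max_eq_right_iff.1 h1]

/-- The maximum principle. -/
theorem exists_bound (M : MovingHypersurface n T) (hT : 0 < T) (hf : M.IsFlux f) (c₀ : ℝ) :
    ∃ R, c₀ ≤ R ∧ ∀ ε w w₀, 0 ≤ ε → M.IsViscousSolution f ε w w₀ →
      AEStronglyMeasurable w₀ (M.σ 0) → (∀ᵐ p ∂(M.σ 0), |w₀ p| ≤ c₀) →
      ∀ t ∈ Ioo 0 T, ∀ᵐ p ∂(M.σ 0), |w (M.Ψ (p, t))| ≤ R := by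
  obtain ⟨B, hB0, hB⟩ := exists_D_bound (M := M) hT
  have hk : 0 ≤ max c₀ 0 := le_max_right _ _
  have he : 1 ≤ Real.exp (B * T) := Real.one_le_exp (mul_nonneg hB0 hT.le)
  refine ⟨max c₀ 0 * Real.exp (B * T), (le_max_left _ _).trans (le_mul_of_one_le_right hk he),
    fun ε w w₀ hε hw hm h0 t ht => ?_⟩
  have hi := integrable_initial hT hm h0
  have h1 := mul_le_barrier (c := 1) hT hf hε hw hB hB0 hi hk (h0.mono fun p hp => by
    linarith [(abs_le.1 hp).2, le_max_left c₀ 0]) ht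
  have h2 := mul_le_barrier (c := -1) hT hf hε hw hB hB0 hi hk (h0.mono fun p hp => by
    linarith [(abs_le.1 hp).1, le_max_left c₀ 0]) ht
  have h3 : max c₀ 0 * Real.exp (B * t) ≤ max c₀ 0 * Real.exp (B * T) :=
    mul_le_mul_of_nonneg_left (Real.exp_le_exp.2 (mul_le_mul_of_nonneg_left ht.2.le hB0)) hk
  filter_upwards [h1, h2] with p hp1 hp2
  rw [abs_le]
  constructor <;> linarith

end IsViscousSolution

end MovingHypersurface

/-! ### Superposition operators and smooth test functions on the reference cylinder -/

namespace MovingHypersurface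
open MovingSurface

variable {n : ℕ} {T : ℝ} {M : MovingHypersurface n T} {f : Amb n × ℝ → ℝ → Amb n}
  {ε : ℝ} {w : Amb n × ℝ → ℝ} {w₀ : Amb n → ℝ}

section Superposition

variable {Y : Type*} [NormedAddCommGroup Y] {A : (Amb n × ℝ) × ℝ → Y} {R : ℝ}

theorem exists_bound_superposition (hT : 0 < T)
    (hA : ContinuousOn A ((M.Γ₀ ×ˢ Icc 0 T) ×ˢ univ)) (R : ℝ) :
    ∃ C, ∀ z ∈ M.Γ₀ ×ˢ Icc 0 T, ∀ s, |s| ≤ R → ‖A (z, s)‖ ≤ C := by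
  obtain ⟨C, hC⟩ := ((isCompact_prod (M := M) hT).prod
    (isCompact_Icc (a := -R) (b := R))).exists_bound_of_continuousOn
    (hA.mono (prod_mono_right (subset_univ _)))
  exact ⟨C, fun z hz s hs => hC (z, s) ⟨hz, abs_le.1 hs⟩⟩

theorem continuousOn_superposition (hA : ContinuousOn A ((M.Γ₀ ×ˢ Icc 0 T) ×ˢ univ))
    {W : Amb n × ℝ → ℝ} (hW : ContinuousOn W (M.Γ₀ ×ˢ Ioo 0 T)) :
    ContinuousOn (fun z => A (z, W z)) (M.Γ₀ ×ˢ Ioo 0 T) :=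
  hA.comp (continuousOn_id.prodMk hW) fun _ hz => ⟨⟨hz.1, Ioo_subset_Icc_self hz.2⟩, mem_univ _⟩

theorem ae_norm_superposition_le (hT : 0 < T) {C : ℝ}
    (hC : ∀ z ∈ M.Γ₀ ×ˢ Icc 0 T, ∀ s, |s| ≤ R → ‖A (z, s)‖ ≤ C) {W : Amb n × ℝ → ℝ}
    (hWR : ∀ᵐ z ∂M.ref, |W z| ≤ R) : ∀ᵐ z ∂M.ref, ‖A (z, W z)‖ ≤ C := by
  filter_upwards [hWR, ae_ref_mem hT] with z h1 h2
  exact hC z ⟨h2.1, Ioo_subset_Icc_self h2.2⟩ _ h1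

variable {W : ℕ → Amb n × ℝ → ℝ} {U : Amb n × ℝ → ℝ}

theorem ae_tendsto_superposition (hT : 0 < T)
    (hA : ContinuousOn A ((M.Γ₀ ×ˢ Icc 0 T) ×ˢ univ))
    (hlim : ∀ᵐ z ∂M.ref, Tendsto (fun k => W k z) atTop (𝓝 (U z))) :
    ∀ᵐ z ∂M.ref, Tendsto (fun k => A (z, W k z)) atTop (𝓝 (A (z, U z))) := by
  filter_upwards [hlim, ae_ref_mem hT] with z h1 h2
  have h3 : z ∈ M.Γ₀ ×ˢ Icc 0 T := ⟨h2.1, Ioo_subset_Icc_self h2.2⟩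
  exact ((hA.comp_continuous (f := fun s => (z, s)) (by fun_prop)
    fun s => ⟨h3, mem_univ _⟩).tendsto (U z)).comp h1

variable [SecondCountableTopology Y]

theorem integrable_superposition (hT : 0 < T) (hA : ContinuousOn A ((M.Γ₀ ×ˢ Icc 0 T) ×ˢ univ))
    {W : Amb n × ℝ → ℝ} (hW : ContinuousOn W (M.Γ₀ ×ˢ Ioo 0 T)) (hWR : ∀ᵐ z ∂M.ref, |W z| ≤ R) :
    Integrable (fun z => A (z, W z)) M.ref := by
  have := isFiniteMeasure_ref (M := M) hT
  obtain ⟨C, hC⟩ := exists_bound_superposition hT hA R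
  exact Integrable.of_bound (aestronglyMeasurable_ref hT (continuousOn_superposition hA hW)) C
    (ae_norm_superposition_le hT hC hWR)

theorem ae_abs_le_of_tendsto (hWR : ∀ k, ∀ᵐ z ∂M.ref, |W k z| ≤ R)
    (hlim : ∀ᵐ z ∂M.ref, Tendsto (fun k => W k z) atTop (𝓝 (U z))) : ∀ᵐ z ∂M.ref, |U z| ≤ R := by
  filter_upwards [ae_all_iff.2 hWR, hlim] with z h1 h2
  exact le_of_tendsto h2.abs (Eventually.of_forall h1)

theorem aestronglyMeasurable_superposition (hT : 0 < T)
    (hA : ContinuousOn A ((M.Γ₀ ×ˢ Icc 0 T) ×ˢ univ))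
    (hW : ∀ k, ContinuousOn (W k) (M.Γ₀ ×ˢ Ioo 0 T))
    (hlim : ∀ᵐ z ∂M.ref, Tendsto (fun k => W k z) atTop (𝓝 (U z))) :
    AEStronglyMeasurable (fun z => A (z, U z)) M.ref :=
  aestronglyMeasurable_of_tendsto_ae atTop
    (fun k => aestronglyMeasurable_ref hT (continuousOn_superposition hA (hW k)))
    (ae_tendsto_superposition hT hA hlim)

/-- The bound `R` confines the arguments almost everywhere to a compact set, on which the continuous
`A` is bounded, so dominated convergence applies. -/
theorem tendsto_integral_superposition [NormedSpace ℝ Y] (hT : 0 < T)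
    (hA : ContinuousOn A ((M.Γ₀ ×ˢ Icc 0 T) ×ˢ univ))
    (hW : ∀ k, ContinuousOn (W k) (M.Γ₀ ×ˢ Ioo 0 T)) (hWR : ∀ k, ∀ᵐ z ∂M.ref, |W k z| ≤ R)
    (hlim : ∀ᵐ z ∂M.ref, Tendsto (fun k => W k z) atTop (𝓝 (U z))) :
    Tendsto (fun k => ∫ z, A (z, W k z) ∂M.ref) atTop (𝓝 (∫ z, A (z, U z) ∂M.ref)) := by
  have := isFiniteMeasure_ref (M := M) hT
  obtain ⟨C, hC⟩ := exists_bound_superposition hT hA R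
  exact tendsto_integral_of_dominated_convergence (fun _ => C)
    (fun k => aestronglyMeasurable_ref hT (continuousOn_superposition hA (hW k)))
    (integrable_const _) (fun k => ae_norm_superposition_le hT hC (hWR k))
    (ae_tendsto_superposition hT hA hlim)

end Superposition

/-- The exceptional null set may depend on time. Tonelli's theorem for the positive part of `|W| -
R` turns the bounds at each time into one almost everywhere on the cylinder. -/
theorem ae_ref_abs_le (hT : 0 < T) {W : Amb n × ℝ → ℝ} (hW : ContinuousOn W (M.Γ₀ ×ˢ Ioo 0 T))
    {R : ℝ} (hR : ∀ t ∈ Ioo 0 T, ∀ᵐ p ∂(M.σ 0), |W (p, t)| ≤ R) : ∀ᵐ z ∂M.ref, |W z| ≤ R := by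
  have := isFiniteMeasure_σ_zero (M := M) hT
  have hm : AEMeasurable (fun z => ENNReal.ofReal (|W z| - R)) M.ref :=
    (aemeasurable_ref hT ((continuous_abs.comp_continuousOn hW).sub continuousOn_const)).ennreal_ofReal
  have h1 : ∫⁻ z, ENNReal.ofReal (|W z| - R) ∂M.ref = 0 := by
    rw [ref, lintegral_prod_symm _ hm, ← lintegral_zero (μ := volume.restrict (Ioo 0 T))]
    refine lintegral_congr_ae ((ae_restrict_mem measurableSet_Ioo).mono fun t ht => ?_)
    refine (lintegral_congr_ae ?_).trans lintegral_zero
    filter_upwards [hR t ht] with p hp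
    exact ENNReal.ofReal_eq_zero.2 (by linarith)
  filter_upwards [(lintegral_eq_zero_iff' hm).1 h1] with z hz
  linarith [ENNReal.ofReal_eq_zero.1 hz]

section Test

variable {ψ : Amb n × ℝ → ℝ}

/-- The material derivative of a smooth ambient function, along the trajectory of `z`. -/
def trajDeriv (M : MovingHypersurface n T) (ψ : Amb n × ℝ → ℝ) (z : Amb n × ℝ) : ℝ :=
  fderiv ℝ ψ (M.Ψ z) (M.v (M.Ψ z), 1)

theorem contDiffOn_test (hψ : ContDiff ℝ ∞ ψ) :
    ContDiffOn ℝ ∞ (fun z => ψ (M.Ψ z)) (M.Γ₀ ×ˢ Icc 0 T) :=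
  hψ.comp_contDiffOn smoothOnSet_Ψ.contDiffOn

theorem continuousOn_trajDeriv (hT : 0 < T) (hψ : ContDiff ℝ ∞ ψ) :
    ContinuousOn (M.trajDeriv ψ) (M.Γ₀ ×ˢ Icc 0 T) :=
  ((hψ.continuous_fderiv (by simp)).comp_continuousOn continuousOn_Ψ).clm_apply
    ((contDiffOn_v hT).continuousOn.prodMk continuousOn_const)

theorem hasDerivAt_trajDeriv (hψ : ContDiff ℝ ∞ ψ) {p : Amb n} (hp : p ∈ M.Γ₀) {t : ℝ}
    (ht : t ∈ Ioo 0 T) : HasDerivAt (fun s => ψ (M.Ψ (p, s))) (M.trajDeriv ψ (p, t)) t :=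
  ((hψ.differentiable (by simp) _).hasFDerivAt).comp_hasDerivAt t
    ((hasDerivAt_Φ hp ht).prodMk (hasDerivAt_id t))

theorem trajDeriv_eq (hψ : ContDiff ℝ ∞ ψ) {z : Amb n × ℝ} (hz : z ∈ M.Γ₀ ×ˢ Ioo 0 T) :
    M.trajDeriv ψ z = M.materialDeriv ψ (M.Ψ z) :=
  (hasDerivAt_trajDeriv hψ hz.1 hz.2).unique (hasDerivAt_comp_Ψ (p := z.1) (t := z.2) hz.1 hz.2
    (hψ.differentiable (by simp) _).differentiableWithinAt)

theorem continuousOn_grad_test (hT : 0 < T) (hψ : ContDiff ℝ ∞ ψ) :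
    ContinuousOn (fun z => M.grad ψ (M.Ψ z)) (M.Γ₀ ×ˢ Icc 0 T) :=
  (contDiffOn_grad (m := ∞) hT (uniqueDiffOn_Icc hT) Subset.rfl (by simp) le_rfl
    (contDiffOn_test hψ)).continuousOn

theorem continuousOn_lap_test (hT : 0 < T) (hψ : ContDiff ℝ ∞ ψ) :
    ContinuousOn (fun z => M.lap ψ (M.Ψ z)) (M.Γ₀ ×ˢ Icc 0 T) :=
  (contDiffOn_lap hT (uniqueDiffOn_Icc hT) Subset.rfl (contDiffOn_test hψ)).continuousOn

theorem integral_σ_test (hT : 0 < T) {t : ℝ} (ht : t ∈ Icc 0 T) (hψ : ContDiff ℝ ∞ ψ) :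
    ∫ x, ψ (x, t) ∂(M.σ t) = ∫ p, M.J (p, t) * ψ (M.Ψ (p, t)) ∂(M.σ 0) :=
  integral_σ (g := fun x => ψ (x, t)) hT ht
    (hψ.continuous.comp (by fun_prop : Continuous fun x : Amb n => (x, t))).continuousOn

end Test

/-! ### The space-time entropy inequality for viscous solutions -/

/-- The pulled back integrand of the entropy inequality. -/
def entropyDensity (M : MovingHypersurface n T) (f : Amb n × ℝ → ℝ → Amb n) (η : ℝ → ℝ) (s₀ : ℝ)
    (ψ : Amb n × ℝ → ℝ) (y : (Amb n × ℝ) × ℝ) : ℝ :=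
  M.J y.1 * (η y.2 * M.trajDeriv ψ y.1 +
    inner ℝ (entropyFlux η f s₀ (M.Ψ y.1) y.2) (M.grad ψ (M.Ψ y.1)) -
    M.D y.1 * (y.2 * deriv η y.2 - η y.2) * ψ (M.Ψ y.1))

/-- The pulled back diffusion term. -/
def diffusionDensity (M : MovingHypersurface n T) (η : ℝ → ℝ)
    (ψ : Amb n × ℝ → ℝ) (y : (Amb n × ℝ) × ℝ) : ℝ :=
  M.J y.1 * (η y.2 * M.lap ψ (M.Ψ y.1))

variable {η : ℝ → ℝ} {s₀ : ℝ} {ψ : Amb n × ℝ → ℝ}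

theorem continuousOn_fst_left {Y : Type*} [TopologicalSpace Y] {g : Amb n × ℝ → Y}
    {s : Set (Amb n × ℝ)} (hg : ContinuousOn g s) :
    ContinuousOn (fun y : (Amb n × ℝ) × ℝ => g y.1) (s ×ˢ univ) :=
  hg.comp continuousOn_fst fun _ hy => hy.1

theorem continuousOn_entropyFlux_comp (hf : M.IsFlux f) (hη : ContDiff ℝ 2 η) (s₀ : ℝ) :
    ContinuousOn (fun y : (Amb n × ℝ) × ℝ => entropyFlux η f s₀ (M.Ψ y.1) y.2)
      ((M.Γ₀ ×ˢ Icc 0 T) ×ˢ univ) :=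
  (hf.continuousOn_entropyFlux hη s₀).comp
    (f := fun y : (Amb n × ℝ) × ℝ => (M.Ψ y.1, y.2))
    ((continuousOn_fst_left continuousOn_Ψ).prodMk continuousOn_snd)
    fun _ hy => ⟨mapsTo_Ψ_Gbar hy.1, mem_univ _⟩

theorem continuousOn_J_Icc (hT : 0 < T) : ContinuousOn M.J (M.Γ₀ ×ˢ Icc 0 T) :=
  (continuousOn_J hT).mono (prod_mono_right (subset_univ _))

theorem continuousOn_D_Icc (hT : 0 < T) : ContinuousOn M.D (M.Γ₀ ×ˢ Icc 0 T) :=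
  (continuousOn_D hT).mono (prod_mono_right (subset_univ _))

theorem continuousOn_entropyDensity (hT : 0 < T) (hf : M.IsFlux f) (hη : ContDiff ℝ 2 η) (s₀ : ℝ)
    (hψ : ContDiff ℝ ∞ ψ) :
    ContinuousOn (M.entropyDensity f η s₀ ψ) ((M.Γ₀ ×ˢ Icc 0 T) ×ˢ univ) := by
  have h1 : Continuous fun y : (Amb n × ℝ) × ℝ => η y.2 := hη.continuous.comp continuous_snd
  have h2 : Continuous fun y : (Amb n × ℝ) × ℝ => deriv η y.2 :=
    (contDiff_deriv_of_two hη).continuous.comp continuous_snd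
  exact (continuousOn_fst_left (continuousOn_J_Icc hT)).mul
    (((h1.continuousOn.mul (continuousOn_fst_left (continuousOn_trajDeriv hT hψ))).add
      ((continuousOn_entropyFlux_comp hf hη s₀).inner
        (continuousOn_fst_left (continuousOn_grad_test hT hψ)))).sub
      (((continuousOn_fst_left (continuousOn_D_Icc hT)).mul
        ((continuous_snd.mul h2).sub h1).continuousOn).mul
        (continuousOn_fst_left (contDiffOn_test hψ).continuousOn)))

theorem continuousOn_diffusionDensity (hT : 0 < T) (hη : ContDiff ℝ 2 η) (hψ : ContDiff ℝ ∞ ψ) :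
    ContinuousOn (M.diffusionDensity η ψ) ((M.Γ₀ ×ˢ Icc 0 T) ×ˢ univ) :=
  (continuousOn_fst_left (continuousOn_J_Icc hT)).mul
    ((hη.continuous.comp continuous_snd).continuousOn.mul
      (continuousOn_fst_left (continuousOn_lap_test hT hψ)))

namespace IsViscousSolution

/-- The entropy inequality between two times. -/
theorem integral_entropy_sub_le (hT : 0 < T) (hf : M.IsFlux f) (hε : 0 ≤ ε)
    (hw : M.IsViscousSolution f ε w w₀) (hη : ContDiff ℝ 2 η)
    (hconv : ∀ s, 0 ≤ deriv (deriv η) s) (s₀ : ℝ) (hψ : ContDiff ℝ ∞ ψ) (hψ0 : ∀ q, 0 ≤ ψ q)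
    {a b : ℝ} (ha : 0 < a) (hab : a ≤ b) (hb : b < T) :
    (∫ p, M.J (p, b) * (η (w (M.Ψ (p, b))) * ψ (M.Ψ (p, b))) ∂(M.σ 0)) -
      ∫ p, M.J (p, a) * (η (w (M.Ψ (p, a))) * ψ (M.Ψ (p, a))) ∂(M.σ 0) ≤
      ∫ t in a..b, ∫ p, (M.entropyDensity f η s₀ ψ ((p, t), w (M.Ψ (p, t))) +
        ε * M.diffusionDensity η ψ ((p, t), w (M.Ψ (p, t)))) ∂(M.σ 0) := by
  have := isFiniteMeasure_σ_zero (M := M) hT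
  have hI : Icc a b ⊆ Ioo 0 T := fun t ht => ⟨ha.trans_le ht.1, ht.2.trans_lt hb⟩
  have hI' : Icc a b ⊆ Icc 0 T := hI.trans Ioo_subset_Icc_self
  have hη' := contDiff_deriv_of_two hη
  have hηd : ∀ s, HasDerivAt η (deriv η s) s := fun s =>
    (hη.differentiable two_ne_zero s).hasDerivAt
  set W : Amb n × ℝ → ℝ := fun z => w (M.Ψ z)
  set W' : Amb n × ℝ → ℝ := fun z => M.materialDeriv w (M.Ψ z)
  have hW : ContinuousOn W (M.Γ₀ ×ˢ Icc a b) := hw.continuousOn_comp.mono (prod_mono_right hI)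
  have hW' : ContinuousOn W' (M.Γ₀ ×ˢ Icc a b) :=
    hw.continuousOn_materialDeriv.mono (prod_mono_right hI)
  have hJ : ContinuousOn M.J (M.Γ₀ ×ˢ Icc a b) :=
    (continuousOn_J hT).mono (prod_mono_right (subset_univ _))
  have hD : ContinuousOn M.D (M.Γ₀ ×ˢ Icc a b) :=
    (continuousOn_D hT).mono (prod_mono_right (subset_univ _))
  have hψc : ContinuousOn (fun z => ψ (M.Ψ z)) (M.Γ₀ ×ˢ Icc a b) :=
    (contDiffOn_test hψ).continuousOn.mono (prod_mono_right hI')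
  have hψ' : ContinuousOn (M.trajDeriv ψ) (M.Γ₀ ×ˢ Icc a b) :=
    (continuousOn_trajDeriv hT hψ).mono (prod_mono_right hI')
  have hηW : ContinuousOn (fun z => η (W z)) (M.Γ₀ ×ˢ Icc a b) := hη.continuous.comp_continuousOn hW
  have hη'W : ContinuousOn (fun z => deriv η (W z)) (M.Γ₀ ×ˢ Icc a b) :=
    hη'.continuous.comp_continuousOn hW
  have hmap : MapsTo (fun z : Amb n × ℝ => (z, W z)) (M.Γ₀ ×ˢ Icc a b)
      ((M.Γ₀ ×ˢ Icc 0 T) ×ˢ univ) := fun z hz => ⟨⟨hz.1, hI' hz.2⟩, mem_univ _⟩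
  have hE : ContinuousOn (fun z => M.entropyDensity f η s₀ ψ (z, W z)) (M.Γ₀ ×ˢ Icc a b) :=
    (continuousOn_entropyDensity hT hf hη s₀ hψ).comp (continuousOn_id.prodMk hW) hmap
  have hL : ContinuousOn (fun z => ε * M.diffusionDensity η ψ (z, W z)) (M.Γ₀ ×ˢ Icc a b) :=
    continuousOn_const.mul
      ((continuousOn_diffusionDensity hT hη hψ).comp (continuousOn_id.prodMk hW) hmap)
  set F : Amb n × ℝ → ℝ := fun z => η (W z) * ψ (M.Ψ z)
  set F' : Amb n × ℝ → ℝ := fun z => deriv η (W z) * W' z * ψ (M.Ψ z) + η (W z) * M.trajDeriv ψ z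
  have hF : ContinuousOn F (M.Γ₀ ×ˢ Icc a b) := hηW.mul hψc
  have hF' : ContinuousOn F' (M.Γ₀ ×ˢ Icc a b) := ((hη'W.mul hW').mul hψc).add (hηW.mul hψ')
  have hFd : ∀ p ∈ M.Γ₀, ∀ t ∈ Ioo a b, HasDerivAt (fun s => F (p, s)) (F' (p, t)) t := by
    intro p hp t ht
    have ht' := hI (Ioo_subset_Icc_self ht)
    exact ((hηd (W (p, t))).comp t (hw.hasDerivAt_comp hp ht')).mul (hasDerivAt_trajDeriv hψ hp ht')
  have hc : ContinuousOn (fun z => M.J z * (F' z + F z * M.D z)) (M.Γ₀ ×ˢ Icc a b) :=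
    hJ.mul (hF'.add (hF.mul hD))
  have hcE : ContinuousOn (fun z => M.entropyDensity f η s₀ ψ (z, W z) +
      ε * M.diffusionDensity η ψ (z, W z)) (M.Γ₀ ×ˢ Icc a b) := hE.add hL
  rw [integral_mul_J_sub hT (F := F) hab hF hF' hFd]
  refine intervalIntegral.integral_mono_on hab
    (intervalIntegrable_integral (isCompact_Γ₀ hT) (ae_σ_zero_mem hT) hab hc)
    (intervalIntegrable_integral (isCompact_Γ₀ hT) (ae_σ_zero_mem hT) hab hcE) fun t ht => ?_
  have key := hw.integral_entropy_le hT hf hε hη hconv s₀ (hI ht) hψ hψ0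
  have c1 : ContinuousOn (fun z => M.J z * (deriv η (W z) * (W' z + W z * M.D z) * ψ (M.Ψ z)))
      (M.Γ₀ ×ˢ Icc a b) := hJ.mul ((hη'W.mul (hW'.add (hW.mul hD))).mul hψc)
  have c2 : ContinuousOn (fun z => M.J z * (η (W z) * M.trajDeriv ψ z -
      M.D z * (W z * deriv η (W z) - η (W z)) * ψ (M.Ψ z))) (M.Γ₀ ×ˢ Icc a b) :=
    hJ.mul ((hηW.mul hψ').sub ((hD.mul ((hW.mul hη'W).sub hηW)).mul hψc))
  have c3 : ContinuousOn (fun z => M.entropyDensity f η s₀ ψ (z, W z) +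
      ε * M.diffusionDensity η ψ (z, W z) - M.J z * (η (W z) * M.trajDeriv ψ z -
      M.D z * (W z * deriv η (W z) - η (W z)) * ψ (M.Ψ z))) (M.Γ₀ ×ˢ Icc a b) := hcE.sub c2
  have i1 := integrable_σ_zero hT (continuousOn_slice c1 ht)
  have i2 := integrable_σ_zero hT (continuousOn_slice c2 ht)
  have i3 := integrable_σ_zero hT (continuousOn_slice c3 ht)
  -- The time derivative of `J η(W) ψ` splits into the expression controlled by the fixed-time
  -- inequality and a remainder which also occurs in the entropy density; `e2` isolates the same
  -- remainder on the other side.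
  have e1 : ∫ p, M.J (p, t) * (F' (p, t) + F (p, t) * M.D (p, t)) ∂(M.σ 0) =
      (∫ p, M.J (p, t) * (deriv η (W (p, t)) * (W' (p, t) + W (p, t) * M.D (p, t)) *
        ψ (M.Ψ (p, t))) ∂(M.σ 0)) + ∫ p, M.J (p, t) * (η (W (p, t)) * M.trajDeriv ψ (p, t) -
      M.D (p, t) * (W (p, t) * deriv η (W (p, t)) - η (W (p, t))) * ψ (M.Ψ (p, t))) ∂(M.σ 0) := by
    rw [← integral_add i1 i2]
    refine integral_congr_ae (Eventually.of_forall fun p => ?_)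
    simp only [F, F']
    ring
  have e2 : ∫ p, (M.entropyDensity f η s₀ ψ ((p, t), W (p, t)) +
      ε * M.diffusionDensity η ψ ((p, t), W (p, t))) ∂(M.σ 0) =
      (∫ p, (M.entropyDensity f η s₀ ψ ((p, t), W (p, t)) +
      ε * M.diffusionDensity η ψ ((p, t), W (p, t)) -
      M.J (p, t) * (η (W (p, t)) * M.trajDeriv ψ (p, t) -
      M.D (p, t) * (W (p, t) * deriv η (W (p, t)) - η (W (p, t))) * ψ (M.Ψ (p, t)))) ∂(M.σ 0)) +
      ∫ p, M.J (p, t) * (η (W (p, t)) * M.trajDeriv ψ (p, t) -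
      M.D (p, t) * (W (p, t) * deriv η (W (p, t)) - η (W (p, t))) * ψ (M.Ψ (p, t))) ∂(M.σ 0) := by
    rw [← integral_add i3 i2]
    refine integral_congr_ae (Eventually.of_forall fun p => ?_)
    ring
  rw [e1, e2]
  refine add_le_add_left (key.trans_eq (integral_congr_ae (Eventually.of_forall fun p => ?_))) _
  simp only [entropyDensity, diffusionDensity, W]
  ring

/-- `L¹` convergence to the initial values implies convergence in measure, hence almost everywhere
along a sequence of times. -/
theorem exists_seq_tendsto_initial (hw : M.IsViscousSolution f ε w w₀) (hT : 0 < T)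
    (hm : AEStronglyMeasurable w₀ (M.σ 0)) : ∃ a : ℕ → ℝ, (∀ k, a k ∈ Ioo 0 T) ∧
      Tendsto a atTop (𝓝 0) ∧
      ∀ᵐ p ∂(M.σ 0), Tendsto (fun k => w (M.Ψ (p, a k))) atTop (𝓝 (w₀ p)) := by
  obtain ⟨a, -, ha, ha0⟩ := exists_seq_strictAnti_tendsto' hT
  have h1 : Tendsto a atTop (𝓝[>] 0) :=
    tendsto_nhdsWithin_iff.2 ⟨ha0, Eventually.of_forall fun k => (ha k).1⟩
  have h2 := hw.initial.comp h1
  have h3 : TendstoInMeasure (M.σ 0) (fun k p => w (M.Ψ (p, a k))) atTop w₀ :=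
    tendstoInMeasure_of_tendsto_eLpNorm one_ne_zero (fun k => aestronglyMeasurable_σ_zero hT
      (continuousOn_slice hw.continuousOn_comp (ha k))) hm h2
  obtain ⟨ns, hns, h4⟩ := h3.exists_seq_tendsto_ae
  exact ⟨fun k => a (ns k), fun k => ha _, ha0.comp hns.tendsto_atTop, h4⟩

/-- The entropy inequality on the whole space-time surface. -/
theorem entropy_inequality (hT : 0 < T) (hf : M.IsFlux f) (hε : 0 ≤ ε)
    (hw : M.IsViscousSolution f ε w w₀) (hm : AEStronglyMeasurable w₀ (M.σ 0)) {R C : ℝ}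
    (hR : ∀ t ∈ Ioo 0 T, ∀ᵐ p ∂(M.σ 0), |w (M.Ψ (p, t))| ≤ R) (hη : ContDiff ℝ 2 η)
    (hconv : ∀ s, 0 ≤ deriv (deriv η) s) (hC : ∀ s, |s| ≤ R → |η s| ≤ C) (s₀ : ℝ)
    (hψ : ContDiff ℝ ∞ ψ) (hψ0 : ∀ q, 0 ≤ ψ q) :
    -(∫ p, η (w₀ p) * ψ (p, 0) ∂(M.σ 0)) -
      (∫ z, M.entropyDensity f η s₀ ψ (z, w (M.Ψ z)) ∂M.ref) -
      ε * ∫ z, M.diffusionDensity η ψ (z, w (M.Ψ z)) ∂M.ref ≤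
      C * ∫ x, ψ (x, T) ∂(M.σ T) := by
  have := isFiniteMeasure_σ_zero (M := M) hT
  have hTT : T ∈ Icc 0 T := right_mem_Icc.2 hT.le
  obtain ⟨CJ, hCJ0, hCJ⟩ := exists_J_bounds (M := M) hT
  obtain ⟨Cψ, hCψ⟩ := (isCompact_prod (M := M) hT).exists_bound_of_continuousOn
    (contDiffOn_test hψ).continuousOn
  have hJψ : ContinuousOn (fun z => M.J z * ψ (M.Ψ z)) (M.Γ₀ ×ˢ Icc 0 T) :=
    (continuousOn_J_Icc hT).mul (contDiffOn_test hψ).continuousOn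
  have hline : ∀ p ∈ M.Γ₀, ContinuousOn (fun t => M.J (p, t) * ψ (M.Ψ (p, t))) (Icc 0 T) :=
    fun p hp => hJψ.comp (f := fun t => (p, t)) (by fun_prop) fun t ht => ⟨hp, ht⟩
  have hJψb : ∀ z ∈ M.Γ₀ ×ˢ Icc 0 T, |M.J z * ψ (M.Ψ z)| ≤ CJ * Cψ := fun z hz => by
    rw [abs_mul, abs_of_pos (J_pos z)]
    exact mul_le_mul (hCJ z hz) (hCψ z hz) (abs_nonneg _) hCJ0.le
  -- The solution lives only at interior times: the inequality is used between `a k ↓ 0`, along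
  -- which the initial values are attained almost everywhere, and `b k ↑ T`.
  obtain ⟨a, ha, ha0, hainit⟩ := hw.exists_seq_tendsto_initial hT hm
  obtain ⟨b, -, hb, hbT⟩ := exists_seq_strictMono_tendsto' hT
  have hab : ∀ᶠ k in atTop, a k ≤ b k := by
    filter_upwards [ha0.eventually (gt_mem_nhds (half_pos hT)),
      hbT.eventually (lt_mem_nhds (half_lt_self hT))] with k h1 h2 using (h1.trans h2).le
  have hWb : ∀ t ∈ Ioo 0 T, ∀ᵐ p ∂(M.σ 0), |η (w (M.Ψ (p, t)))| ≤ C := fun t ht =>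
    (hR t ht).mono fun p hp => hC _ hp
  have hηW : ContinuousOn (fun z => η (w (M.Ψ z))) (M.Γ₀ ×ˢ Ioo 0 T) :=
    hη.continuous.comp_continuousOn hw.continuousOn_comp
  have hJψo := hJψ.mono (prod_mono_right (s := M.Γ₀) (Ioo_subset_Icc_self (a := 0) (b := T)))
  have hFi : ContinuousOn (fun z => M.J z * (η (w (M.Ψ z)) * ψ (M.Ψ z))) (M.Γ₀ ×ˢ Ioo 0 T) :=
    (hηW.mul hJψo).congr fun z _ => mul_left_comm _ _ _
  -- the initial term
  have lim0 : Tendsto (fun k => ∫ p, M.J (p, a k) * (η (w (M.Ψ (p, a k))) * ψ (M.Ψ (p, a k))) ∂(M.σ 0))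
      atTop (𝓝 (∫ p, η (w₀ p) * ψ (p, 0) ∂(M.σ 0))) := by
    refine tendsto_integral_of_dominated_convergence (fun _ => C * (CJ * Cψ)) (fun k =>
      aestronglyMeasurable_σ_zero hT (continuousOn_slice hFi (ha k))) (integrable_const _)
      (fun k => ?_) ?_
    · filter_upwards [hWb _ (ha k), ae_σ_zero_mem hT] with p h1 hp
      have h2 := hJψb (p, a k) ⟨hp, Ioo_subset_Icc_self (ha k)⟩
      rw [Real.norm_eq_abs, mul_left_comm, abs_mul]
      exact mul_le_mul h1 h2 (abs_nonneg _) ((abs_nonneg _).trans h1)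
    · filter_upwards [hainit, ae_σ_zero_mem hT] with p h1 hp
      have h2 := (hline p hp 0 (left_mem_Icc.2 hT.le)).tendsto.comp (tendsto_nhdsWithin_iff.2
        ⟨ha0, Eventually.of_forall fun k => Ioo_subset_Icc_self (ha k)⟩)
      have h3 := ((hη.continuous.tendsto _).comp h1).mul h2
      have h4 : M.J (p, 0) * ψ (M.Ψ (p, 0)) = ψ (p, 0) := by
        rw [J_zero, one_mul, Ψ, M.initial p hp]
      rw [h4] at h3
      refine h3.congr fun k => ?_
      simp only [Function.comp_apply]
      ring
  -- the final term
  have limT : Tendsto (fun k => ∫ p, M.J (p, b k) * ψ (M.Ψ (p, b k)) ∂(M.σ 0))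
      atTop (𝓝 (∫ x, ψ (x, T) ∂(M.σ T))) := by
    rw [integral_σ_test hT hTT hψ]
    refine tendsto_integral_of_dominated_convergence (fun _ => CJ * Cψ) (fun k =>
      aestronglyMeasurable_σ_zero hT (continuousOn_slice hJψo (hb k))) (integrable_const _)
      (fun k => ?_) ?_
    · filter_upwards [ae_σ_zero_mem hT] with p hp
      exact hJψb (p, b k) ⟨hp, Ioo_subset_Icc_self (hb k)⟩
    · filter_upwards [ae_σ_zero_mem hT] with p hp
      exact (hline p hp T hTT).tendsto.comp (tendsto_nhdsWithin_iff.2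
        ⟨hbT, Eventually.of_forall fun k => Ioo_subset_Icc_self (hb k)⟩)
  -- No trace of `w` at time `T` is available. The bound `|η(w)| ≤ C` alone gives the error term on
  -- the right.
  have hfin : ∀ k, -(C * ∫ p, M.J (p, b k) * ψ (M.Ψ (p, b k)) ∂(M.σ 0)) ≤
      ∫ p, M.J (p, b k) * (η (w (M.Ψ (p, b k))) * ψ (M.Ψ (p, b k))) ∂(M.σ 0) := by
    intro k
    rw [← integral_const_mul, ← integral_neg]
    refine integral_mono_ae ((integrable_σ_zero hT (continuousOn_slice hJψo (hb k))).const_mul C).neg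
      (integrable_σ_zero hT (continuousOn_slice hFi (hb k))) ?_
    filter_upwards [hWb _ (hb k)] with p h1
    have h2 : 0 ≤ M.J (p, b k) * ψ (M.Ψ (p, b k)) := mul_nonneg (J_pos _).le (hψ0 _)
    have h3 := mul_le_mul_of_nonneg_right (abs_le.1 h1).1 h2
    linarith
  -- the space-time term
  have hWref := ae_ref_abs_le hT hw.continuousOn_comp hR
  have iE := integrable_superposition hT (continuousOn_entropyDensity hT hf hη s₀ hψ)
    hw.continuousOn_comp hWref
  have iL := (integrable_superposition hT (continuousOn_diffusionDensity hT hη hψ)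
    hw.continuousOn_comp hWref).const_mul ε
  set g : ℝ → ℝ := fun t => ∫ p, (M.entropyDensity f η s₀ ψ ((p, t), w (M.Ψ (p, t))) +
        ε * M.diffusionDensity η ψ ((p, t), w (M.Ψ (p, t)))) ∂(M.σ 0)
  have ig : IntervalIntegrable g volume 0 T := by
    rw [intervalIntegrable_iff_integrableOn_Ioo_of_le hT.le]
    exact (iE.add iL).integral_prod_right
  have hg : ∫ t in (0 : ℝ)..T, g t = (∫ z, M.entropyDensity f η s₀ ψ (z, w (M.Ψ z)) ∂M.ref) +
      ε * ∫ z, M.diffusionDensity η ψ (z, w (M.Ψ z)) ∂M.ref := by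
    rw [intervalIntegral.integral_of_le hT.le, integral_Ioc_eq_integral_Ioo, ← integral_const_mul,
      ← integral_add iE iL]
    exact (integral_prod_symm _ (iE.add iL)).symm
  have hprim := intervalIntegral.continuousOn_primitive_interval' ig left_mem_uIcc
  rw [uIcc_of_le hT.le] at hprim
  have limb := (hprim T hTT).tendsto.comp (tendsto_nhdsWithin_iff.2
        ⟨hbT, Eventually.of_forall fun k => Ioo_subset_Icc_self (hb k)⟩)
  have lima := (hprim 0 (left_mem_Icc.2 hT.le)).tendsto.comp (tendsto_nhdsWithin_iff.2
        ⟨ha0, Eventually.of_forall fun k => Ioo_subset_Icc_self (ha k)⟩)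
  rw [intervalIntegral.integral_same] at lima
  have lim := le_of_tendsto_of_tendsto ((limT.const_mul C).neg.sub lim0) (limb.sub lima) (by
    filter_upwards [hab] with k hk
    have h1 := hw.integral_entropy_sub_le hT hf hε hη hconv s₀ hψ hψ0 (ha k).1 hk (hb k).2
    have h2 : ∀ c ∈ Ioo 0 T, IntervalIntegrable g volume 0 c := fun c hc =>
      ig.mono_set (uIcc_subset_uIcc_left (by
        rw [uIcc_of_le hT.le]
        exact Ioo_subset_Icc_self hc))
    have h3 := intervalIntegral.integral_interval_sub_left (h2 _ (hb k)) (h2 _ (ha k))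
    simp only [Function.comp_apply]
    rw [h3]
    linarith [hfin k])
  rw [hg] at lim
  linarith

end IsViscousSolution

end MovingHypersurface

/-! ### Integrability of smooth test functions and conservation of mass -/

namespace MovingHypersurface
open MovingSurface

variable {n : ℕ} {T : ℝ} {M : MovingHypersurface n T} {f : Amb n × ℝ → ℝ → Amb n}

theorem ae_μ_of_ref (hT : 0 < T) {P : Amb n × ℝ → Prop} (h : ∀ᵐ z ∂M.ref, P (M.Ψ z)) :
    ∀ᵐ q ∂M.μ, P q := by
  have h1 : ∀ᵐ z ∂(M.μ.map M.Θ), P (M.Ψ z) := by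
    rw [map_Θ_μ hT]
    exact ae_lam_of_ref h
  filter_upwards [ae_of_ae_map (aemeasurable_Θ hT) h1, ae_μ_mem hT] with q h2 h3
  rwa [Ψ_Θ h3] at h2

section SmoothFunctions

variable {Y : Type*} [NormedAddCommGroup Y] [SecondCountableTopology Y]

theorem integrable_μ_of_continuousOn (hT : 0 < T) {g G : Amb n × ℝ → Y}
    (hG : ContinuousOn G (M.Γ₀ ×ˢ Icc 0 T)) (he : ∀ z ∈ M.Γ₀ ×ˢ Ioo 0 T, G z = g (M.Ψ z)) :
    Integrable g M.μ := by
  have := isFiniteMeasure_μ (M := M) hT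
  obtain ⟨C, hC⟩ := (isCompact_prod (M := M) hT).exists_bound_of_continuousOn hG
  refine Integrable.of_bound (aestronglyMeasurable_μ hT ?_) C (ae_μ_of_ref hT ?_)
  · refine (aestronglyMeasurable_ref hT (hG.mono (prod_mono_right Ioo_subset_Icc_self))).congr ?_
    exact (ae_ref_mem hT).mono he
  · filter_upwards [ae_ref_mem hT] with z hz
    rw [← he z hz]
    exact hC z ⟨hz.1, Ioo_subset_Icc_self hz.2⟩

variable {ψ : Amb n × ℝ → ℝ}

theorem integrable_test (hT : 0 < T) (hψ : ContDiff ℝ ∞ ψ) : Integrable ψ M.μ :=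
  integrable_μ_of_continuousOn hT (contDiffOn_test hψ).continuousOn fun _ _ => rfl

theorem integrable_materialDeriv_test (hT : 0 < T) (hψ : ContDiff ℝ ∞ ψ) :
    Integrable (M.materialDeriv ψ) M.μ :=
  integrable_μ_of_continuousOn hT (continuousOn_trajDeriv hT hψ) fun _ hz => trajDeriv_eq hψ hz

theorem integrable_grad_test (hT : 0 < T) (hψ : ContDiff ℝ ∞ ψ) : Integrable (M.grad ψ) M.μ :=
  integrable_μ_of_continuousOn hT (continuousOn_grad_test hT hψ) fun _ _ => rfl

theorem integrable_test_slice (hψ : ContDiff ℝ ∞ ψ) {t : ℝ} (ht : t ∈ Icc 0 T) :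
    Integrable (fun x => ψ (x, t)) (M.σ t) :=
  (isParamSurface_Γ ht).integrable_of_continuousOn
    (hψ.continuous.comp (by fun_prop : Continuous fun x : Amb n => (x, t))).continuousOn

theorem integrable_div_v (hT : 0 < T) : Integrable (M.div M.v) M.μ :=
  integrable_μ_of_continuousOn hT (contDiffOn_div_v hT).continuousOn fun _ _ => rfl

theorem exists_div_v_bound (hT : 0 < T) : ∃ B, ∀ᵐ q ∂M.μ, |M.div M.v q| ≤ B := by
  obtain ⟨B, -, hB⟩ := exists_D_bound (M := M) hT
  refine ⟨B, ae_μ_of_ref hT ?_⟩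
  filter_upwards [ae_ref_mem hT] with z hz
  have hz' : z ∈ M.Γ₀ ×ˢ Icc 0 T := ⟨hz.1, Ioo_subset_Icc_self hz.2⟩
  rw [← D_eq hz'.2]
  exact hB z hz'

/-- Conservation of mass for smooth functions. -/
theorem integral_transport_test (hT : 0 < T) (hψ : ContDiff ℝ ∞ ψ) :
    (∫ x, ψ (x, 0) ∂(M.σ 0)) + ∫ q, (M.materialDeriv ψ q + M.div M.v q * ψ q) ∂M.μ =
      ∫ x, ψ (x, T) ∂(M.σ T) := by
  have := isFiniteMeasure_σ_zero (M := M) hT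
  have h0 : (0 : ℝ) ∈ Icc 0 T := left_mem_Icc.2 hT.le
  have hψc := (contDiffOn_test (M := M) hψ).continuousOn
  have hψ' := continuousOn_trajDeriv (M := M) hT hψ
  have hG : ContinuousOn (fun z => M.trajDeriv ψ z + ψ (M.Ψ z) * M.D z) (M.Γ₀ ×ˢ Icc 0 T) :=
    hψ'.add (hψc.mul (continuousOn_D_Icc hT))
  have hJG : ContinuousOn (fun z => M.J z * (M.trajDeriv ψ z + ψ (M.Ψ z) * M.D z))
      (M.Γ₀ ×ˢ Icc 0 T) := (continuousOn_J_Icc hT).mul hG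
  have he : ∀ z ∈ M.Γ₀ ×ˢ Ioo 0 T, M.trajDeriv ψ z + ψ (M.Ψ z) * M.D z =
      M.materialDeriv ψ (M.Ψ z) + M.div M.v (M.Ψ z) * ψ (M.Ψ z) := fun z hz => by
    rw [trajDeriv_eq hψ hz, D_eq (Ioo_subset_Icc_self hz.2), mul_comm]
  have hi := integrable_μ_of_continuousOn
    (g := fun q => M.materialDeriv ψ q + M.div M.v q * ψ q) hT hG he
  have hiref : Integrable (fun z => M.J z * (M.trajDeriv ψ z + ψ (M.Ψ z) * M.D z)) M.ref :=
    integrable_superposition (A := fun y => M.J y.1 * (M.trajDeriv ψ y.1 + ψ (M.Ψ y.1) * M.D y.1))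
      (W := fun _ => 0) (R := 0) hT (continuousOn_fst_left hJG) continuousOn_const
      (Eventually.of_forall fun _ => by simp)
  have key := integral_mul_J_sub (M := M) (F := fun z => ψ (M.Ψ z)) hT hT.le hψc hψ'
    fun p hp t ht => hasDerivAt_trajDeriv hψ hp ht
  rw [← integral_σ_test hT (right_mem_Icc.2 hT.le) hψ, ← integral_σ_test hT h0 hψ,
    intervalIntegral.integral_of_le hT.le, integral_Ioc_eq_integral_Ioo,
    ← integral_prod_symm (μ := M.σ 0) (ν := volume.restrict (Ioo 0 T))
      (fun z => M.J z * (M.trajDeriv ψ z + ψ (M.Ψ z) * M.D z)) hiref] at key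
  rw [integral_μ hT hi.1, add_comm, ← eq_sub_iff_add_eq, key]
  refine integral_congr_ae ((ae_ref_mem hT).mono fun z hz => ?_)
  simp only [he z hz]

end SmoothFunctions

/-! ### The limit of vanishing viscosity -/

section VanishingViscosity

variable {εs : ℕ → ℝ} {ws : ℕ → Amb n × ℝ → ℝ} {w₀s : ℕ → Amb n → ℝ} {u : Amb n × ℝ → ℝ}
  {u₀ : Amb n → ℝ} {R C : ℝ} {η : ℝ → ℝ} {s₀ : ℝ} {ψ : Amb n × ℝ → ℝ}

/-- Viscous solutions with uniform bounds converge almost everywhere. -/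
structure IsViscousLimit (M : MovingHypersurface n T) (f : Amb n × ℝ → ℝ → Amb n) (R : ℝ)
    (εs : ℕ → ℝ) (ws : ℕ → Amb n × ℝ → ℝ) (w₀s : ℕ → Amb n → ℝ) (u : Amb n × ℝ → ℝ)
    (u₀ : Amb n → ℝ) : Prop where
  nonneg : ∀ k, 0 ≤ εs k
  tendsto_zero : Tendsto εs atTop (𝓝 0)
  sol : ∀ k, M.IsViscousSolution f (εs k) (ws k) (w₀s k)
  meas : ∀ k, AEStronglyMeasurable (w₀s k) (M.σ 0)
  bound₀ : ∀ k, ∀ᵐ p ∂(M.σ 0), |w₀s k p| ≤ R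
  bound : ∀ k, ∀ t ∈ Ioo 0 T, ∀ᵐ p ∂(M.σ 0), |ws k (M.Ψ (p, t))| ≤ R
  lim : ∀ᵐ z ∂M.ref, Tendsto (fun k => ws k (M.Ψ z)) atTop (𝓝 (u (M.Ψ z)))
  lim₀ : ∀ᵐ p ∂(M.σ 0), Tendsto (fun k => w₀s k p) atTop (𝓝 (u₀ p))

namespace IsViscousLimit

theorem ae_abs_initial_le (h : M.IsViscousLimit f R εs ws w₀s u u₀) :
    ∀ᵐ p ∂(M.σ 0), |u₀ p| ≤ R := by
  filter_upwards [ae_all_iff.2 h.bound₀, h.lim₀] with p h1 h2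
  exact le_of_tendsto h2.abs (Eventually.of_forall h1)

theorem aestronglyMeasurable_initial (h : M.IsViscousLimit f R εs ws w₀s u u₀)
    (hη : Continuous η) : AEStronglyMeasurable (fun p => η (u₀ p)) (M.σ 0) :=
  hη.comp_aestronglyMeasurable (aestronglyMeasurable_of_tendsto_ae atTop h.meas h.lim₀)

theorem ae_ref_bound (h : M.IsViscousLimit f R εs ws w₀s u u₀) (hT : 0 < T) (k : ℕ) :
    ∀ᵐ z ∂M.ref, |ws k (M.Ψ z)| ≤ R :=
  ae_ref_abs_le hT (h.sol k).continuousOn_comp (h.bound k)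

theorem aestronglyMeasurable_coeff (h : M.IsViscousLimit f R εs ws w₀s u u₀) (hT : 0 < T)
    {Y : Type*} [NormedAddCommGroup Y] [SecondCountableTopology Y] {A : (Amb n × ℝ) × ℝ → Y}
    {g : Amb n × ℝ → Y} (hA : ContinuousOn A ((M.Γ₀ ×ˢ Icc 0 T) ×ˢ univ))
    (hg : ∀ z ∈ M.Γ₀ ×ˢ Ioo 0 T, A (z, u (M.Ψ z)) = g (M.Ψ z)) : AEStronglyMeasurable g M.μ := by
  refine aestronglyMeasurable_μ hT (AEStronglyMeasurable.congr
    (aestronglyMeasurable_superposition hT hA (fun k => (h.sol k).continuousOn_comp) h.lim) ?_)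
  exact (ae_ref_mem hT).mono hg

theorem exists_coeff_bound (h : M.IsViscousLimit f R εs ws w₀s u u₀) (hT : 0 < T)
    {Y : Type*} [NormedAddCommGroup Y] {A : (Amb n × ℝ) × ℝ → Y}
    {g : Amb n × ℝ → Y} (hA : ContinuousOn A ((M.Γ₀ ×ˢ Icc 0 T) ×ˢ univ))
    (hg : ∀ z ∈ M.Γ₀ ×ˢ Ioo 0 T, A (z, u (M.Ψ z)) = g (M.Ψ z)) :
    ∃ C, ∀ᵐ q ∂M.μ, ‖g q‖ ≤ C := by
  obtain ⟨C, hC⟩ := exists_bound_superposition hT hA R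
  refine ⟨C, ae_μ_of_ref hT ?_⟩
  filter_upwards [ae_norm_superposition_le hT hC (ae_abs_le_of_tendsto (h.ae_ref_bound hT) h.lim),
    ae_ref_mem hT] with z h1 h2
  rwa [← hg z h2]

theorem continuousOn_damping (hT : 0 < T) (hη : ContDiff ℝ 2 η) :
    ContinuousOn (fun y : (Amb n × ℝ) × ℝ => M.D y.1 * (y.2 * deriv η y.2 - η y.2))
      ((M.Γ₀ ×ˢ Icc 0 T) ×ˢ univ) :=
  (continuousOn_fst_left (continuousOn_D_Icc hT)).mul
    ((continuous_snd.mul ((contDiff_deriv_of_two hη).continuous.comp continuous_snd)).sub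
      (hη.continuous.comp continuous_snd)).continuousOn

/-- The entropy inequality in the limit of vanishing viscosity, for smooth test functions. -/
theorem entropy_inequality (h : M.IsViscousLimit f R εs ws w₀s u u₀) (hT : 0 < T)
    (hf : M.IsFlux f) (hη : ContDiff ℝ 2 η) (hconv : ∀ s, 0 ≤ deriv (deriv η) s)
    (hC : ∀ s, |s| ≤ R → |η s| ≤ C) (s₀ : ℝ) (hψ : ContDiff ℝ ∞ ψ) (hψ0 : ∀ q, 0 ≤ ψ q) :
    -(∫ x, η (u₀ x) * ψ (x, 0) ∂(M.σ 0)) +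
      ∫ q, (-(η (u q) * M.materialDeriv ψ q) - inner ℝ (entropyFlux η f s₀ q (u q)) (M.grad ψ q)
        + M.div M.v q * (u q * deriv η (u q) - η (u q)) * ψ q) ∂M.μ ≤
      C * ∫ x, ψ (x, T) ∂(M.σ T) := by
  have := isFiniteMeasure_σ_zero (M := M) hT
  have hE := continuousOn_entropyDensity hT hf hη s₀ hψ
  have hL := continuousOn_diffusionDensity (M := M) hT hη hψ
  have hW := fun k => (h.sol k).continuousOn_comp
  have limE := tendsto_integral_superposition hT hE hW (h.ae_ref_bound hT) h.lim
  -- With the Laplacian on `ψ`, the factor of `ε` converges, so the diffusion term disappears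
  -- without any gradient estimate.
  have limL := h.tendsto_zero.mul
    (tendsto_integral_superposition hT hL hW (h.ae_ref_bound hT) h.lim)
  have hψs := integrable_test_slice (M := M) hψ (left_mem_Icc.2 hT.le)
  have lim0 : Tendsto (fun k => ∫ p, η (w₀s k p) * ψ (p, 0) ∂(M.σ 0)) atTop
      (𝓝 (∫ p, η (u₀ p) * ψ (p, 0) ∂(M.σ 0))) := by
    refine tendsto_integral_of_dominated_convergence (fun p => C * |ψ (p, 0)|) (fun k =>
      (hη.continuous.comp_aestronglyMeasurable (h.meas k)).mul hψs.1) (hψs.abs.const_mul C)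
      (fun k => ?_) ?_
    · filter_upwards [h.bound₀ k] with p hp
      rw [Real.norm_eq_abs, abs_mul]
      exact mul_le_mul_of_nonneg_right (hC _ hp) (abs_nonneg _)
    · filter_upwards [h.lim₀] with p hp
      exact ((hη.continuous.tendsto _).comp hp).mul_const _
  have lim := le_of_tendsto ((lim0.neg.sub limE).sub limL) (Eventually.of_forall fun k =>
    (h.sol k).entropy_inequality hT hf (h.nonneg k) (h.meas k) (h.bound k) hη hconv hC s₀ hψ hψ0)
  rw [zero_mul, sub_zero] at lim
  have hEu := aestronglyMeasurable_superposition hT hE hW h.lim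
  -- The entropy density contains the area density `J`; dividing by it recovers the integrand on
  -- `G_T`.
  have he : ∀ z ∈ M.Γ₀ ×ˢ Ioo 0 T, (M.J z)⁻¹ * -M.entropyDensity f η s₀ ψ (z, u (M.Ψ z)) =
      -(η (u (M.Ψ z)) * M.materialDeriv ψ (M.Ψ z)) -
        inner ℝ (entropyFlux η f s₀ (M.Ψ z) (u (M.Ψ z))) (M.grad ψ (M.Ψ z)) +
        M.div M.v (M.Ψ z) * (u (M.Ψ z) * deriv η (u (M.Ψ z)) - η (u (M.Ψ z))) * ψ (M.Ψ z) := by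
    intro z hz
    rw [entropyDensity, ← trajDeriv_eq hψ hz, ← D_eq (Ioo_subset_Icc_self hz.2), ← mul_neg,
      inv_mul_cancel_left₀ (J_pos z).ne']
    ring
  have hm : AEStronglyMeasurable (fun q => -(η (u q) * M.materialDeriv ψ q) -
      inner ℝ (entropyFlux η f s₀ q (u q)) (M.grad ψ q) +
      M.div M.v q * (u q * deriv η (u q) - η (u q)) * ψ q) M.μ := by
    refine aestronglyMeasurable_μ hT (AEStronglyMeasurable.congr
      ((aemeasurable_J hT).inv.aestronglyMeasurable.mul hEu.neg) ?_)
    exact (ae_ref_mem hT).mono he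
  have hI : ∫ q, (-(η (u q) * M.materialDeriv ψ q) -
      inner ℝ (entropyFlux η f s₀ q (u q)) (M.grad ψ q) +
      M.div M.v q * (u q * deriv η (u q) - η (u q)) * ψ q) ∂M.μ =
      -∫ z, M.entropyDensity f η s₀ ψ (z, u (M.Ψ z)) ∂M.ref := by
    rw [integral_μ hT hm, ← integral_neg]
    refine integral_congr_ae ((ae_ref_mem hT).mono fun z hz => ?_)
    simp only [← he z hz]
    rw [mul_inv_cancel_left₀ (J_pos z).ne']
  rw [hI]
  linarith

end IsViscousLimit

end VanishingViscosity

end MovingHypersurface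

/-! ### Convergence of integrals with bounded coefficients -/

namespace MovingSurface

theorem abs_ramp_sub_ramp_le (δ x y : ℝ) : |ramp δ x - ramp δ y| ≤ |x - y| := by
  have h := Convex.norm_image_sub_le_of_norm_deriv_le (f := ramp δ) (C := 1) (s := univ) (x := y)
    (y := x) (fun a _ => (hasDerivAt_ramp δ a).differentiableAt) (fun a _ => ?_) convex_univ
    (mem_univ _) (mem_univ _)
  · simpa using h
  · rw [deriv_ramp, Real.norm_eq_abs, abs_of_nonneg (Real.smoothTransition.nonneg _)]
    exact Real.smoothTransition.le_one _

theorem ramp_le_abs_add {δ : ℝ} (hδ : 0 < δ) (s : ℝ) : ramp δ (s + δ) ≤ |s| + δ := by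
  rcases le_total 0 (s + δ) with h | h
  · exact (ramp_le h).trans (by linarith [le_abs_self s])
  · rw [ramp_of_nonpos hδ h]
    positivity

section Convergence

variable {α E : Type*} [MeasurableSpace α] {m : Measure α} [NormedAddCommGroup E]

/-- On a finite measure space `L²` convergence implies `L¹` convergence, which suffices because all
coefficients of the inequality are bounded. -/
theorem tendsto_integral_norm_sub_of_eLpNorm_two [IsFiniteMeasure m] {g : ℕ → α → E} {g₀ : α → E}
    (hm : ∀ k, AEStronglyMeasurable (g k) m) (hm₀ : AEStronglyMeasurable g₀ m)
    (h : Tendsto (fun k => eLpNorm (fun x => g k x - g₀ x) 2 m) atTop (𝓝 0)) :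
    Tendsto (fun k => ∫ x, ‖g k x - g₀ x‖ ∂m) atTop (𝓝 0) := by
  have h1 : ∀ k, AEStronglyMeasurable (fun x => g k x - g₀ x) m := fun k => (hm k).sub hm₀
  have h2 : Tendsto (fun k => eLpNorm (fun x => g k x - g₀ x) 1 m) atTop (𝓝 0) := by
    have h3 := ENNReal.Tendsto.mul_const (b := m univ ^ (1 / (1 : ENNReal).toReal -
      1 / (2 : ENNReal).toReal)) h (Or.inr (ENNReal.rpow_ne_top_of_nonneg (by norm_num)
        (measure_ne_top _ _)))
    rw [zero_mul] at h3
    exact tendsto_of_tendsto_of_tendsto_of_le_of_le tendsto_const_nhds h3 (fun _ => zero_le)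
      fun k => eLpNorm_le_eLpNorm_mul_rpow_measure_univ one_le_two (h1 k)
  have h4 := (ENNReal.tendsto_toReal ENNReal.zero_ne_top).comp h2
  rw [ENNReal.toReal_zero] at h4
  refine h4.congr fun k => ?_
  rw [integral_norm_eq_lintegral_enorm (h1 k), Function.comp_apply, eLpNorm_one_eq_lintegral_enorm]

theorem integrable_mul_of_ae_le {a g : α → ℝ} {A : ℝ} (ham : AEStronglyMeasurable a m)
    (ha : ∀ᵐ x ∂m, |a x| ≤ A) (hg : Integrable g m) : Integrable (fun x => a x * g x) m := by
  refine (hg.norm.const_mul A).mono' (ham.mul hg.1) (ha.mono fun x hx => ?_)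
  rw [norm_mul]
  exact mul_le_mul_of_nonneg_right hx (norm_nonneg _)

theorem integrable_inner_of_ae_le [InnerProductSpace ℝ E] {b g : α → E} {A : ℝ}
    (hbm : AEStronglyMeasurable b m) (hb : ∀ᵐ x ∂m, ‖b x‖ ≤ A) (hg : Integrable g m) :
    Integrable (fun x => inner ℝ (b x) (g x)) m := by
  refine (hg.norm.const_mul A).mono' (hbm.inner hg.1) (hb.mono fun x hx => ?_)
  exact (norm_inner_le_norm _ _).trans (mul_le_mul_of_nonneg_right hx (norm_nonneg _))

theorem tendsto_integral_of_norm_sub_le {F : ℕ → α → ℝ} {F₀ : α → ℝ} {G : ℕ → α → ℝ}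
    (hF : ∀ k, Integrable (F k) m) (hF₀ : Integrable F₀ m) (hG : ∀ k, Integrable (G k) m)
    (hle : ∀ k, ∀ᵐ x ∂m, |F k x - F₀ x| ≤ G k x)
    (h : Tendsto (fun k => ∫ x, G k x ∂m) atTop (𝓝 0)) :
    Tendsto (fun k => ∫ x, F k x ∂m) atTop (𝓝 (∫ x, F₀ x ∂m)) := by
  rw [tendsto_iff_norm_sub_tendsto_zero]
  refine squeeze_zero (fun _ => norm_nonneg _) (fun k => ?_) h
  rw [← integral_sub (hF k) hF₀]
  refine (norm_integral_le_integral_norm _).trans ?_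
  exact integral_mono_ae ((hF k).sub hF₀).norm (hG k) (hle k)

theorem tendsto_integral_mul_of_ae_le {a : α → ℝ} {A : ℝ} {g : ℕ → α → ℝ} {g₀ : α → ℝ}
    (ham : AEStronglyMeasurable a m) (ha : ∀ᵐ x ∂m, |a x| ≤ A) (hg : ∀ k, Integrable (g k) m)
    (hg₀ : Integrable g₀ m) (h : Tendsto (fun k => ∫ x, ‖g k x - g₀ x‖ ∂m) atTop (𝓝 0)) :
    Tendsto (fun k => ∫ x, a x * g k x ∂m) atTop (𝓝 (∫ x, a x * g₀ x ∂m)) := by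
  refine tendsto_integral_of_norm_sub_le (G := fun k x => A * ‖g k x - g₀ x‖)
    (fun k => integrable_mul_of_ae_le ham ha (hg k)) (integrable_mul_of_ae_le ham ha hg₀)
    (fun k => ((hg k).sub hg₀).norm.const_mul A) (fun k => ha.mono fun x hx => ?_) ?_
  · rw [← mul_sub, abs_mul]
    exact mul_le_mul_of_nonneg_right hx (abs_nonneg _)
  · simp only [integral_const_mul]
    simpa using h.const_mul A

end Convergence

end MovingSurface

/-! ### From smooth to `H¹` test functions -/

namespace MovingHypersurface
open MovingSurface

variable {n : ℕ} {T : ℝ} {M : MovingHypersurface n T}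

section ChainRule

variable {ψ : Amb n × ℝ → ℝ} {θ : ℝ → ℝ}

/-- The chain rule is applied along trajectories, where the derivative is unique although the
derivative within `G_T` is not. -/
theorem ae_materialDeriv_comp (hT : 0 < T) (hψ : ContDiff ℝ ∞ ψ) (hθ : ContDiff ℝ ∞ θ) :
    ∀ᵐ q ∂M.μ, M.materialDeriv (fun q => θ (ψ q)) q = deriv θ (ψ q) * M.materialDeriv ψ q := by
  refine ae_μ_of_ref hT ?_
  filter_upwards [ae_ref_mem hT] with z hz
  have h1 := hasDerivAt_comp_Ψ (M := M) (p := z.1) (t := z.2) hz.1 hz.2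
    (hψ.differentiable (by simp) _).differentiableWithinAt
  have h2 := hasDerivAt_comp_Ψ (M := M) (g := fun q => θ (ψ q)) (p := z.1) (t := z.2) hz.1 hz.2
    ((hθ.comp hψ).differentiable (by simp) _).differentiableWithinAt
  have h3 : HasDerivAt θ (deriv θ (ψ (M.Ψ z))) (ψ (M.Ψ z)) :=
    (hθ.differentiable (by simp) _).hasDerivAt
  exact h2.unique (HasDerivAt.comp z.2 h3 h1)

theorem grad_comp (hψ : ContDiff ℝ ∞ ψ) (hθ : ContDiff ℝ ∞ θ) (q : Amb n × ℝ) :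
    M.grad (fun q => θ (ψ q)) q = deriv θ (ψ q) • M.grad ψ q :=
  tangGrad_comp (g := fun y => ψ (y, q.2))
    ((hψ.comp (contDiff_id.prodMk contDiff_const)).differentiable (by simp) _).differentiableWithinAt
    (hθ.differentiable (by simp) _)

end ChainRule

namespace IsH1

variable {φ φdot : Amb n × ℝ → ℝ} {φgrad : Amb n × ℝ → Amb n} {φ₀ φT : Amb n → ℝ}

theorem integrable (hφ : M.IsH1 φ φdot φgrad φ₀ φT) (hT : 0 < T) : Integrable φ M.μ := by
  have := isFiniteMeasure_μ (M := M) hT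
  exact hφ.memLp.integrable one_le_two

theorem integrable_dot (hφ : M.IsH1 φ φdot φgrad φ₀ φT) (hT : 0 < T) : Integrable φdot M.μ := by
  have := isFiniteMeasure_μ (M := M) hT
  exact hφ.memLp_dot.integrable one_le_two

theorem integrable_grad (hφ : M.IsH1 φ φdot φgrad φ₀ φT) (hT : 0 < T) : Integrable φgrad M.μ := by
  have := isFiniteMeasure_μ (M := M) hT
  exact hφ.memLp_grad.integrable one_le_two

theorem integrable_initial (hφ : M.IsH1 φ φdot φgrad φ₀ φT) (hT : 0 < T) :
    Integrable φ₀ (M.σ 0) := by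
  have := isFiniteMeasure_σ_zero (M := M) hT
  exact hφ.memLp_initial.integrable one_le_two

theorem integrable_final (hφ : M.IsH1 φ φdot φgrad φ₀ φT) (hT : 0 < T) :
    Integrable φT (M.σ T) := by
  have := isFiniteMeasure_σ (M := M) (right_mem_Icc.2 hT.le)
  exact hφ.memLp_final.integrable one_le_two

/-- Approximation by smooth functions, almost everywhere and in `L¹`. -/
theorem exists_approx (hφ : M.IsH1 φ φdot φgrad φ₀ φT) (hT : 0 < T) :
    ∃ ψ : ℕ → Amb n × ℝ → ℝ, (∀ k, ContDiff ℝ ∞ (ψ k)) ∧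
      (∀ᵐ q ∂M.μ, Tendsto (fun k => ψ k q) atTop (𝓝 (φ q))) ∧
      Tendsto (fun k => ∫ q, ‖ψ k q - φ q‖ ∂M.μ) atTop (𝓝 0) ∧
      Tendsto (fun k => ∫ q, ‖M.materialDeriv (ψ k) q - φdot q‖ ∂M.μ) atTop (𝓝 0) ∧
      Tendsto (fun k => ∫ q, ‖M.grad (ψ k) q - φgrad q‖ ∂M.μ) atTop (𝓝 0) ∧
      Tendsto (fun k => ∫ x, ‖ψ k (x, 0) - φ₀ x‖ ∂(M.σ 0)) atTop (𝓝 0) ∧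
      Tendsto (fun k => ∫ x, ‖ψ k (x, T) - φT x‖ ∂(M.σ T)) atTop (𝓝 0) := by
  have := isFiniteMeasure_μ (M := M) hT
  have := isFiniteMeasure_σ_zero (M := M) hT
  have := isFiniteMeasure_σ (M := M) (right_mem_Icc.2 hT.le)
  obtain ⟨ψ, hψ, h1, h2, h3, h4, h5⟩ := hφ.approx
  have hm : TendstoInMeasure M.μ ψ atTop φ := tendstoInMeasure_of_tendsto_eLpNorm two_ne_zero
    (fun k => (integrable_test hT (hψ k)).1) (hφ.integrable hT).1 h1
  obtain ⟨ns, hns, hae⟩ := hm.exists_seq_tendsto_ae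
  have ht := hns.tendsto_atTop
  exact ⟨fun k => ψ (ns k), fun k => hψ _, hae,
    tendsto_integral_norm_sub_of_eLpNorm_two (fun k => (integrable_test hT (hψ _)).1)
      (hφ.integrable hT).1 (h1.comp ht),
    tendsto_integral_norm_sub_of_eLpNorm_two (fun k => (integrable_materialDeriv_test hT (hψ _)).1)
      (hφ.integrable_dot hT).1 (h2.comp ht),
    tendsto_integral_norm_sub_of_eLpNorm_two (fun k => (integrable_grad_test hT (hψ _)).1)
      (hφ.integrable_grad hT).1 (h3.comp ht),
    tendsto_integral_norm_sub_of_eLpNorm_two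
      (fun k => (integrable_test_slice (hψ _) (left_mem_Icc.2 hT.le)).1)
      (hφ.integrable_initial hT).1 (h4.comp ht),
    tendsto_integral_norm_sub_of_eLpNorm_two
      (fun k => (integrable_test_slice (hψ _) (right_mem_Icc.2 hT.le)).1)
      (hφ.integrable_final hT).1 (h5.comp ht)⟩

/-- Conservation of mass. -/
theorem integral_transport (hφ : M.IsH1 φ φdot φgrad φ₀ φT) (hT : 0 < T) :
    (∫ x, φ₀ x ∂(M.σ 0)) + ∫ q, (φdot q + M.div M.v q * φ q) ∂M.μ = ∫ x, φT x ∂(M.σ T) := by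
  obtain ⟨ψ, hψ, -, h1, h2, -, h4, h5⟩ := hφ.exists_approx hT
  obtain ⟨B, hB⟩ := exists_div_v_bound (M := M) hT
  have hDm := (integrable_div_v (M := M) hT).1
  have l0 := tendsto_integral_mul_of_ae_le (a := fun _ => (1 : ℝ)) (A := 1)
    aestronglyMeasurable_const (by simp)
    (fun k => integrable_test_slice (M := M) (hψ k) (left_mem_Icc.2 hT.le))
    (hφ.integrable_initial hT) h4
  have lT := tendsto_integral_mul_of_ae_le (a := fun _ => (1 : ℝ)) (A := 1)
    aestronglyMeasurable_const (by simp)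
    (fun k => integrable_test_slice (M := M) (hψ k) (right_mem_Icc.2 hT.le))
    (hφ.integrable_final hT) h5
  have ld := tendsto_integral_mul_of_ae_le (a := fun _ => (1 : ℝ)) (A := 1)
    aestronglyMeasurable_const (by simp)
    (fun k => integrable_materialDeriv_test (M := M) hT (hψ k)) (hφ.integrable_dot hT) h2
  have lD := tendsto_integral_mul_of_ae_le hDm hB (fun k => integrable_test hT (hψ k))
    (hφ.integrable hT) h1
  simp only [one_mul] at l0 lT ld
  rw [integral_add (hφ.integrable_dot hT) (integrable_mul_of_ae_le hDm hB (hφ.integrable hT))]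
  refine tendsto_nhds_unique (l0.add (ld.add lD)) (lT.congr fun k => ?_)
  rw [← integral_transport_test hT (hψ k), integral_add (integrable_materialDeriv_test hT (hψ k))
    (integrable_mul_of_ae_le hDm hB (integrable_test hT (hψ k)))]

/-- A first order inequality for smooth nonnegative functions, with an error at the final time,
extends to nonnegative `H¹` functions which vanish at the final time. -/
theorem integral_le_zero (hφ : M.IsH1 φ φdot φgrad φ₀ fun _ => 0) (hT : 0 < T)
    (hφ0 : ∀ᵐ q ∂M.μ, 0 ≤ φ q) {a c : Amb n × ℝ → ℝ} {b : Amb n × ℝ → Amb n} {a₀ : Amb n → ℝ}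
    {A C : ℝ} (hA0 : 0 ≤ A) (hC0 : 0 ≤ C)
    (ham : AEStronglyMeasurable a M.μ) (ha : ∀ᵐ q ∂M.μ, |a q| ≤ A)
    (hbm : AEStronglyMeasurable b M.μ) (hb : ∀ᵐ q ∂M.μ, ‖b q‖ ≤ A)
    (hcm : AEStronglyMeasurable c M.μ) (hc : ∀ᵐ q ∂M.μ, |c q| ≤ A)
    (ha₀m : AEStronglyMeasurable a₀ (M.σ 0)) (ha₀ : ∀ᵐ x ∂(M.σ 0), |a₀ x| ≤ A)
    (ha₀' : ∀ᵐ x ∂(M.σ 0), a₀ x ≤ 0)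
    (hI : ∀ ψ : Amb n × ℝ → ℝ, ContDiff ℝ ∞ ψ → (∀ q, 0 ≤ ψ q) →
      -(∫ x, a₀ x * ψ (x, 0) ∂(M.σ 0)) +
        ∫ q, (-(a q * M.materialDeriv ψ q) - inner ℝ (b q) (M.grad ψ q) + c q * ψ q) ∂M.μ ≤
      C * ∫ x, ψ (x, T) ∂(M.σ T)) :
    -(∫ x, a₀ x * φ₀ x ∂(M.σ 0)) +
      ∫ q, (-(a q * φdot q) - inner ℝ (b q) (φgrad q) + c q * φ q) ∂M.μ ≤ 0 := by
  have := isFiniteMeasure_μ (M := M) hT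
  have := isFiniteMeasure_σ_zero (M := M) hT
  have := isFiniteMeasure_σ (M := M) (right_mem_Icc.2 hT.le)
  have hint : ∀ {g d : Amb n × ℝ → ℝ} {w : Amb n × ℝ → Amb n}, Integrable g M.μ → Integrable d M.μ →
      Integrable w M.μ →
      Integrable (fun q => -(a q * d q) - inner ℝ (b q) (w q) + c q * g q) M.μ :=
    fun hg hd hw => ((integrable_mul_of_ae_le ham ha hd).neg.sub
      (integrable_inner_of_ae_le hbm hb hw)).add (integrable_mul_of_ae_le hcm hc hg)
  obtain ⟨ψ, hψ, hae, h1, h2, h3, h4, h5⟩ := hφ.exists_approx hT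
  have hbase := hint (hφ.integrable hT) (hφ.integrable_dot hT) (hφ.integrable_grad hT)
  have hδ : ∀ δ, 0 < δ → -(∫ x, a₀ x * φ₀ x ∂(M.σ 0)) +
      ∫ q, (-(a q * φdot q) - inner ℝ (b q) (φgrad q) + c q * φ q) ∂M.μ ≤
      δ * (C * (M.σ T).real univ + A * M.μ.real univ) := by
    intro δ hδ
    -- The cut-off making the approximations nonnegative: `θ` is smooth, nonnegative and
    -- 1-Lipschitz, satisfies `θ(s) ≥ s`, and equals `s + ramp δ δ` for `s ≥ 0`, where `0 ≤ ramp δ δ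
    -- ≤ δ`. The shift by `δ` gives `θ' = 1` on all of `[0, ∞)`.
    set θ : ℝ → ℝ := fun s => ramp δ (s + δ)
    have hθ : ContDiff ℝ ∞ θ := (contDiff_ramp δ).comp (contDiff_id.add contDiff_const)
    have hθ' : ∀ s, deriv θ s = Real.smoothTransition ((s + δ) / δ) := fun s =>
      ((hasDerivAt_ramp δ (s + δ)).comp_add_const s δ).deriv
    have hθpos : ∀ s, 0 ≤ s → θ s = s + ramp δ δ := fun s hs => by
      simp only [θ]
      rw [ramp_of_le hδ (by linarith)]
      ring
    have hθlip : ∀ x y, |θ x - θ y| ≤ |x - y| := fun x y => by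
      simpa using abs_ramp_sub_ramp_le δ (x + δ) (y + δ)
    have hκ0 := ramp_nonneg hδ δ
    have hκ1 := ramp_le (δ := δ) hδ.le
    have hθψ : ∀ k, ContDiff ℝ ∞ fun q => θ (ψ k q) := fun k => hθ.comp (hψ k)
    set τ : ℕ → Amb n × ℝ → ℝ := fun k q => deriv θ (ψ k q)
    have hτc : Continuous (deriv θ) := hθ.continuous_deriv (by simp)
    have hτ0 : ∀ k q, 0 ≤ τ k q := fun k q => by
      simp only [τ, hθ']
      exact Real.smoothTransition.nonneg _
    have hτ1 : ∀ k q, τ k q ≤ 1 := fun k q => by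
      simp only [τ, hθ']
      exact Real.smoothTransition.le_one _
    have hτm : ∀ k, AEStronglyMeasurable (τ k) M.μ := fun k =>
      (hτc.comp (hψ k).continuous).aestronglyMeasurable
    -- the part of the error which is only pointwise small
    set N : Amb n × ℝ → ℝ := fun q => ‖φdot q‖ + ‖φgrad q‖
    have hN : Integrable N M.μ := (hφ.integrable_dot hT).norm.add (hφ.integrable_grad hT).norm
    have hN0 : ∀ q, 0 ≤ N q := fun q => add_nonneg (norm_nonneg _) (norm_nonneg _)
    have hτb : ∀ k q, |τ k q - 1| ≤ 1 := fun k q => by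
      rw [abs_le]
      constructor <;> linarith [hτ0 k q, hτ1 k q]
    have hNτ : ∀ k, Integrable (fun q => |τ k q - 1| * N q) M.μ := fun k =>
      integrable_mul_of_ae_le (A := 1) ((hτm k).sub aestronglyMeasurable_const).norm
        (Eventually.of_forall fun q => by rw [abs_abs]; exact hτb k q) hN
    have h6 : Tendsto (fun k => ∫ q, |τ k q - 1| * N q ∂M.μ) atTop (𝓝 0) := by
      rw [← integral_zero (Amb n × ℝ) ℝ (μ := M.μ)]
      refine tendsto_integral_of_dominated_convergence N (fun k => (hNτ k).1) hN
        (fun k => Eventually.of_forall fun q => ?_) ?_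
      · rw [norm_mul, Real.norm_of_nonneg (hN0 q), Real.norm_eq_abs, abs_abs]
        exact mul_le_of_le_one_left (hN0 q) (hτb k q)
      · filter_upwards [hae, hφ0] with q h hq
        have h7 := (hτc.tendsto _).comp h
        -- Nonnegativity of `φ` enters here: the cut-off acts as a translation at the limit and
        -- leaves the derivatives of `φ` unchanged.
        have h8 : deriv θ (φ q) = 1 := by
          rw [hθ']
          exact Real.smoothTransition.one_of_one_le ((one_le_div hδ).2 (by linarith))
        rw [h8] at h7
        simpa using ((h7.sub_const 1).abs).mul_const (N q)
    -- convergence of the space-time integrals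
    have hθφ : Integrable (fun q => θ (φ q)) M.μ :=
      ((hφ.integrable hT).add (integrable_const (ramp δ δ))).congr
        (hφ0.mono fun q hq => (hθpos _ hq).symm)
    have limE := tendsto_integral_of_norm_sub_le
      (F := fun k q => -(a q * M.materialDeriv (fun q => θ (ψ k q)) q) -
        inner ℝ (b q) (M.grad (fun q => θ (ψ k q)) q) + c q * θ (ψ k q))
      (F₀ := fun q => -(a q * φdot q) - inner ℝ (b q) (φgrad q) + c q * θ (φ q))
      (G := fun k q => A * (‖ψ k q - φ q‖ + ‖M.materialDeriv (ψ k) q - φdot q‖ +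
        ‖M.grad (ψ k) q - φgrad q‖ + |τ k q - 1| * N q))
      (fun k => hint (integrable_test hT (hθψ k)) (integrable_materialDeriv_test hT (hθψ k))
        (integrable_grad_test hT (hθψ k)))
      (hint hθφ (hφ.integrable_dot hT) (hφ.integrable_grad hT))
      (fun k => (((((integrable_test hT (hψ k)).sub (hφ.integrable hT)).norm.add
        ((integrable_materialDeriv_test hT (hψ k)).sub (hφ.integrable_dot hT)).norm).add
        ((integrable_grad_test hT (hψ k)).sub (hφ.integrable_grad hT)).norm).add
        (hNτ k)).const_mul A)
      (fun k => by
        filter_upwards [ha, hb, hc, ae_materialDeriv_comp hT (hψ k) hθ] with q qa qb qc qd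
        rw [qd, grad_comp (hψ k) hθ]
        -- The factor `τ = θ'(ψ k)` stays on the differences that tend to zero in `L¹`, while `τ -
        -- 1` multiplies the fixed derivatives of `φ` and is handled by dominated convergence
        -- (`h6`).
        have e : -(a q * (deriv θ (ψ k q) * M.materialDeriv (ψ k) q)) -
            inner ℝ (b q) (deriv θ (ψ k q) • M.grad (ψ k) q) + c q * θ (ψ k q) -
            (-(a q * φdot q) - inner ℝ (b q) (φgrad q) + c q * θ (φ q)) =
            -(a q * (τ k q * (M.materialDeriv (ψ k) q - φdot q))) - a q * ((τ k q - 1) * φdot q) -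
            τ k q * inner ℝ (b q) (M.grad (ψ k) q - φgrad q) -
            (τ k q - 1) * inner ℝ (b q) (φgrad q) + c q * (θ (ψ k q) - θ (φ q)) := by
          simp only [inner_sub_right, real_inner_smul_right, τ]
          ring
        have b1 : |a q * (τ k q * (M.materialDeriv (ψ k) q - φdot q))| ≤
            A * ‖M.materialDeriv (ψ k) q - φdot q‖ := by
          rw [abs_mul, abs_mul, abs_of_nonneg (hτ0 k q)]
          exact mul_le_mul qa (mul_le_of_le_one_left (abs_nonneg _) (hτ1 k q))
            (mul_nonneg (hτ0 k q) (abs_nonneg _)) hA0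
        have b2 : |a q * ((τ k q - 1) * φdot q)| ≤ A * (|τ k q - 1| * ‖φdot q‖) := by
          rw [abs_mul, abs_mul]
          exact mul_le_mul_of_nonneg_right qa (by positivity)
        have b3 : |τ k q * inner ℝ (b q) (M.grad (ψ k) q - φgrad q)| ≤
            A * ‖M.grad (ψ k) q - φgrad q‖ := by
          rw [abs_mul, abs_of_nonneg (hτ0 k q)]
          refine (mul_le_of_le_one_left (abs_nonneg _) (hτ1 k q)).trans ?_
          exact (abs_real_inner_le_norm _ _).trans
            (mul_le_mul_of_nonneg_right qb (norm_nonneg _))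
        have b4 : |(τ k q - 1) * inner ℝ (b q) (φgrad q)| ≤ A * (|τ k q - 1| * ‖φgrad q‖) := by
          rw [abs_mul, mul_left_comm]
          exact mul_le_mul_of_nonneg_left ((abs_real_inner_le_norm _ _).trans
            (mul_le_mul_of_nonneg_right qb (norm_nonneg _))) (abs_nonneg _)
        have b5 : |c q * (θ (ψ k q) - θ (φ q))| ≤ A * ‖ψ k q - φ q‖ := by
          rw [abs_mul]
          exact mul_le_mul qc (hθlip _ _) (abs_nonneg _) hA0
        rw [e, abs_le]
        rw [abs_le] at b1 b2 b3 b4 b5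
        simp only [N, mul_add]
        constructor <;> linarith [b1.1, b1.2, b2.1, b2.2, b3.1, b3.2, b4.1, b4.2, b5.1, b5.2])
      (by
        simp only [integral_const_mul]
        have h7 := (((h1.add h2).add h3).add h6).const_mul A
        simp only [add_zero, mul_zero] at h7
        refine h7.congr fun k => ?_
        have i1 : Integrable (fun q => ‖ψ k q - φ q‖) M.μ :=
          ((integrable_test hT (hψ k)).sub (hφ.integrable hT)).norm
        have i2 : Integrable (fun q => ‖M.materialDeriv (ψ k) q - φdot q‖) M.μ :=
          ((integrable_materialDeriv_test hT (hψ k)).sub (hφ.integrable_dot hT)).norm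
        have i3 : Integrable (fun q => ‖M.grad (ψ k) q - φgrad q‖) M.μ :=
          ((integrable_grad_test hT (hψ k)).sub (hφ.integrable_grad hT)).norm
        have i12 : Integrable (fun q => ‖ψ k q - φ q‖ + ‖M.materialDeriv (ψ k) q - φdot q‖) M.μ :=
          i1.add i2
        have i123 : Integrable (fun q => ‖ψ k q - φ q‖ + ‖M.materialDeriv (ψ k) q - φdot q‖ +
          ‖M.grad (ψ k) q - φgrad q‖) M.μ := i12.add i3
        rw [← integral_add i1 i2, ← integral_add i12 i3, ← integral_add i123 (hNτ k)])
    have lim0 := tendsto_integral_mul_of_ae_le ha₀m ha₀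
      (fun k => integrable_test_slice (M := M) (hψ k) (left_mem_Icc.2 hT.le))
      (hφ.integrable_initial hT) h4
    have limT := (h5.add_const (δ * (M.σ T).real univ)).const_mul C
    rw [zero_add] at limT
    have key := le_of_tendsto_of_tendsto (lim0.neg.add limE) limT (Eventually.of_forall fun k => by
      have k1 := hI _ (hθψ k) fun q => ramp_nonneg hδ _
      have s0 := integrable_test_slice (M := M) (hψ k) (left_mem_Icc.2 hT.le)
      have s0' := integrable_test_slice (M := M) (hθψ k) (left_mem_Icc.2 hT.le)
      have sT := integrable_test_slice (M := M) (hψ k) (right_mem_Icc.2 hT.le)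
      have sT' := integrable_test_slice (M := M) (hθψ k) (right_mem_Icc.2 hT.le)
      -- Since `θ(s) ≥ s` and `a₀ ≤ 0`, removing the cut-off at time `0` errs on the right side. No
      -- sign of the trace of `φ` is needed.
      have k2 : ∫ x, a₀ x * θ (ψ k (x, 0)) ∂(M.σ 0) ≤ ∫ x, a₀ x * ψ k (x, 0) ∂(M.σ 0) := by
        refine integral_mono_ae (integrable_mul_of_ae_le ha₀m ha₀ s0')
          (integrable_mul_of_ae_le ha₀m ha₀ s0) (ha₀'.mono fun x hx => ?_)
        refine mul_le_mul_of_nonpos_left ?_ hx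
        have := sub_le_ramp hδ (ψ k (x, 0) + δ)
        simp only [θ]
        linarith
      have k3 : ∫ x, θ (ψ k (x, T)) ∂(M.σ T) ≤
          (∫ x, ‖ψ k (x, T) - 0‖ ∂(M.σ T)) + δ * (M.σ T).real univ := by
        have i1 : Integrable (fun x => ‖ψ k (x, T) - 0‖) (M.σ T) := (sT.sub (integrable_zero _ _ _)).norm
        have i2 : ∫ x, θ (ψ k (x, T)) ∂(M.σ T) ≤ ∫ x, (‖ψ k (x, T) - 0‖ + δ) ∂(M.σ T) := by
          refine integral_mono sT' (i1.add (integrable_const _)) fun x => ?_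
          simpa using ramp_le_abs_add hδ (ψ k (x, T))
        rw [integral_add i1 (integrable_const _), integral_const, smul_eq_mul,
          mul_comm _ δ] at i2
        exact i2
      have k4 := mul_le_mul_of_nonneg_left k3 hC0
      linarith)
    -- Replacing `θ(φ) = φ + ramp δ δ` by `φ` costs at most `A δ` pointwise.
    have hsplit : ∫ q, (-(a q * φdot q) - inner ℝ (b q) (φgrad q) + c q * φ q) ∂M.μ ≤
        (∫ q, (-(a q * φdot q) - inner ℝ (b q) (φgrad q) + c q * θ (φ q)) ∂M.μ) +
        M.μ.real univ * (A * δ) := by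
      have i1 := hint hθφ (hφ.integrable_dot hT) (hφ.integrable_grad hT)
      rw [← smul_eq_mul (M.μ.real univ), ← integral_const, ← integral_add i1 (integrable_const _)]
      refine integral_mono_ae hbase (i1.add (integrable_const _)) ?_
      filter_upwards [hφ0, hc] with q hq qc
      have e1 : -(A * δ) ≤ c q * ramp δ δ := by
        have : |c q * ramp δ δ| ≤ A * δ := by
          rw [abs_mul, abs_of_nonneg hκ0]
          exact mul_le_mul qc hκ1 hκ0 hA0
        exact (abs_le.1 this).1
      rw [hθpos _ hq]
      linarith
    linarith
  have hlim : Tendsto (fun δ : ℝ => δ * (C * (M.σ T).real univ + A * M.μ.real univ)) (𝓝[>] 0)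
      (𝓝 0) := by
    have := ((continuous_mul_const (C * (M.σ T).real univ + A * M.μ.real univ)).tendsto 0).mono_left
      (nhdsWithin_le_nhds (s := Ioi 0))
    rwa [zero_mul] at this
  exact ge_of_tendsto hlim (eventually_mem_nhdsWithin.mono fun δ h => hδ δ h)

end IsH1

end MovingHypersurface

end

/-! ### The entropy inequality for the limit -/

open MovingSurface
theorem mainTheorem7 {n : ℕ} {T : ℝ} (hT : 0 < T) (M : MovingHypersurface n T)
    (f : Amb n × ℝ → ℝ → Amb n) (hf : M.IsFlux f)
    (Λ : Set ℝ) (hΛ : Λ ⊆ Ioc 0 1) (hΛ0 : (0 : ℝ) ∈ closure Λ)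
    (uε : ℝ → Amb n × ℝ → ℝ) (u0ε : ℝ → Amb n → ℝ) (c₀ : ℝ)
    (hu0ε_meas : ∀ ε ∈ Λ, AEStronglyMeasurable (u0ε ε) (M.σ 0))
    (hu0ε_bdd : ∀ ε ∈ Λ, ∀ᵐ x ∂(M.σ 0), |u0ε ε x| ≤ c₀)
    (hsol : ∀ ε ∈ Λ, M.IsViscousSolution f ε (uε ε) (u0ε ε))
    (u : Amb n × ℝ → ℝ) (u₀ : Amb n → ℝ)
    (hu : Integrable u M.μ) (hu₀ : MemLp u₀ ⊤ (M.σ 0))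
    (hconv : ∀ᵐ p ∂M.μ, Tendsto (fun ε => uε ε p) (𝓝[Λ] 0) (𝓝 (u p)))
    (hconv₀ : ∀ᵐ x ∂(M.σ 0), Tendsto (fun ε => u0ε ε x) (𝓝[Λ] 0) (𝓝 (u₀ x)))
    (η : ℝ → ℝ) (hη : ContDiff ℝ 2 η) (hη_convex : ∀ s, 0 ≤ deriv (deriv η) s) (s₀ : ℝ)
    (φ φdot : Amb n × ℝ → ℝ) (φgrad : Amb n × ℝ → Amb n) (φ₀ : Amb n → ℝ)
    (hφ : M.IsH1 φ φdot φgrad φ₀ (fun _ => 0)) (hφ_nonneg : ∀ᵐ p ∂M.μ, 0 ≤ φ p) :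
    Integrable (fun x => η (u₀ x) * φ₀ x) (M.σ 0) ∧
    Integrable (fun p => -(η (u p) * φdot p) - inner ℝ (entropyFlux η f s₀ p (u p)) (φgrad p)
      + M.div M.v p * (u p * deriv η (u p) - η (u p)) * φ p) M.μ ∧
    -(∫ x, η (u₀ x) * φ₀ x ∂(M.σ 0)) +
      ∫ p, (-(η (u p) * φdot p) - inner ℝ (entropyFlux η f s₀ p (u p)) (φgrad p)
        + M.div M.v p * (u p * deriv η (u p) - η (u p)) * φ p) ∂M.μ ≤ 0 := by
  have := MovingHypersurface.isFiniteMeasure_σ_zero (M := M) hT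
  have := MovingHypersurface.isFiniteMeasure_μ (M := M) hT
  -- One sequence in `Λ` is enough, the limits `u` and `u₀` being prescribed. The interval `[-R, R]`
  -- below contains almost all values of the data, the solutions and their limits.
  obtain ⟨εs, hεΛ, hε0⟩ := mem_closure_iff_seq_limit.1 hΛ0
  obtain ⟨R, hcR, hR⟩ := MovingHypersurface.IsViscousSolution.exists_bound M hT hf c₀
  have hεt : Tendsto εs atTop (𝓝[Λ] 0) := tendsto_nhdsWithin_iff.2 ⟨hε0, Eventually.of_forall hεΛ⟩
  have h : M.IsViscousLimit f R εs (fun k => uε (εs k)) (fun k => u0ε (εs k)) u u₀ :=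
    { nonneg := fun k => (hΛ (hεΛ k)).1.le
      tendsto_zero := hε0
      sol := fun k => hsol _ (hεΛ k)
      meas := fun k => hu0ε_meas _ (hεΛ k)
      bound₀ := fun k => (hu0ε_bdd _ (hεΛ k)).mono fun x hx => hx.trans hcR
      bound := fun k => hR _ _ _ (hΛ (hεΛ k)).1.le (hsol _ (hεΛ k)) (hu0ε_meas _ (hεΛ k))
        (hu0ε_bdd _ (hεΛ k))
      lim := (MovingHypersurface.ae_ref_of_μ hT hconv).mono fun z hz => hz.comp hεt
      lim₀ := hconv₀.mono fun x hx => hx.comp hεt }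
  obtain ⟨C', hC'⟩ := (isCompact_Icc (a := -R) (b := R)).exists_bound_of_continuousOn
    hη.continuous.continuousOn
  set C := max C' 0
  have hC0 : 0 ≤ C := le_max_right _ _
  have hC : ∀ s, |s| ≤ R → |η s| ≤ C := fun s hs =>
    (hC' s (abs_le.1 hs)).trans (le_max_left _ _)
  -- The shift makes the entropy nonpositive at `u₀`, as `IsH1.integral_le_zero` requires. It
  -- changes neither `η'` nor the entropy flux, and `|ζ| ≤ 2 C` on `[-R, R]`.
  set ζ : ℝ → ℝ := fun s => η s - C
  have hζ : ContDiff ℝ 2 ζ := hη.sub contDiff_const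
  have hζd : deriv ζ = deriv η := funext fun s => deriv_sub_const (f := η) C
  have hζq : ∀ p s, entropyFlux ζ f s₀ p s = entropyFlux η f s₀ p s := fun p s => by
    simp only [entropyFlux, hζd]
  have hζC : ∀ s, |s| ≤ R → |ζ s| ≤ 2 * C := fun s hs => by
    have := abs_le.1 (hC s hs)
    simp only [ζ]
    rw [abs_le]
    constructor <;> linarith
  -- the coefficients are bounded and measurable
  have cη : ∀ {κ : ℝ → ℝ}, ContDiff ℝ 2 κ → ContinuousOn (fun y : (Amb n × ℝ) × ℝ => κ y.2)
      ((M.Γ₀ ×ˢ Icc 0 T) ×ˢ univ) := fun hκ => (hκ.continuous.comp continuous_snd).continuousOn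
  have cq := MovingHypersurface.continuousOn_entropyFlux_comp (M := M) hf hη s₀
  have cd : ∀ {κ : ℝ → ℝ}, ContDiff ℝ 2 κ → _ := fun hκ =>
    MovingHypersurface.IsViscousLimit.continuousOn_damping (M := M) hT hκ
  have ed : ∀ {κ : ℝ → ℝ}, ∀ z ∈ M.Γ₀ ×ˢ Ioo 0 T,
      M.D z * (u (M.Ψ z) * deriv κ (u (M.Ψ z)) - κ (u (M.Ψ z))) =
      M.div M.v (M.Ψ z) * (u (M.Ψ z) * deriv κ (u (M.Ψ z)) - κ (u (M.Ψ z))) := fun z hz => by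
    rw [MovingHypersurface.D_eq (Ioo_subset_Icc_self hz.2)]
  have am : ∀ {κ : ℝ → ℝ}, ContDiff ℝ 2 κ → AEStronglyMeasurable (fun q => κ (u q)) M.μ :=
    fun hκ => h.aestronglyMeasurable_coeff hT (cη hκ) fun _ _ => rfl
  have bm : AEStronglyMeasurable (fun q => entropyFlux η f s₀ q (u q)) M.μ :=
    h.aestronglyMeasurable_coeff hT cq fun _ _ => rfl
  have dm : ∀ {κ : ℝ → ℝ}, ContDiff ℝ 2 κ → AEStronglyMeasurable
      (fun q => M.div M.v q * (u q * deriv κ (u q) - κ (u q))) M.μ :=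
    fun hκ => h.aestronglyMeasurable_coeff hT (cd hκ) ed
  obtain ⟨A1, hA1⟩ := h.exists_coeff_bound (g := fun q => η (u q)) hT (cη hη) fun _ _ => rfl
  obtain ⟨A2, hA2⟩ := h.exists_coeff_bound (g := fun q => ζ (u q)) hT (cη hζ) fun _ _ => rfl
  obtain ⟨A3, hA3⟩ := h.exists_coeff_bound (g := fun q => entropyFlux η f s₀ q (u q)) hT cq
    fun _ _ => rfl
  obtain ⟨A4, hA4⟩ := h.exists_coeff_bound
    (g := fun q => M.div M.v q * (u q * deriv η (u q) - η (u q))) hT (cd hη) ed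
  obtain ⟨A5, hA5⟩ := h.exists_coeff_bound
    (g := fun q => M.div M.v q * (u q * deriv ζ (u q) - ζ (u q))) hT (cd hζ) ed
  obtain ⟨B, hB⟩ := MovingHypersurface.exists_div_v_bound (M := M) hT
  have hη0 : ∀ᵐ x ∂(M.σ 0), |η (u₀ x)| ≤ C := h.ae_abs_initial_le.mono fun x hx => hC _ hx
  have hζ0 : ∀ᵐ x ∂(M.σ 0), |ζ (u₀ x)| ≤ 2 * C := h.ae_abs_initial_le.mono fun x hx => hζC _ hx
  have iφ := hφ.integrable hT
  have iφd := hφ.integrable_dot hT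
  have iφg := hφ.integrable_grad hT
  have iφ0 := hφ.integrable_initial hT
  have int0 : Integrable (fun x => η (u₀ x) * φ₀ x) (M.σ 0) :=
    integrable_mul_of_ae_le (h.aestronglyMeasurable_initial hη.continuous) hη0 iφ0
  have int1 : Integrable (fun p => -(η (u p) * φdot p) -
      inner ℝ (entropyFlux η f s₀ p (u p)) (φgrad p) +
      M.div M.v p * (u p * deriv η (u p) - η (u p)) * φ p) M.μ :=
    ((integrable_mul_of_ae_le (am hη) hA1 iφd).neg.sub
      (integrable_inner_of_ae_le bm hA3 iφg)).add (integrable_mul_of_ae_le (dm hη) hA4 iφ)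
  refine ⟨int0, int1, ?_⟩
  set A := max (max (max A2 A3) (max A5 (2 * C))) 0
  have a2 : A2 ≤ A := (le_max_left _ _).trans ((le_max_left _ _).trans (le_max_left _ _))
  have a3 : A3 ≤ A := (le_max_right _ _).trans ((le_max_left _ _).trans (le_max_left _ _))
  have a5 : A5 ≤ A := (le_max_left _ _).trans ((le_max_right _ _).trans (le_max_left _ _))
  have a6 : 2 * C ≤ A := (le_max_right _ _).trans ((le_max_right _ _).trans (le_max_left _ _))
  have key := hφ.integral_le_zero hT hφ_nonneg (A := A) (C := 2 * C) (le_max_right _ _)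
    (by positivity) (am hζ) (hA2.mono fun q hq => hq.trans a2) bm
    (hA3.mono fun q hq => hq.trans a3) (dm hζ) (hA5.mono fun q hq => hq.trans a5)
    (h.aestronglyMeasurable_initial hζ.continuous) (hζ0.mono fun x hx => hx.trans a6)
    (hη0.mono fun x hx => by
      have := (abs_le.1 hx).2
      simp only [ζ]
      linarith)
    fun ψ hψ hψ0 => by
      have := h.entropy_inequality hT hf hζ (fun s => by rw [hζd]; exact hη_convex s) hζC s₀ hψ hψ0
      simpa only [hζq] using this
  -- Undoing the shift adds `C` times the mass balance of `φ`, which is zero because the trace at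
  -- time `T` vanishes.
  have htr := hφ.integral_transport hT
  rw [integral_zero] at htr
  have itr : Integrable (fun q => φdot q + M.div M.v q * φ q) M.μ := iφd.add
    (integrable_mul_of_ae_le (MovingHypersurface.integrable_div_v hT).1 hB iφ)
  have e0 : ∫ x, ζ (u₀ x) * φ₀ x ∂(M.σ 0) =
      (∫ x, η (u₀ x) * φ₀ x ∂(M.σ 0)) - C * ∫ x, φ₀ x ∂(M.σ 0) := by
    rw [← integral_const_mul, ← integral_sub int0 (iφ0.const_mul C)]
    refine integral_congr_ae (Eventually.of_forall fun x => ?_)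
    simp only [ζ]
    ring
  have e1 : ∫ q, (-(ζ (u q) * φdot q) - inner ℝ (entropyFlux η f s₀ q (u q)) (φgrad q) +
      M.div M.v q * (u q * deriv ζ (u q) - ζ (u q)) * φ q) ∂M.μ =
      (∫ p, (-(η (u p) * φdot p) - inner ℝ (entropyFlux η f s₀ p (u p)) (φgrad p) +
      M.div M.v p * (u p * deriv η (u p) - η (u p)) * φ p) ∂M.μ) +
      C * ∫ q, (φdot q + M.div M.v q * φ q) ∂M.μ := by
    rw [← integral_const_mul, ← integral_add int1 (itr.const_mul C)]
    refine integral_congr_ae (Eventually.of_forall fun q => ?_)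
    simp only [hζd, ζ]
    ring
  rw [e0, e1] at key
  have e2 : C * (∫ x, φ₀ x ∂(M.σ 0)) + C * ∫ q, (φdot q + M.div M.v q * φ q) ∂M.μ = 0 := by
    rw [← mul_add, htr, mul_zero]
  linarith
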